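/- **Notation.** For $B\in\mathbb R^{d\times d}$ let $\lambda_{1,\mathsf{bin}}(B)=\min\{\|Bz-Bz'\|_2 : z\ne z'\in\{-1,1\}^d\}$. An instance of $\mathsf{BinaryBDD}_{d,\alpha}$ is a pair $(B,t)$ with $t=Bz+e$, $z\in\{-1,1\}^d$, $\|e\|_2\le\alpha\,\lambda_{1,\mathsf{bin}}(B)$; the task is to find $z$. We assume $\lambda_{1,\mathsf{bin}}(B)>0$, and an integer $\ell\ge 0$ with $2^{-\ell}\le\lambda_{1,\mathsf{bin}}(B)\le 2^{\ell}$ (a bound on the size of the description of the instance) is part of the input. A solution of a $k$-$\mathsf{SLR}$ instance $(X,y,\delta)$, $X\in\mathbb R^{m\times n}$, $y\in\mathbb R^m$, is a $\theta\in\mathbb R^n$ with at most $k$ non-zero entries and $\frac1m\|X\theta-y\|_2^2\le\delta^2$; the task is to find a solution whenever one exists. When $k\mid d$ and $n=k\,2^{d/k}$, let $G_{\mathsf{sparse}}\in\mathbb R^{d\times n}$ be the block diagonal matrix with $k$ identical blocks of size $(d/k)\times 2^{d/k}$ whose columns are all vectors of $\{-1,1\}^{d/k}$ in a fixed order, and let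 $G_{\mathsf{partite}}\in\mathbb R^{k\times n}$ be the block diagonal matrix with $k$ identical blocks $(1,\dots,1)\in\mathbb R^{1\times n/k}$. Algorithms are real-RAM programs that may draw a standard Gaussian in one step and may query a $k$-$\mathsf{SLR}$ oracle in dimension $n$ with $m$ samples, a query costing the size of the instance and of the answer. **Statement.** There are a single randomized oracle program and universal positive constants $C_0,C,c,\delta_1,\delta_2,\sigma_1,\sigma_2$ such that the following holds for all integers $d\ge1$, $k\mid d$, $m\ge C_0d$, $n=k\,2^{d/k}$, $\ell\ge 0$. 1. On every input $(\alpha,B,t,\ell)$, for every outcome of its coins and every oracle, the program makes at most $C(n+m)^C(\ell+1)$ steps. 2. Let $0\le\alpha\le c/(m\sqrt{\log m})$, and let $(B,t)$ be a $\mathsf{BinaryBDD}_{d,\alpha}$ instance with solution $z$ and $2^{-\ell}\le\lambda_{1,\mathsf{bin}}(B)\le2^\ell$. Then one of the queries of the program, whose position $i$ depends on the instance but not on the coins or the oracle, is a $k$-$\mathsf{SLR}$ instance $(X,y,\delta)$ that is determined by the coins alone and has the following properties. * (Parameter.) $\delta$ is deterministic and $\delta_1\lambda_{1,\mathsf{bin}}(B)\le\delta\le\delta_2\lambda_{1,\mathsf{bin}}(B)$.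 * (Design matrix.) $X=\begin{pmatrix}X_1\\X_2\end{pmatrix}$, where the $m-k$ rows of $X_1$ are i.i.d. $\mathcal N(0,G_{\mathsf{sparse}}^\top B^\top B\,G_{\mathsf{sparse}})$ and $X_2=\gamma\,G_{\mathsf{partite}}$ for a deterministic $\gamma\in\mathbb R$. * (Noise.) There are a fixed $k$-sparse vector $\theta^*$ and a real $\sigma$ with $\sigma_1\,\alpha\lambda_{1,\mathsf{bin}}(B)m\sqrt{\log m}\le\sigma\le\sigma_2\,\alpha\lambda_{1,\mathsf{bin}}(B)m\sqrt{\log m}$ such that the law of the noise $w=y-X\theta^*$ is within total variation distance $1/2$ of $\mathcal N(0,\sigma^2)^{\otimes m}$. Moreover the noise is close to being independent of the design: the joint law of $(X_1,w)$ is within total variation distance $1/2$ of the product of the law of $X_1$ and $\mathcal N(0,\sigma^2)^{\otimes m}$. * (Success.) With probability at least $9/10$ over the coins, the instance $(X,y,\delta)$ has a solution, and the program outputs $z$ whenever the oracle answers $(X,y,\delta)$ with a solution. In particular the program outputs $z$ with probability at least $9/10$ for every oracle that solves $k$-$\mathsf{SLR}$. -/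

import Mathlib

open MeasureTheory ProbabilityTheory

noncomputable section

/-- The Euclidean norm of a real vector. -/
def l2norm {ι : Type} [Fintype ι] (v : ι → ℝ) : ℝ :=
  ‖(WithLp.toLp 2 v : EuclideanSpace ℝ ι)‖

/-! ### Binary bounded distance decoding -/

/-- `z ∈ {-1, 1}^d`. -/
def IsSignVector {d : ℕ} (z : Fin d → ℝ) : Prop :=
  ∀ i, z i = 1 ∨ z i = -1

/-- The binary minimum distance of `B`: the least distance `‖B z - B z'‖` between
the images of two distinct vectors of `{-1, 1}^d`. For `1 ≤ d` the set below is finite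
and nonempty, so that the infimum is a minimum. -/
def lambdaBin {d : ℕ} (B : Matrix (Fin d) (Fin d) ℝ) : ℝ :=
  sInf {r : ℝ | ∃ z z' : Fin d → ℝ, IsSignVector z ∧ IsSignVector z' ∧ z ≠ z' ∧
    r = l2norm (B.mulVec z - B.mulVec z')}

/-- `(B, t)` is an instance of binary BDD with parameter `α` whose solution is `z`:
`t = B z + e` with `z ∈ {-1, 1}^d` and `‖e‖ ≤ α · lambdaBin B`. -/
def IsBinaryBDD {d : ℕ} (α : ℝ) (B : Matrix (Fin d) (Fin d) ℝ) (t z : Fin d → ℝ) : Prop :=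
  IsSignVector z ∧ ∃ e : Fin d → ℝ, t = B.mulVec z + e ∧ l2norm e ≤ α * lambdaBin B

/-! ### Sparse linear regression -/

/-- An instance `(X, y, δ)` of sparse linear regression in dimension `n` with `m` samples. -/
structure SLRInstance (m n : ℕ) where
  X : Matrix (Fin m) (Fin n) ℝ
  y : Fin m → ℝ
  δ : ℝ

/-- `θ` has at most `k` non-zero entries. -/
def IsSparse {n : ℕ} (k : ℕ) (θ : Fin n → ℝ) : Prop :=
  (Finset.univ.filter fun j => θ j ≠ 0).card ≤ k

/-- `θ` solves the `k`-SLR instance `(X, y, δ)`: it is `k`-sparse and its mean squared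
error `‖X θ - y‖² / m` is at most `δ²`. -/
def SLRInstance.IsSolution {m n : ℕ} (q : SLRInstance m n) (k : ℕ) (θ : Fin n → ℝ) : Prop :=
  IsSparse k θ ∧ l2norm (q.X.mulVec θ - q.y) ^ 2 / m ≤ q.δ ^ 2

/-! ### The gadget matrices -/

/-- The block diagonal `d × n` matrix with `k` identical blocks of size `(d/k) × (n/k)`;
for `n/k = 2^(d/k)` the columns of a block are all the vectors of `{-1, 1}^(d/k)`, the
`j`-th one being read off the binary digits of `j`. -/
def Gsparse (d k n : ℕ) : Matrix (Fin d) (Fin n) ℝ := fun a b =>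
  if (a : ℕ) / (d / k) = (b : ℕ) / (n / k) then
    if Nat.testBit ((b : ℕ) % (n / k)) ((a : ℕ) % (d / k)) then 1 else -1
  else 0

/-- The block diagonal `k × n` matrix with `k` identical blocks `(1, …, 1)` of size
`1 × (n/k)`. -/
def Gpartite (k n : ℕ) : Matrix (Fin k) (Fin n) ℝ := fun a b =>
  if (a : ℕ) = (b : ℕ) / (n / k) then 1 else 0

/-- The `m × n` matrix whose first `m - k` rows are those of `X₁` and whose last `k` rows
are those of `X₂`. -/
def stackRows {m n k : ℕ} (X₁ : Fin (m - k) → EuclideanSpace ℝ (Fin n))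
    (X₂ : Matrix (Fin k) (Fin n) ℝ) : Matrix (Fin m) (Fin n) ℝ := fun i j =>
  if h : (i : ℕ) < m - k then X₁ ⟨i, h⟩ j
  else X₂ ⟨(i : ℕ) - (m - k), by have := i.isLt; omega⟩ j

/-! ### Probability -/

/-- Total variation distance of two probability measures. -/
def tvDist {Ω : Type} [MeasurableSpace Ω] (μ ν : Measure Ω) : ℝ :=
  sSup {r : ℝ | ∃ A : Set Ω, MeasurableSet A ∧ r = |μ.real A - ν.real A|}

/-- `N(0, σ²)^{⊗ m}`. -/
def gaussianNoise (m : ℕ) (σ : ℝ) : Measure (Fin m → ℝ) :=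
  Measure.pi fun _ => gaussianReal 0 (σ ^ 2).toNNReal

/-- The law of the random tape of a randomized algorithm: an infinite sequence of
independent standard Gaussians. -/
def tapeLaw : Measure (ℕ → ℝ) :=
  Measure.infinitePi fun _ => gaussianReal 0 1

/-! ### Randomized real-RAM programs with an oracle for sparse linear regression

A machine has index registers, which hold natural numbers, and two-dimensional arrays of
exact real numbers. A program names finitely many registers and arrays; array entries are
addressed through index registers. Arithmetic on reals, comparison, and drawing one
standard Gaussian cost one step each. -/

/-- The entry of the array `arr` whose row and column are the current values of the index
registers `row` and `col`. -/
structure Cell where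
  arr : ℕ
  row : ℕ
  col : ℕ

inductive Instr where
  /-- index register `i` := the constant `c` -/
  | setIdx (i c : ℕ)
  /-- index register `i` := sum of the index registers `j` and `l` -/
  | addIdx (i j l : ℕ)
  /-- index register `i` := truncated difference of the index registers `j` and `l` -/
  | subIdx (i j l : ℕ)
  /-- real cell := a rational constant -/
  | setReal (x : Cell) (q : ℚ)
  /-- real cell := the number held by the index register `i` -/
  | castReal (x : Cell) (i : ℕ)
  | addReal (x u v : Cell)
  | subReal (x u v : Cell)
  | mulReal (x u v : Cell)
  /-- division, with the value `0` if the divisor is `0` -/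
  | divReal (x u v : Cell)
  /-- real cell := the next Gaussian of the random tape -/
  | gauss (x : Cell)
  /-- Ask the oracle for the instance with design matrix in the array `aX`, response vector
  in column `0` of the array `ay` and error parameter in the entry `(0, 0)` of the array
  `aδ`; the answer is written into column `0` of the array `aθ`. -/
  | query (aX ay aδ aθ : ℕ)

inductive Prog where
  | instr (c : Instr)
  | seq (p q : Prog)
  /-- run `p` if index register `i` is less than index register `j`, and `q` otherwise -/
  | iteIdx (i j : ℕ) (p q : Prog)
  /-- run `p` if the real cell `x` is less than the real cell `y`, and `q` otherwise -/
  | iteReal (x y : Cell) (p q : Prog)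
  /-- repeat `p` as often as the value of index register `i` on entry says -/
  | loop (i : ℕ) (p : Prog)

structure RState (m n : ℕ) where
  idx : ℕ → ℕ
  mem : ℕ → ℕ → ℕ → ℝ
  /-- number of Gaussians drawn so far -/
  draws : ℕ
  /-- number of steps made so far -/
  time : ℕ
  /-- the oracle queries made so far, the earliest one first -/
  queries : List (SLRInstance m n)

/-- An oracle: a map from instances to candidate solutions. -/
abbrev SLROracle (m n : ℕ) : Type := SLRInstance m n → Fin n → ℝ

namespace RState

variable {m n : ℕ}

def tick (s : RState m n) (c : ℕ) : RState m n := { s with time := s.time + c }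

def get (s : RState m n) (x : Cell) : ℝ := s.mem x.arr (s.idx x.row) (s.idx x.col)

def set (s : RState m n) (x : Cell) (r : ℝ) : RState m n :=
  { s with mem := fun a i j =>
      if a = x.arr ∧ i = s.idx x.row ∧ j = s.idx x.col then r else s.mem a i j }

def setIdx (s : RState m n) (i v : ℕ) : RState m n :=
  { s with idx := Function.update s.idx i v }

/-- The instance that a query with the given arrays asks about. -/
def readQuery (s : RState m n) (aX ay aδ : ℕ) : SLRInstance m n where
  X := fun i j => s.mem aX i j
  y := fun i => s.mem ay i 0
  δ := s.mem aδ 0 0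

/-- Writes the vector `θ` into column `0` of the array `a`. -/
def writeVec (s : RState m n) (a : ℕ) (θ : Fin n → ℝ) : RState m n :=
  { s with mem := fun b i j =>
      if h : b = a ∧ j = 0 ∧ i < n then θ ⟨i, h.2.2⟩ else s.mem b i j }

end RState

/-- The effect of one instruction, for the random tape `ω` and the oracle `O`. Every
instruction costs one step, except that a query is charged for the size of the instance
and of the answer as well. -/
def Instr.exec {m n : ℕ} (ω : ℕ → ℝ) (O : SLROracle m n) :
    Instr → RState m n → RState m n
  | .setIdx i c, s => (s.setIdx i c).tick 1
  | .addIdx i j l, s => (s.setIdx i (s.idx j + s.idx l)).tick 1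
  | .subIdx i j l, s => (s.setIdx i (s.idx j - s.idx l)).tick 1
  | .setReal x q, s => (s.set x (q : ℝ)).tick 1
  | .castReal x i, s => (s.set x (s.idx i : ℝ)).tick 1
  | .addReal x u v, s => (s.set x (s.get u + s.get v)).tick 1
  | .subReal x u v, s => (s.set x (s.get u - s.get v)).tick 1
  | .mulReal x u v, s => (s.set x (s.get u * s.get v)).tick 1
  | .divReal x u v, s => (s.set x (s.get u / s.get v)).tick 1
  | .gauss x, s => ({ s.set x (ω s.draws) with draws := s.draws + 1 } : RState m n).tick 1
  | .query aX ay aδ aθ, s =>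
      ({ s.writeVec aθ (O (s.readQuery aX ay aδ)) with
          queries := s.queries ++ [s.readQuery aX ay aδ] } : RState m n).tick
        (m * n + m + n + 1)

open Classical in
/-- The effect of a program. A test costs one step, and so does every round of a loop and
its entry. -/
def Prog.run {m n : ℕ} (ω : ℕ → ℝ) (O : SLROracle m n) :
    Prog → RState m n → RState m n
  | .instr c, s => c.exec ω O s
  | .seq p q, s => q.run ω O (p.run ω O s)
  | .iteIdx i j p q, s =>
      if s.idx i < s.idx j then p.run ω O (s.tick 1) else q.run ω O (s.tick 1)
  | .iteReal x y p q, s =>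
      if s.get x < s.get y then p.run ω O (s.tick 1) else q.run ω O (s.tick 1)
  | .loop i p, s => (fun s' => (p.run ω O s').tick 1)^[s.idx i] (s.tick 1)

/-- The initial state: the index registers `0, …, 4` hold `d, k, m, n, ℓ`, the entry
`(0, 0)` of the array `0` holds `α`, the array `1` holds `B`, column `0` of the array `2`
holds `t`, and everything else is `0`. -/
def initState {d : ℕ} (k m n ℓ : ℕ) (α : ℝ) (B : Matrix (Fin d) (Fin d) ℝ)
    (t : Fin d → ℝ) : RState m n where
  idx := fun i => if i = 0 then d else if i = 1 then k else if i = 2 then m else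
    if i = 3 then n else if i = 4 then ℓ else 0
  mem := fun a i j =>
    if a = 0 ∧ i = 0 ∧ j = 0 then α
    else if h : a = 1 ∧ i < d ∧ j < d then B ⟨i, h.2.1⟩ ⟨j, h.2.2⟩
    else if h : a = 2 ∧ i < d ∧ j = 0 then t ⟨i, h.2.1⟩
    else 0
  draws := 0
  time := 0
  queries := []

/-- The output: the first `d` entries of column `0` of the array `3`. -/
def RState.output {m n : ℕ} (s : RState m n) (d : ℕ) : Fin d → ℝ := fun i => s.mem 3 i 0

end

/-! The program fills an m × (d+1) array with Gaussians. The first d columns form a matrix R and the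
last column a vector g. The top m - k rows of the design are R B G_sparse, so they are i.i.d. with
the required covariance (`map_designRows`), and the bottom k rows are γ G_partite with γ = 16 m (1 +
‖B‖_F²). The response is R t on top and γ below, plus σ g everywhere. Picking in each block the
column of G_sparse that equals the corresponding piece of z gives a k-sparse θ* with G_sparse θ* = z
and all block sums 1 (`exists_sparse_preimage`), so the noise is R e + σ g on top and σ g below.

Decoding (`decode_of_isSolution`): a solution θ' differs from θ* by little after applying X. Since γ
is huge, the bottom rows force all block sums of θ' to be almost 1. There are k blocks and at most k
non-zero entries, so each block has exactly one, and G_sparse θ' is a sign vector z' up to a tiny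
relative error. Then ‖R B (z' - z)‖ is a small multiple of √m λ, whereas a Chernoff bound and a
union bound over the 2^d sign vectors show that R shrinks none of the vectors B (z' - z) much below
√m times their length, which is at least √m λ when z' ≠ z.

Noise (`abs_joint_sub_le`): given R, the noise is σ g shifted by R e. Markov's inequality makes ‖R
e‖ / σ at most 1/5 with high probability, and a standard Gaussian shifted by so short a vector stays
close in total variation by a second moment computation (`abs_shift_sub_le`). As this holds
conditionally on R, it yields near independence of the design too.

Scale: λ is unknown, so the program tries s = 2^(-ℓ), …, 2^ℓ with δ = s/100 and σ = 100 α m q s,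
where q is an integer comparable with √(log m). Some s lies in [λ/2, λ] (`exists_scale`). As α <
1/2, z is the strict minimizer of ‖B z - t‖ over sign vectors. The program keeps the best decoded
candidate, so whatever the oracle answers at the other scales cannot displace z (`rounds_holds`).

Implementation: arrays are tabulated by expressions compiled to programs (`compile_computes`,
`tab_holds`). The running time follows from the syntax, since no loop bound is changed after the
initialization (`Prog.run_time_le`). -/

noncomputable section

/-! ### Running time -/

/-- The index registers that a program may write. -/
def Prog.modIdx : Prog → List ℕ
  | .instr (.setIdx i _) => [i]
  | .instr (.addIdx i _ _) => [i]
  | .instr (.subIdx i _ _) => [i]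
  | .instr _ => []
  | .seq p q => p.modIdx ++ q.modIdx
  | .iteIdx _ _ p q => p.modIdx ++ q.modIdx
  | .iteReal _ _ p q => p.modIdx ++ q.modIdx
  | .loop _ p => p.modIdx

/-- The index registers that bound the loops of a program. -/
def Prog.loopIdx : Prog → List ℕ
  | .instr _ => []
  | .seq p q => p.loopIdx ++ q.loopIdx
  | .iteIdx _ _ p q => p.loopIdx ++ q.loopIdx
  | .iteReal _ _ p q => p.loopIdx ++ q.loopIdx
  | .loop i p => i :: p.loopIdx

/-- The coefficient of the syntactic bound on the running time. -/
def Prog.weight : Prog → ℕ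
  -- A query costs m n + m + n + 1 ≤ 4 M² steps when m, n ≤ M and 1 ≤ M; hence this 4 and the
  -- exponent 2 in `codepth`.
  | .instr _ => 4
  | .seq p q => p.weight + q.weight
  | .iteIdx _ _ p q => p.weight + q.weight + 1
  | .iteReal _ _ p q => p.weight + q.weight + 1
  | .loop _ p => p.weight + 2

/-- The nesting depth of the loops of a program whose bound is one of the registers in `L`. -/
def Prog.depth (L : List ℕ) : Prog → ℕ
  | .instr _ => 0
  | .seq p q => max (p.depth L) (q.depth L)
  | .iteIdx _ _ p q => max (p.depth L) (q.depth L)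
  | .iteReal _ _ p q => max (p.depth L) (q.depth L)
  | .loop i p => p.depth L + if i ∈ L then 1 else 0

/-- The nesting depth of the loops of a program whose bound is not in `L`. -/
def Prog.codepth (L : List ℕ) : Prog → ℕ
  | .instr _ => 2
  | .seq p q => max (p.codepth L) (q.codepth L)
  | .iteIdx _ _ p q => max (p.codepth L) (q.codepth L)
  | .iteReal _ _ p q => max (p.codepth L) (q.codepth L)
  | .loop i p => p.codepth L + if i ∈ L then 0 else 1

section semantics

variable {m n : ℕ} (ω : ℕ → ℝ) (O : SLROracle m n)

theorem iterate_invariant {α β : Type*} (f : α → α) (g : α → β) (h : ∀ x, g (f x) = g x)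
    (r : ℕ) (x : α) : g (f^[r] x) = g x := by
  induction r generalizing x with
  | zero => rfl
  | succ r ih => rw [Function.iterate_succ_apply, ih, h]

theorem Prog.run_idx_eq {i : ℕ} (p : Prog) (hi : i ∉ p.modIdx) (s : RState m n) :
    (p.run ω O s).idx i = s.idx i := by
  induction p generalizing s with
  | instr c =>
    cases c <;>
      simp_all [Prog.modIdx, Prog.run, Instr.exec, RState.tick, RState.setIdx, RState.set,
        RState.writeVec]
  | seq p q ihp ihq =>
    simp only [Prog.modIdx, List.mem_append, not_or] at hi
    rw [Prog.run, ihq hi.2, ihp hi.1]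
  | iteIdx j l p q ihp ihq =>
    simp only [Prog.modIdx, List.mem_append, not_or] at hi
    rw [Prog.run]
    split_ifs
    · rw [ihp hi.1]; rfl
    · rw [ihq hi.2]; rfl
  | iteReal j l p q ihp ihq =>
    simp only [Prog.modIdx, List.mem_append, not_or] at hi
    rw [Prog.run]
    split_ifs
    · rw [ihp hi.1]; rfl
    · rw [ihq hi.2]; rfl
  | loop j p ih =>
    exact (iterate_invariant (fun s' => (p.run ω O s').tick 1) (fun s : RState m n => s.idx i)
      (fun s => ih hi s) _ _).trans rfl

theorem iterate_time_le {I : RState m n → Prop} (f : RState m n → RState m n) (T : ℕ)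
    (hI : ∀ s, I s → I (f s)) (hf : ∀ s, I s → (f s).time ≤ s.time + T) (r : ℕ)
    (s : RState m n) (hs : I s) : (f^[r] s).time ≤ s.time + r * T := by
  induction r generalizing s with
  | zero => simp
  | succ r ih =>
    rw [Function.iterate_succ_apply]
    have h1 := ih (f s) (hI s hs)
    have h2 := hf s hs
    linarith [add_mul r 1 T]

/-- Loop bounds never written by the program keep their initial values, so the cost is a product
over nested loops. Separating the loops in `L` (number K) from the others (number M) keeps the
dependence on ℓ linear later on. -/
theorem Prog.run_time_le (L : List ℕ) (M K : ℕ) (hM : 1 ≤ M) (hK : 1 ≤ K) (hm : m ≤ M)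
    (hn : n ≤ M) (p : Prog) (s : RState m n)
    (hL : ∀ i ∈ p.loopIdx, i ∉ p.modIdx ∧ s.idx i ≤ if i ∈ L then K else M) :
    (p.run ω O s).time ≤ s.time + p.weight * (M ^ p.codepth L * K ^ p.depth L) := by
  -- `W` stands for the registers written by the whole program: a loop bound must survive not only
  -- its own body but also the sibling subprograms and earlier rounds.
  suffices h : ∀ p : Prog, ∀ W : List ℕ, (∀ i ∈ p.modIdx, i ∈ W) → ∀ s : RState m n,
      (∀ i ∈ p.loopIdx, i ∉ W ∧ s.idx i ≤ if i ∈ L then K else M) →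
      (p.run ω O s).time ≤ s.time + p.weight * (M ^ p.codepth L * K ^ p.depth L) from
    h p p.modIdx (fun _ h => h) s hL
  have mono : ∀ {a b a' b' : ℕ}, a ≤ a' → b ≤ b' → M ^ a * K ^ b ≤ M ^ a' * K ^ b' :=
    fun h1 h2 => Nat.mul_le_mul (Nat.pow_le_pow_right hM h1) (Nat.pow_le_pow_right hK h2)
  have pos : ∀ a b : ℕ, 1 ≤ M ^ a * K ^ b := fun a b =>
    Nat.mul_pos (Nat.pow_pos hM) (Nat.pow_pos hK)
  intro p W
  induction p with
  | instr c =>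
    intro _ s _
    have h2 : M ≤ M ^ 2 := by nlinarith
    have h3 : m * n ≤ M ^ 2 := by nlinarith
    cases c <;>
      simp only [Prog.run, Instr.exec, RState.tick, RState.setIdx, RState.set, RState.writeVec,
        Prog.weight, Prog.codepth, Prog.depth] <;> nlinarith
  | seq p q ihp ihq =>
    intro hW s hs
    simp only [Prog.modIdx, Prog.loopIdx, List.mem_append] at hW hs
    have h1 := ihp (fun i hi => hW i (.inl hi)) s (fun i hi => hs i (.inl hi))
    have h2 := ihq (fun i hi => hW i (.inr hi)) (p.run ω O s) (fun i hi => by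
      have := hs i (.inr hi)
      rwa [Prog.run_idx_eq ω O p (fun hh => this.1 (hW i (.inl hh)))])
    rw [Prog.run]
    simp only [Prog.weight, Prog.codepth, Prog.depth]
    have h3 := Nat.mul_le_mul_left p.weight
      (mono (le_max_left (p.codepth L) (q.codepth L)) (le_max_left (p.depth L) (q.depth L)))
    have h4 := Nat.mul_le_mul_left q.weight
      (mono (le_max_right (p.codepth L) (q.codepth L)) (le_max_right (p.depth L) (q.depth L)))
    rw [add_mul]
    omega
  | iteIdx j l p q ihp ihq =>
    intro hW s hs
    simp only [Prog.modIdx, Prog.loopIdx, List.mem_append] at hW hs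
    have h1 := ihp (fun i hi => hW i (.inl hi)) (s.tick 1) (fun i hi => hs i (.inl hi))
    have h2 := ihq (fun i hi => hW i (.inr hi)) (s.tick 1) (fun i hi => hs i (.inr hi))
    have h0 : (s.tick 1).time = s.time + 1 := rfl
    rw [Prog.run]
    simp only [Prog.weight, Prog.codepth, Prog.depth]
    have h3 := Nat.mul_le_mul_left p.weight
      (mono (le_max_left (p.codepth L) (q.codepth L)) (le_max_left (p.depth L) (q.depth L)))
    have h4 := Nat.mul_le_mul_left q.weight
      (mono (le_max_right (p.codepth L) (q.codepth L)) (le_max_right (p.depth L) (q.depth L)))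
    have h5 := pos (max (p.codepth L) (q.codepth L)) (max (p.depth L) (q.depth L))
    rw [add_mul, add_mul]
    split_ifs <;> omega
  | iteReal j l p q ihp ihq =>
    intro hW s hs
    simp only [Prog.modIdx, Prog.loopIdx, List.mem_append] at hW hs
    have h1 := ihp (fun i hi => hW i (.inl hi)) (s.tick 1) (fun i hi => hs i (.inl hi))
    have h2 := ihq (fun i hi => hW i (.inr hi)) (s.tick 1) (fun i hi => hs i (.inr hi))
    have h0 : (s.tick 1).time = s.time + 1 := rfl
    rw [Prog.run]
    simp only [Prog.weight, Prog.codepth, Prog.depth]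
    have h3 := Nat.mul_le_mul_left p.weight
      (mono (le_max_left (p.codepth L) (q.codepth L)) (le_max_left (p.depth L) (q.depth L)))
    have h4 := Nat.mul_le_mul_left q.weight
      (mono (le_max_right (p.codepth L) (q.codepth L)) (le_max_right (p.depth L) (q.depth L)))
    have h5 := pos (max (p.codepth L) (q.codepth L)) (max (p.depth L) (q.depth L))
    rw [add_mul, add_mul]
    split_ifs <;> omega
  | loop j p ih =>
    intro hW s hs
    simp only [Prog.modIdx, Prog.loopIdx, List.mem_cons] at hW hs
    rw [Prog.run]
    have h1 := iterate_time_le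
      (I := fun s : RState m n => ∀ i ∈ p.loopIdx, i ∉ W ∧ s.idx i ≤ if i ∈ L then K else M)
      (fun s' => (p.run ω O s').tick 1) (p.weight * (M ^ p.codepth L * K ^ p.depth L) + 1)
      (fun s' hs' i hi => by
        have h := hs' i hi
        refine ⟨h.1, ?_⟩
        have : ((p.run ω O s').tick 1).idx i = s'.idx i :=
          Prog.run_idx_eq ω O p (fun hh => h.1 (hW i hh)) s'
        rw [this]; exact h.2)
      (fun s' hs' => by
        have := ih hW s' hs'
        have h0 : ((p.run ω O s').tick 1).time = (p.run ω O s').time + 1 := rfl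
        omega) (s.idx j) (s.tick 1) (fun i hi => hs i (.inr hi))
    have h0 : (s.tick 1).time = s.time + 1 := rfl
    have hj := (hs j (.inl rfl)).2
    simp only [Prog.weight, Prog.codepth, Prog.depth]
    have hp := pos (p.codepth L) (p.depth L)
    set A := M ^ p.codepth L * K ^ p.depth L with hA
    refine h1.trans ?_
    rw [h0]
    have hB : M ^ (p.codepth L + if j ∈ L then 0 else 1) * K ^ (p.depth L + if j ∈ L then 1 else 0)
        = A * (if j ∈ L then K else M) := by
      split_ifs <;> simp only [pow_succ, add_zero, hA] <;> ring
    rw [hB]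
    set V := if j ∈ L then K else M with hV
    have hV1 : 1 ≤ V := by rw [hV]; split_ifs <;> assumption
    have hAV : 1 ≤ A * V := Nat.mul_pos hp hV1
    -- The step at the entry and the one per round are absorbed by the `+ 2` in `weight`, because 1
    -- ≤ A V and V ≤ A V.
    have h5 : s.idx j * (p.weight * A + 1) ≤ V * (p.weight * A + 1) :=
      Nat.mul_le_mul_right _ hj
    have h6 : V * 1 ≤ V * A := Nat.mul_le_mul_left _ hp
    nlinarith

end semantics

/-! ### Expressions and their compilation -/

/-- Real-valued expressions over the index registers and arrays. The constructors `sum`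
and `prod` bind the index register `50 + v`, where `v` is the number of enclosing
binders. -/
inductive Expr where
  | rat (q : ℚ)
  | nat (i : ℕ)
  | cell (a i j : ℕ)
  | add (e f : Expr)
  | sub (e f : Expr)
  | mul (e f : Expr)
  | div (e f : Expr)
  | sum (i : ℕ) (e : Expr)
  | prod (i : ℕ) (e : Expr)
  | ite (e f g h : Expr)

namespace Expr

open Classical in
/-- The value of an expression; `ite e f g h` is `g` if `e < f`, and `h` otherwise. -/
def eval (mem : ℕ → ℕ → ℕ → ℝ) : Expr → ℕ → (ℕ → ℕ) → ℝ
  | rat q, _, _ => q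
  | nat i, _, x => x i
  | cell a i j, _, x => mem a (x i) (x j)
  | add e f, v, x => e.eval mem v x + f.eval mem v x
  | sub e f, v, x => e.eval mem v x - f.eval mem v x
  | mul e f, v, x => e.eval mem v x * f.eval mem v x
  | div e f, v, x => e.eval mem v x / f.eval mem v x
  | sum i e, v, x => ∑ r ∈ Finset.range (x i), e.eval mem (v + 1) (Function.update x (50 + v) r)
  | prod i e, v, x => ∏ r ∈ Finset.range (x i), e.eval mem (v + 1) (Function.update x (50 + v) r)
  | ite e f g h, v, x =>
      if e.eval mem v x < f.eval mem v x then g.eval mem v x else h.eval mem v x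

/-- All registers are in scope, all arrays are below `100`, and `C` is not among them. -/
def wf (C : ℕ) : Expr → ℕ → Bool
  | rat _, _ => true
  | nat i, v => i < 50 + v
  | cell a i j, v => (a < 100 && a ≠ C) && (i < 50 + v && j < 50 + v)
  | add e f, v => e.wf C v && f.wf C v
  | sub e f, v => e.wf C v && f.wf C v
  | mul e f, v => e.wf C v && f.wf C v
  | div e f, v => e.wf C v && f.wf C v
  | sum i e, v => i < 50 + v && e.wf C (v + 1)
  | prod i e, v => i < 50 + v && e.wf C (v + 1)
  | ite e f g h, v => e.wf C v && (f.wf C v && (g.wf C v && h.wf C v))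

/-- The temporary real variable number `t`. -/
def temp (t : ℕ) : Cell := ⟨100 + t, 5, 5⟩

/-- Compiles an expression under `v` binders to a program that leaves the value in the
temporary `t` and uses only temporaries from `t` on. Register `5` has to hold `0`, and
register `6` has to hold `1`. -/
def compile : Expr → ℕ → ℕ → Prog
  | rat q, t, _ => .instr (.setReal (temp t) q)
  | nat i, t, _ => .instr (.castReal (temp t) i)
  | cell a i j, t, _ =>
      -- Cells are copied by adding them to 0.
      .seq (.instr (.setReal (temp t) 0)) (.instr (.addReal (temp t) (temp t) ⟨a, i, j⟩))
  | add e f, t, v => .seq (e.compile t v) (.seq (f.compile (t + 1) v)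
      (.instr (.addReal (temp t) (temp t) (temp (t + 1)))))
  | sub e f, t, v => .seq (e.compile t v) (.seq (f.compile (t + 1) v)
      (.instr (.subReal (temp t) (temp t) (temp (t + 1)))))
  | mul e f, t, v => .seq (e.compile t v) (.seq (f.compile (t + 1) v)
      (.instr (.mulReal (temp t) (temp t) (temp (t + 1)))))
  | div e f, t, v => .seq (e.compile t v) (.seq (f.compile (t + 1) v)
      (.instr (.divReal (temp t) (temp t) (temp (t + 1)))))
  | sum i e, t, v => .seq (.instr (.setReal (temp t) 0)) (.seq (.instr (.setIdx (50 + v) 0))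
      (.loop i (.seq (e.compile (t + 1) (v + 1))
        (.seq (.instr (.addReal (temp t) (temp t) (temp (t + 1))))
          (.instr (.addIdx (50 + v) (50 + v) 6))))))
  | prod i e, t, v => .seq (.instr (.setReal (temp t) 1)) (.seq (.instr (.setIdx (50 + v) 0))
      (.loop i (.seq (e.compile (t + 1) (v + 1))
        (.seq (.instr (.mulReal (temp t) (temp t) (temp (t + 1))))
          (.instr (.addIdx (50 + v) (50 + v) 6))))))
  | ite e f g h, t, v => .seq (e.compile t v) (.seq (f.compile (t + 1) v)
      (.iteReal (temp t) (temp (t + 1)) (g.compile t v) (h.compile t v)))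

/-- This makes values insensitive to the temporaries, to registers out of scope, and to the array
`C` that is being overwritten while the expression is evaluated. -/
theorem eval_congr {C : ℕ} {mem mem' : ℕ → ℕ → ℕ → ℝ}
    (hmem : ∀ a < 100, a ≠ C → mem a = mem' a) (e : Expr) :
    ∀ {v : ℕ} {x x' : ℕ → ℕ}, e.wf C v = true → (∀ i < 50 + v, x i = x' i) →
      e.eval mem v x = e.eval mem' v x' := by
  induction e with
  | rat q => intros; rfl
  | nat i => intro v x x' h hx; simp only [wf, decide_eq_true_eq] at h; simp [eval, hx i h]
  | cell a i j =>
    intro v x x' h hx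
    simp only [wf, decide_eq_true_eq, Bool.and_eq_true] at h
    simp [eval, hx i h.2.1, hx j h.2.2, hmem a h.1.1 h.1.2]
  | add e f he hf =>
    intro v x x' h hx
    simp only [wf, Bool.and_eq_true] at h
    simp [eval, he h.1 hx, hf h.2 hx]
  | sub e f he hf =>
    intro v x x' h hx
    simp only [wf, Bool.and_eq_true] at h
    simp [eval, he h.1 hx, hf h.2 hx]
  | mul e f he hf =>
    intro v x x' h hx
    simp only [wf, Bool.and_eq_true] at h
    simp [eval, he h.1 hx, hf h.2 hx]
  | div e f he hf =>
    intro v x x' h hx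
    simp only [wf, Bool.and_eq_true] at h
    simp [eval, he h.1 hx, hf h.2 hx]
  | sum i e he =>
    intro v x x' h hx
    simp only [wf, Bool.and_eq_true, decide_eq_true_eq] at h
    simp only [eval, hx i h.1]
    refine Finset.sum_congr rfl fun r _ => he h.2 fun j hj => ?_
    simp only [Function.update_apply]
    split_ifs with hj'
    · rfl
    · exact hx j (by omega)
  | prod i e he =>
    intro v x x' h hx
    simp only [wf, Bool.and_eq_true, decide_eq_true_eq] at h
    simp only [eval, hx i h.1]
    refine Finset.prod_congr rfl fun r _ => he h.2 fun j hj => ?_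
    simp only [Function.update_apply]
    split_ifs with hj'
    · rfl
    · exact hx j (by omega)
  | ite e f g h he hf hg hh =>
    intro v x x' hw hx
    simp only [wf, Bool.and_eq_true] at hw
    simp [eval, he hw.1 hx, hf hw.2.1 hx, hg hw.2.2.1 hx, hh hw.2.2.2 hx]

end Expr

/-- The states `s` and `s'` agree except for the time, the index registers from `50 + v` on
and the arrays from `100 + t` on. -/
structure RState.AgreeUpTo {m n : ℕ} (t v : ℕ) (s s' : RState m n) : Prop where
  idx : ∀ i < 50 + v, s'.idx i = s.idx i
  mem : ∀ a < 100 + t, s'.mem a = s.mem a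
  draws : s'.draws = s.draws
  queries : s'.queries = s.queries

theorem RState.AgreeUpTo.trans {m n t v t' v' : ℕ} {s s' s'' : RState m n}
    (h : s.AgreeUpTo t v s') (h' : s'.AgreeUpTo t' v' s'') (ht : t ≤ t') (hv : v ≤ v') :
    s.AgreeUpTo t v s'' where
  idx i hi := (h'.idx i (by omega)).trans (h.idx i hi)
  mem a ha := (h'.mem a (by omega)).trans (h.mem a ha)
  draws := h'.draws.trans h.draws
  queries := h'.queries.trans h.queries

namespace Expr

variable {m n : ℕ} (ω : ℕ → ℝ) (O : SLROracle m n)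

/-- The temporary `t` holds the value `r` after the run, and nothing in scope has changed. -/
def Computes (t v : ℕ) (s : RState m n) (r : ℝ) (s' : RState m n) : Prop :=
  s.AgreeUpTo t v s' ∧ s'.mem (100 + t) 0 0 = r

theorem run_setReal_temp (t v : ℕ) (s : RState m n) (h5 : s.idx 5 = 0) (q : ℚ) :
    Computes t v s q ((Prog.instr (.setReal (temp t) q)).run ω O s) := by
  refine ⟨⟨fun i _ => rfl, fun a ha => ?_, rfl, rfl⟩, ?_⟩
  · funext i j
    simp [Prog.run, Instr.exec, RState.tick, RState.set, temp, ha.ne]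
  · simp [Prog.run, Instr.exec, RState.tick, RState.set, temp, h5]

/-- The second operand is computed with temporaries from `t + 1` on, so the first one survives in
`t`. Abstracting `op` and `g` treats the four arithmetic instructions at once. -/
theorem run_binary {op : Cell → Cell → Cell → Instr} {g : ℝ → ℝ → ℝ}
    (hop : ∀ (x y z : Cell) (s : RState m n),
      (op x y z).exec ω O s = (s.set x (g (s.get y) (s.get z))).tick 1)
    (t v : ℕ) (s s₁ s₂ : RState m n) (h5 : s.idx 5 = 0) (r₁ r₂ : ℝ)
    (h₁ : Computes t v s r₁ s₁) (h₂ : Computes (t + 1) v s₁ r₂ s₂) :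
    Computes t v s (g r₁ r₂)
      ((Prog.instr (op (temp t) (temp t) (temp (t + 1)))).run ω O s₂) := by
  have h51 : s₁.idx 5 = 0 := by rw [h₁.1.idx 5 (by omega), h5]
  have h52 : s₂.idx 5 = 0 := by rw [h₂.1.idx 5 (by omega), h51]
  have ht : s₂.mem (100 + t) 0 0 = r₁ := by rw [h₂.1.mem _ (by omega), h₁.2]
  have ht' : s₂.mem (100 + (t + 1)) 0 0 = r₂ := h₂.2
  have hag : s.AgreeUpTo t v s₂ := h₁.1.trans h₂.1 (by omega) le_rfl
  rw [Prog.run, hop]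
  refine ⟨⟨fun i hi => hag.idx i hi, fun a ha => ?_, hag.draws, hag.queries⟩, ?_⟩
  · rw [← hag.mem a ha]
    funext i j
    simp [RState.tick, RState.set, temp, ha.ne]
  · simp [RState.tick, RState.set, RState.get, temp, h52, ht, ht']

/-- The loop that folds the values of an expression with a binary operation. -/
theorem run_fold {op : Cell → Cell → Cell → Instr} {g : ℝ → ℝ → ℝ}
    (hop : ∀ (x y z : Cell) (s : RState m n),
      (op x y z).exec ω O s = (s.set x (g (s.get y) (s.get z))).tick 1)
    (i t v : ℕ) (hi : i < 50 + v) (q : ℚ) (p : Prog) (val : ℕ → ℝ) (s : RState m n)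
    (h5 : s.idx 5 = 0) (h6 : s.idx 6 = 1)
    (hp : ∀ (r : ℕ) (s' : RState m n), s.AgreeUpTo t v s' → s'.idx (50 + v) = r →
      Computes (t + 1) (v + 1) s' (val r) (p.run ω O s')) :
    Computes t v s (Nat.rec (q : ℝ) (fun r x => g x (val r)) (s.idx i))
      ((Prog.seq (.instr (.setReal (temp t) q)) (.seq (.instr (.setIdx (50 + v) 0))
      (.loop i (.seq p (.seq (.instr (op (temp t) (temp t) (temp (t + 1))))
          (.instr (.addIdx (50 + v) (50 + v) 6))))))).run ω O s) := by
  have h0 := run_setReal_temp ω O t v s h5 q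
  simp only [Prog.run] at h0 ⊢
  set s₀ := (Instr.setReal (temp t) q).exec ω O s with hs₀
  set s₁ := (((Instr.setIdx (50 + v) 0).exec ω O s₀).tick 1) with hs₁
  have hN : ((Instr.setIdx (50 + v) 0).exec ω O s₀).idx i = s.idx i := by
    rw [← h0.1.idx i hi]
    simp [Instr.exec, RState.tick, RState.setIdx, hi.ne]
  rw [hN]
  -- Loop invariant: after r rounds the temporary holds the fold of the first r values and the bound
  -- register holds r.
  have key : ∀ r : ℕ, ∀ s' : RState m n, s' = (fun s' : RState m n => RState.tick
      (((Instr.addIdx (50 + v) (50 + v) 6).exec ω O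
        ((op (temp t) (temp t) (temp (t + 1))).exec ω O (p.run ω O s')))) 1)^[r] s₁ →
      Computes t v s (Nat.rec (q : ℝ) (fun r x => g x (val r)) r) s' ∧
        s'.idx (50 + v) = r := by
    intro r
    induction r with
    | zero =>
      rintro s' rfl
      refine ⟨⟨⟨fun j hj => ?_, h0.1.mem, h0.1.draws, h0.1.queries⟩, h0.2⟩, ?_⟩
      · rw [← h0.1.idx j hj]
        simp [hs₁, Instr.exec, RState.tick, RState.setIdx, hj.ne]
      · simp [hs₁, Instr.exec, RState.tick, RState.setIdx]
    | succ r ih =>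
      intro s' hs'
      rw [Function.iterate_succ_apply'] at hs'
      obtain ⟨hc, hr⟩ := ih _ rfl
      set s₂ := (fun s' : RState m n => RState.tick
        (((Instr.addIdx (50 + v) (50 + v) 6).exec ω O
          ((op (temp t) (temp t) (temp (t + 1))).exec ω O (p.run ω O s')))) 1)^[r] s₁
      have hpr := hp r s₂ hc.1 hr
      have hb := run_binary ω O hop t v s s₂ (p.run ω O s₂) h5 _ _ hc
        ⟨⟨fun j hj => hpr.1.idx j (by omega), hpr.1.mem, hpr.1.draws, hpr.1.queries⟩, hpr.2⟩
      have hv : (p.run ω O s₂).idx (50 + v) = r := by rw [hpr.1.idx _ (by omega), hr]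
      have hbi : ∀ j, ((op (temp t) (temp t) (temp (t + 1))).exec ω O (p.run ω O s₂)).idx j =
        (p.run ω O s₂).idx j := by intro j; rw [hop]; rfl
      have h6' : (p.run ω O s₂).idx 6 = 1 := by
        rw [hpr.1.idx _ (by omega), hc.1.idx _ (by omega), h6]
      simp only [Prog.run] at hb
      set s₃ := (op (temp t) (temp t) (temp (t + 1))).exec ω O (p.run ω O s₂)
      rw [hs']
      refine ⟨⟨⟨fun j hj => ?_, hb.1.mem, hb.1.draws, hb.1.queries⟩, hb.2⟩, ?_⟩
      · rw [← hb.1.idx j hj]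
        simp [Instr.exec, RState.tick, RState.setIdx, hj.ne]
      · simp [Instr.exec, RState.tick, RState.setIdx, hbi, hv, h6']
  exact (key _ _ rfl).1

/-- Structural induction. A later subexpression runs in a state changed by an earlier one, but only
in temporaries and out of scope registers, so `eval_congr` moves its value back to the starting
state. -/
theorem compile_computes {C : ℕ} (e : Expr) : ∀ (t v : ℕ) (s : RState m n), e.wf C v = true →
    s.idx 5 = 0 → s.idx 6 = 1 →
    Computes t v s (e.eval s.mem v s.idx) ((e.compile t v).run ω O s) := by
  have hbin : ∀ (e f : Expr) (op : Cell → Cell → Cell → Instr) (g : ℝ → ℝ → ℝ),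
    (∀ (x y z : Cell) (s : RState m n),
      (op x y z).exec ω O s = (s.set x (g (s.get y) (s.get z))).tick 1) →
    (∀ (t v : ℕ) (s : RState m n), e.wf C v = true → s.idx 5 = 0 → s.idx 6 = 1 →
      Computes t v s (e.eval s.mem v s.idx) ((e.compile t v).run ω O s)) →
    (∀ (t v : ℕ) (s : RState m n), f.wf C v = true → s.idx 5 = 0 → s.idx 6 = 1 →
      Computes t v s (f.eval s.mem v s.idx) ((f.compile t v).run ω O s)) →
    ∀ (t v : ℕ) (s : RState m n), (e.wf C v && f.wf C v) = true → s.idx 5 = 0 → s.idx 6 = 1 →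
      Computes t v s (g (e.eval s.mem v s.idx) (f.eval s.mem v s.idx))
        ((Prog.seq (e.compile t v) (.seq (f.compile (t + 1) v)
          (.instr (op (temp t) (temp t) (temp (t + 1)))))).run ω O s) := by
    intro e f op g hop he hf t v s hw h5 h6
    rw [Bool.and_eq_true] at hw
    have h1 := he t v s hw.1 h5 h6
    have h2 := hf (t + 1) v ((e.compile t v).run ω O s) hw.2
      (by rw [h1.1.idx _ (by omega), h5]) (by rw [h1.1.idx _ (by omega), h6])
    rw [f.eval_congr (fun a ha _ => h1.1.mem a (by omega)) hw.2 h1.1.idx] at h2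
    simp only [Prog.run]
    exact run_binary ω O hop t v s _ _ h5 _ _ h1 h2
  induction e with
  | rat q => intro t v s _ h5 _; exact run_setReal_temp ω O t v s h5 q
  | nat i =>
    intro t v s _ h5 _
    refine ⟨⟨fun i _ => rfl, fun a ha => ?_, rfl, rfl⟩, ?_⟩
    · funext i j
      simp [compile, Prog.run, Instr.exec, RState.tick, RState.set, temp, ha.ne]
    · simp [compile, eval, Prog.run, Instr.exec, RState.tick, RState.set, temp, h5]
  | cell a i j =>
    intro t v s h h5 _
    simp only [wf, decide_eq_true_eq, Bool.and_eq_true] at h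
    refine ⟨⟨fun i _ => rfl, fun a ha => ?_, rfl, rfl⟩, ?_⟩
    · funext i j
      simp [compile, Prog.run, Instr.exec, RState.tick, RState.set, temp, ha.ne]
    · have : a ≠ 100 + t := by omega
      simp [compile, eval, Prog.run, Instr.exec, RState.tick, RState.set, RState.get, temp, h5,
        this]
  | add e f he hf => exact hbin e f .addReal (· + ·) (fun _ _ _ _ => rfl) he hf
  | sub e f he hf => exact hbin e f .subReal (· - ·) (fun _ _ _ _ => rfl) he hf
  | mul e f he hf => exact hbin e f .mulReal (· * ·) (fun _ _ _ _ => rfl) he hf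
  | div e f he hf => exact hbin e f .divReal (· / ·) (fun _ _ _ _ => rfl) he hf
  | sum i e he =>
    intro t v s h h5 h6
    simp only [wf, Bool.and_eq_true, decide_eq_true_eq] at h
    have := run_fold ω O (op := .addReal) (g := (· + ·)) (fun _ _ _ _ => rfl) i t v h.1 0
      (e.compile (t + 1) (v + 1))
      (fun r => e.eval s.mem (v + 1) (Function.update s.idx (50 + v) r)) s h5 h6
      (fun r s' hs' hr => by
        have h1 := he (t + 1) (v + 1) s' h.2 (by rw [hs'.idx _ (by omega), h5])
          (by rw [hs'.idx _ (by omega), h6])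
        rwa [e.eval_congr (fun a ha _ => hs'.mem a (by omega)) h.2
          (x' := Function.update s.idx (50 + v) r) (fun j hj => by
            rw [Function.update_apply]
            split_ifs with hj'
            · rw [hj', hr]
            · exact hs'.idx j (by omega))] at h1)
    rw [eval]
    convert this using 1
    · induction s.idx i with
      | zero => simp
      | succ r ih => rw [Finset.sum_range_succ, ih]
    · rfl
  | prod i e he =>
    intro t v s h h5 h6
    simp only [wf, Bool.and_eq_true, decide_eq_true_eq] at h
    have := run_fold ω O (op := .mulReal) (g := (· * ·)) (fun _ _ _ _ => rfl) i t v h.1 1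
      (e.compile (t + 1) (v + 1))
      (fun r => e.eval s.mem (v + 1) (Function.update s.idx (50 + v) r)) s h5 h6
      (fun r s' hs' hr => by
        have h1 := he (t + 1) (v + 1) s' h.2 (by rw [hs'.idx _ (by omega), h5])
          (by rw [hs'.idx _ (by omega), h6])
        rwa [e.eval_congr (fun a ha _ => hs'.mem a (by omega)) h.2
          (x' := Function.update s.idx (50 + v) r) (fun j hj => by
            rw [Function.update_apply]
            split_ifs with hj'
            · rw [hj', hr]
            · exact hs'.idx j (by omega))] at h1)
    rw [eval]
    convert this using 1
    · induction s.idx i with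
      | zero => simp
      | succ r ih => rw [Finset.prod_range_succ, ih]
    · rfl
  | ite e f g h he hf hg hh =>
    intro t v s hw h5 h6
    simp only [wf, Bool.and_eq_true] at hw
    have h1 := he t v s hw.1 h5 h6
    have h2 := hf (t + 1) v ((e.compile t v).run ω O s) hw.2.1
      (by rw [h1.1.idx _ (by omega), h5]) (by rw [h1.1.idx _ (by omega), h6])
    rw [f.eval_congr (fun a ha _ => h1.1.mem a (by omega)) hw.2.1 h1.1.idx] at h2
    simp only [compile, Prog.run]
    set s₁ := (e.compile t v).run ω O s
    set s₂ := (f.compile (t + 1) v).run ω O s₁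
    have hag : s.AgreeUpTo t v s₂ := h1.1.trans h2.1 (by omega) le_rfl
    have h52 : s₂.idx 5 = 0 := by rw [hag.idx _ (by omega), h5]
    have h62 : s₂.idx 6 = 1 := by rw [hag.idx _ (by omega), h6]
    have g1 : s₂.get (temp t) = e.eval s.mem v s.idx := by
      simp only [RState.get, temp, h52]
      rw [h2.1.mem _ (by omega), h1.2]
    have g2 : s₂.get (temp (t + 1)) = f.eval s.mem v s.idx := by
      simp only [RState.get, temp, h52]
      rw [h2.2]
    rw [g1, g2, eval]
    have hag' : s.AgreeUpTo t v (s₂.tick 1) := ⟨hag.idx, hag.mem, hag.draws, hag.queries⟩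
    split_ifs
    · have h3 := hg t v (s₂.tick 1) hw.2.2.1 h52 h62
      rw [g.eval_congr (fun a ha _ => hag'.mem a (by omega)) hw.2.2.1 hag'.idx] at h3
      exact ⟨hag'.trans h3.1 le_rfl le_rfl, h3.2⟩
    · have h3 := hh t v (s₂.tick 1) hw.2.2.2 h52 h62
      rw [h.eval_congr (fun a ha _ => hag'.mem a (by omega)) hw.2.2.2 hag'.idx] at h3
      exact ⟨hag'.trans h3.1 le_rfl le_rfl, h3.2⟩

end Expr

/-! ### Filling arrays -/

/-- Run `p` for the values `0, 1, …` of the register `i` below the value of the register `N`. -/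
def forLoop (i N : ℕ) (p : Prog) : Prog :=
  .seq (.instr (.setIdx i 0)) (.loop N (.seq p (.instr (.addIdx i i 6))))

/-- Run `p` for all entries of the array `C` whose row and column are below the values of
the registers `I` and `J`. -/
def fill (I J : ℕ) (p : Prog) : Prog :=
  forLoop 50 I (forLoop 51 J p)

/-- Assign the values of an expression in the row `50` and the column `51` to the entries of
an array. -/
def tab (C I J : ℕ) (e : Expr) : Prog :=
  fill I J (.seq (e.compile 0 2) (.seq (.instr (.setReal ⟨C, 50, 51⟩ 0))
    (.instr (.addReal ⟨C, 50, 51⟩ ⟨C, 50, 51⟩ (Expr.temp 0)))))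

/-- The part of the state that is not temporary. -/
structure RState.Holds {m n : ℕ} (x : ℕ → ℕ) (μ : ℕ → ℕ → ℕ → ℝ) (D : ℕ)
    (Q : List (SLRInstance m n)) (s : RState m n) : Prop where
  idx : ∀ i < 50, s.idx i = x i
  mem : ∀ a < 100, s.mem a = μ a
  draws : s.draws = D
  queries : s.queries = Q

variable {m n : ℕ} (ω : ℕ → ℝ) (O : SLROracle m n)

/-- The induction principle for counted loops; `I r` describes the state after r rounds, and the
counter is advanced by register 6, which is meant to hold 1. -/
theorem forLoop_induction (i N : ℕ) (hiN : N ≠ i) (p : Prog) (s : RState m n)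
    (I : ℕ → RState m n → Prop)
    (h0 : I 0 ((s.setIdx i 0).tick 1 |>.tick 1))
    (hstep : ∀ r < s.idx N, ∀ s', I r s' →
      I (r + 1) ((((p.run ω O s').setIdx i ((p.run ω O s').idx i + (p.run ω O s').idx 6)).tick
        1).tick 1)) :
    I (s.idx N) ((forLoop i N p).run ω O s) := by
  simp only [forLoop, Prog.run]
  have hN : ((Instr.setIdx i 0).exec ω O s).idx N = s.idx N := by
    simp [Instr.exec, RState.tick, RState.setIdx, hiN]
  rw [hN]
  have : ∀ r ≤ s.idx N, I r ((fun s' : RState m n =>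
      ((Instr.addIdx i i 6).exec ω O (p.run ω O s')).tick 1)^[r]
        (((Instr.setIdx i 0).exec ω O s).tick 1)) := by
    intro r hr
    induction r with
    | zero => exact h0
    | succ r ih =>
      rw [Function.iterate_succ_apply']
      exact hstep r (by omega) _ (ih (by omega))
  exact this _ le_rfl

/-- The loop invariant of `fill`. -/
structure FillInv (C : ℕ) (x : ℕ → ℕ) (μ : ℕ → ℕ → ℕ → ℝ) (D : ℕ) (Q : List (SLRInstance m n))
    (val : ℕ → ℕ → ℝ) (P : ℕ → ℕ → Prop) (s : RState m n) : Prop where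
  idx : ∀ i < 50, s.idx i = x i
  mem : ∀ a < 100, a ≠ C → s.mem a = μ a
  memC : ∀ i j, (P i j → s.mem C i j = val i j) ∧ (¬ P i j → s.mem C i j = μ C i j)
  draws : s.draws = D
  queries : s.queries = Q

/-- The number `δ` of Gaussians drawn per entry is 0 for tabulated arrays and 1 for the random
array. Tracking it determines which tape position ends up in the entry (i, j). -/
theorem fill_holds {C I J : ℕ} (hI : I < 50) (hJ : J < 50) (p : Prog)
    (x : ℕ → ℕ) (hx6 : x 6 = 1) (μ : ℕ → ℕ → ℕ → ℝ) (D δ : ℕ) (Q : List (SLRInstance m n))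
    (val : ℕ → ℕ → ℝ)
    (hp : ∀ (i j : ℕ) (s : RState m n), s.idx 50 = i → s.idx 51 = j → j < x J →
      (∀ l < 50, s.idx l = x l) →
      (∀ a < 100, a ≠ C → s.mem a = μ a) → s.draws = D + δ * (i * x J + j) →
      (∀ l < 52, (p.run ω O s).idx l = s.idx l) ∧
      (∀ a < 100, a ≠ C → (p.run ω O s).mem a = s.mem a) ∧
      (p.run ω O s).mem C i j = val i j ∧
      (∀ i' j', ¬ (i' = i ∧ j' = j) → (p.run ω O s).mem C i' j' = s.mem C i' j') ∧
      (p.run ω O s).draws = s.draws + δ ∧ (p.run ω O s).queries = s.queries)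
    (s : RState m n) (hs : s.Holds x μ D Q) (hC : C < 100) :
    ((fill I J p).run ω O s).Holds x
      (Function.update μ C fun i j => if i < x I ∧ j < x J then val i j else μ C i j)
      (D + δ * (x I * x J)) Q := by
  have hsI : s.idx I = x I := hs.idx I hI
  let Inv : ℕ → RState m n → Prop := fun r s' => s'.idx 50 = r ∧
    FillInv C x μ (D + δ * (r * x J)) Q val (fun i j => i < r ∧ j < x J) s'
  have key : Inv (s.idx I) ((fill I J p).run ω O s) := by
    refine forLoop_induction ω O 50 I (by omega) _ s Inv ⟨?_, ?_⟩ ?_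
    · simp [RState.tick, RState.setIdx]
    · refine ⟨fun i hi => ?_, fun a ha _ => hs.mem a ha, fun i j => ⟨fun h => ?_, fun _ => ?_⟩,
        ?_, hs.queries⟩
      · rw [← hs.idx i hi]
        simp [RState.tick, RState.setIdx, (show i ≠ 50 by omega)]
      · simp at h
      · exact congrFun (congrFun (hs.mem C hC) i) j
      · simpa [RState.tick, RState.setIdx] using hs.draws
    · rintro r hr s₁ ⟨h50, h1⟩
      have hJ1 : s₁.idx J = x J := h1.idx J hJ
      -- Rows before r are complete, and row r is complete up to column c.
      let Inv' : ℕ → RState m n → Prop := fun c s' => s'.idx 50 = r ∧ s'.idx 51 = c ∧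
        FillInv C x μ (D + δ * (r * x J + c)) Q val
          (fun i j => (i < r ∧ j < x J) ∨ (i = r ∧ j < c)) s'
      have inner : Inv' (s₁.idx J) ((forLoop 51 J p).run ω O s₁) := by
        refine forLoop_induction ω O 51 J (by omega) _ s₁ Inv' ⟨?_, ?_, ?_⟩ ?_
        · simp [RState.tick, RState.setIdx, h50]
        · simp [RState.tick, RState.setIdx]
        · refine ⟨fun i hi => ?_, fun a ha hac => h1.mem a ha hac,
            fun i j => ⟨fun h => ?_, fun h => ?_⟩, ?_, h1.queries⟩
          · rw [← h1.idx i hi]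
            simp [RState.tick, RState.setIdx, (show i ≠ 51 by omega)]
          · exact (h1.memC i j).1 (by simpa using h)
          · exact (h1.memC i j).2 (by simpa using h)
          · simpa [RState.tick, RState.setIdx] using h1.draws
        · rintro c hc s₂ ⟨h50', h51, h2⟩
          obtain ⟨q1, q2, q3, q4, q5, q6⟩ := hp r c s₂ h50' h51 (by omega) h2.idx h2.mem h2.draws
          refine ⟨?_, ?_, ?_⟩
          · simp [RState.tick, RState.setIdx, q1, h50']
          · simp [RState.tick, RState.setIdx, q1, h51, h2.idx 6, hx6]
          · refine ⟨fun i hi => ?_, fun a ha hac => ?_, fun i j => ?_, ?_, ?_⟩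
            · rw [← h2.idx i hi, ← q1 i (by omega)]
              simp [RState.tick, RState.setIdx, (show i ≠ 51 by omega)]
            · rw [← h2.mem a ha hac, ← q2 a ha hac]; rfl
            · have hm := h2.memC i j
              by_cases hij : i = r ∧ j = c
              · obtain ⟨rfl, rfl⟩ := hij
                exact ⟨fun _ => q3, fun h => absurd (Or.inr ⟨rfl, by omega⟩) h⟩
              · have hne := q4 i j hij
                refine ⟨fun h => hne.trans (hm.1 ?_), fun h => hne.trans (hm.2 ?_)⟩
                · rcases h with h | h
                  · exact Or.inl h
                  · refine Or.inr ⟨h.1, ?_⟩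
                    have := h.2
                    by_contra hcc
                    exact hij ⟨h.1, by omega⟩
                · rintro (h' | h')
                  · exact h (Or.inl h')
                  · exact h (Or.inr ⟨h'.1, by omega⟩)
            · have := h2.draws
              show (p.run ω O s₂).draws = _
              rw [q5, this]; ring
            · exact q6.trans h2.queries
      obtain ⟨i50, -, hinv⟩ := inner
      refine ⟨?_, ?_⟩
      · simp [RState.tick, RState.setIdx, i50, hinv.idx 6, hx6]
      · refine ⟨fun i hi => ?_, hinv.mem, fun i j => ?_, ?_, hinv.queries⟩
        · rw [← hinv.idx i hi]
          simp [RState.tick, RState.setIdx, (show i ≠ 50 by omega)]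
        · have := hinv.memC i j
          refine ⟨fun h => this.1 ?_, fun h => this.2 ?_⟩
          · rw [hJ1]
            rcases Nat.lt_succ_iff_lt_or_eq.1 h.1 with h' | h'
            · exact Or.inl ⟨h', h.2⟩
            · exact Or.inr ⟨h', h.2⟩
          · rw [hJ1]
            rintro (h' | h')
            · exact h ⟨by omega, h'.2⟩
            · exact h ⟨by omega, h'.2⟩
        · have := hinv.draws
          show ((forLoop 51 J p).run ω O s₁).draws = _
          rw [this, hJ1]; ring
  obtain ⟨-, h⟩ := key
  rw [hsI] at h
  refine ⟨h.idx, fun a ha => ?_, h.draws, h.queries⟩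
  by_cases hac : a = C
  · subst hac
    rw [Function.update_self]
    funext i j
    split_ifs with hij
    · exact (h.memC i j).1 hij
    · exact (h.memC i j).2 hij
  · rw [Function.update_of_ne hac]
    exact h.mem a ha hac

/-- The registers while the entry `(i, j)` of an array is being computed. -/
def entryIdx (x : ℕ → ℕ) (i j : ℕ) : ℕ → ℕ :=
  Function.update (Function.update x 50 i) 51 j

/-- Well-formedness at level 2 brings the row and column registers 50 and 51 into scope and forbids
reading `C`, so every entry is computed from the old contents `μ`. -/
theorem tab_holds {C I J : ℕ} (e : Expr) (he : e.wf C 2 = true) (hI : I < 50) (hJ : J < 50)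
    (hC : C < 100) {x : ℕ → ℕ} (hx5 : x 5 = 0) (hx6 : x 6 = 1) {μ : ℕ → ℕ → ℕ → ℝ} {D : ℕ}
    {Q : List (SLRInstance m n)} {s : RState m n} (hs : s.Holds x μ D Q) :
    ∃ μ' : ℕ → ℕ → ℕ → ℝ, ((tab C I J e).run ω O s).Holds x μ' D Q ∧ (∀ a ≠ C, μ' a = μ a) ∧
      (∀ i < x I, ∀ j < x J, μ' C i j = e.eval μ 2 (entryIdx x i j)) := by
  have hD : D = D + 0 * (x I * x J) := by simp
  rw [hD]
  refine ⟨_, fill_holds ω O (C := C) hI hJ _ x hx6 μ D 0 Q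
    (fun i j => e.eval μ 2 (entryIdx x i j)) ?_ s hs hC,
    fun a ha => Function.update_of_ne ha _ _, fun i hi j hj => ?_⟩
  · intro i j s' h50 h51 _ hidx hmem hD
    have h5 : s'.idx 5 = 0 := by rw [hidx 5 (by omega), hx5]
    have h6 : s'.idx 6 = 1 := by rw [hidx 6 (by omega), hx6]
    have hc := e.compile_computes ω O 0 2 s' he h5 h6
    rw [Expr.eval_congr (mem' := μ) (x' := entryIdx x i j) hmem e he (fun l hl => ?_)] at hc
    · simp only [Prog.run]
      set s₁ := (e.compile 0 2).run ω O s'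
      obtain ⟨hag, hv⟩ := hc
      have g50 : s₁.idx 50 = i := by rw [hag.idx _ (by omega), h50]
      have g51 : s₁.idx 51 = j := by rw [hag.idx _ (by omega), h51]
      have g5 : s₁.idx 5 = 0 := by rw [hag.idx _ (by omega), h5]
      refine ⟨fun l hl => hag.idx l (by omega), fun a ha hac => ?_, ?_, fun i' j' hij => ?_,
        hag.draws, hag.queries⟩
      · rw [← hag.mem a (by omega)]
        funext i' j'
        simp [Instr.exec, RState.tick, RState.set, hac]
      · have h100 : ¬ (100 = C) := by omega
        simp only [add_zero] at hv
        simp [Instr.exec, RState.tick, RState.set, RState.get, g50, g51, g5, Expr.temp, hv, h100]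
      · rw [← hag.mem C (by omega)]
        simp [Instr.exec, RState.tick, RState.set, g50, g51, hij]
    · unfold entryIdx
      simp only [Function.update_apply]
      split_ifs with h1 h2
      · rw [h1, h51]
      · rw [h2, h50]
      · exact hidx l (by omega)
  · rw [Function.update_self, if_pos ⟨hi, hj⟩]

/-- The Gaussians of the random tape fill the array `C` row by row. -/
theorem fill_gauss_holds {C I J : ℕ} (hI : I < 50) (hJ : J < 50)
    (hC : C < 100) {x : ℕ → ℕ} (hx6 : x 6 = 1) {μ : ℕ → ℕ → ℕ → ℝ}
    {Q : List (SLRInstance m n)} {s : RState m n} (hs : s.Holds x μ 0 Q) :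
    ∃ (μ' : ℕ → ℕ → ℕ → ℝ) (D : ℕ),
      ((fill I J (.instr (.gauss ⟨C, 50, 51⟩))).run ω O s).Holds x μ' D Q ∧
      (∀ a ≠ C, μ' a = μ a) ∧ (∀ i < x I, ∀ j < x J, μ' C i j = ω (i * x J + j)) := by
  refine ⟨_, _, fill_holds ω O (C := C) hI hJ _ x hx6 μ 0 1 Q
    (fun i j => ω (i * x J + j)) ?_ s hs hC,
    fun a ha => Function.update_of_ne ha _ _, fun i hi j hj => ?_⟩
  · intro i j s' h50 h51 _ _ _ hD
    refine ⟨fun l _ => rfl, fun a ha hac => ?_, ?_, fun i' j' hij => ?_, rfl, rfl⟩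
    · funext i' j'
      simp [Prog.run, Instr.exec, RState.tick, RState.set, hac]
    · simp [Prog.run, Instr.exec, RState.tick, RState.set, h50, h51, hD]
    · simp [Prog.run, Instr.exec, RState.tick, RState.set, h50, h51, hij]
  · rw [Function.update_self, if_pos ⟨hi, hj⟩]

theorem query_holds {aX ay aδ aθ : ℕ} (hX : aX < 100) (hy : ay < 100) (hδ : aδ < 100)
    {x : ℕ → ℕ} {μ : ℕ → ℕ → ℕ → ℝ} {D : ℕ}
    {Q : List (SLRInstance m n)} {s : RState m n} (hs : s.Holds x μ D Q)
    {q : SLRInstance m n}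
    (hq : q = ⟨fun i j => μ aX i j, fun i => μ ay i 0, μ aδ 0 0⟩) :
    ∃ μ' : ℕ → ℕ → ℕ → ℝ,
      ((Prog.instr (.query aX ay aδ aθ)).run ω O s).Holds x μ' D (Q ++ [q]) ∧
      (∀ a ≠ aθ, μ' a = μ a) ∧ (∀ i : Fin n, μ' aθ i 0 = O q i) := by
  have hr : s.readQuery aX ay aδ = q := by
    rw [hq, RState.readQuery, hs.mem _ hX, hs.mem _ hy, hs.mem _ hδ]
  refine ⟨fun b i j => if h : b = aθ ∧ j = 0 ∧ i < n then O q ⟨i, h.2.2⟩ else μ b i j,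
    ⟨hs.idx, fun a ha => ?_, hs.draws, ?_⟩, fun a ha => ?_, fun i => ?_⟩
  · funext i j
    simp only [Prog.run, Instr.exec, RState.tick, RState.writeVec, hr, hs.mem a ha]
  · simp only [Prog.run, Instr.exec, RState.tick, hr, hs.queries]
  · funext i j
    simp [ha]
  · simp

/-! ### The program -/

namespace Expr

/-- The number of `c < N` with `(c + 1) w ≤ e`, which is `⌊e / w⌋` if this is at most `N`;
to be used under two binders. -/
def floorDiv (N : ℕ) (e w : Expr) : Expr :=
  .sum N (.ite e (.mul (.add (.nat 52) (.rat 1)) w) (.rat 0) (.rat 1))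

/-- `g` if `e = f`, and `0` otherwise. -/
def ifEq (e f g : Expr) : Expr :=
  .ite e f (.rat 0) (.ite f e (.rat 0) g)

/-- The summand is the indicator of c < x / w. Thus integer quotients can be obtained by comparing
reals; N only has to be large enough. -/
theorem sum_range_floorDiv {N x w : ℕ} (hw : 0 < w) (hx : x / w ≤ N) :
    (∑ c ∈ Finset.range N, if (x : ℝ) < ((c : ℝ) + 1) * w then (0 : ℝ) else 1) = (x / w : ℕ) := by
  have h : ∀ c ∈ Finset.range N, (if (x : ℝ) < ((c : ℝ) + 1) * w then (0 : ℝ) else 1) =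
      if c ∈ Finset.range (x / w) then 1 else 0 := by
    intro c _
    have : (x : ℝ) < ((c : ℝ) + 1) * w ↔ ¬ c < x / w := by
      rw [not_lt, ← Nat.lt_succ_iff, Nat.div_lt_iff_lt_mul hw]
      exact_mod_cast Iff.rfl
    simp only [this, Finset.mem_range]
    split_ifs <;> simp_all
  rw [Finset.sum_congr rfl h, Finset.sum_ite_mem, Finset.inter_eq_right.2 (by simpa using hx)]
  simp

theorem prod_range_ite_two {N r : ℕ} (hr : r ≤ N) :
    (∏ c ∈ Finset.range N, if (c : ℝ) < r then (2 : ℝ) else 1) = 2 ^ r := by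
  have h : ∀ c ∈ Finset.range N, (if (c : ℝ) < r then (2 : ℝ) else 1) =
      if c ∈ Finset.range r then 2 else 1 := by
    intro c _
    simp
  rw [Finset.prod_congr rfl h, Finset.prod_ite_mem, Finset.inter_eq_right.2 (by simpa using hr)]
  simp

theorem ifEq_eq (r s g : ℝ) :
    (if r < s then 0 else if s < r then 0 else g) = if r = s then g else 0 := by
  rcases lt_trichotomy r s with h | h | h
  · rw [if_pos h, if_neg h.ne]
  · rw [if_neg h.not_lt, if_neg h.symm.not_lt, if_pos h]
  · rw [if_neg h.not_gt, if_pos h, if_neg h.ne']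

end Expr

/-- The index registers after the initialization. -/
def regs (d k m n ℓ : ℕ) : ℕ → ℕ := fun i =>
  if i = 0 then d else if i = 1 then k else if i = 2 then m else if i = 3 then n else
  if i = 4 then ℓ else if i = 6 then 1 else if i = 7 then 2 * ℓ + 1 else
  if i = 8 then m - k else if i = 9 then d + 1 else 0

/-- Sets the index registers `6, …, 9`. -/
def initProg : Prog :=
  .seq (.instr (.setIdx 6 1)) (.seq (.instr (.addIdx 7 4 4)) (.seq (.instr (.addIdx 7 7 6))
    (.seq (.instr (.subIdx 8 2 1)) (.instr (.addIdx 9 0 6)))))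

open Expr in
/-- Draws the Gaussians into the array `8` and computes `Gsparse` in the array `10`. -/
def gadgetProg : Prog :=
  .seq (fill 2 9 (.instr (.gauss ⟨8, 50, 51⟩))) <|
  -- Registers 5 and 6 hold 0 and 1, so bounds `6 6` make a scalar stored at (0, 0). Arrays 20 and
  -- 21 hold d/k and n/k; 22 and 24 the block numbers of a row a and a column b; 23 the power 2^(a
  -- mod (d/k)); 25 the remainder b mod (n/k); 26 its quotient by that power; and 27 half of 26,
  -- rounded down.
  .seq (tab 20 6 6 (floorDiv 0 (nat 0) (nat 1))) <|
  .seq (tab 21 6 6 (floorDiv 3 (nat 3) (nat 1))) <|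
  .seq (tab 22 0 6 (floorDiv 0 (nat 50) (cell 20 5 5))) <|
  .seq (tab 23 0 6 (prod 0 (ite (nat 52) (sub (nat 50) (mul (cell 20 5 5) (cell 22 50 5)))
    (rat 2) (rat 1)))) <|
  .seq (tab 24 3 6 (floorDiv 3 (nat 50) (cell 21 5 5))) <|
  .seq (tab 25 3 6 (sub (nat 50) (mul (cell 21 5 5) (cell 24 50 5)))) <|
  .seq (tab 26 0 3 (floorDiv 3 (cell 25 51 5) (cell 23 50 5))) <|
  .seq (tab 27 0 3 (floorDiv 3 (cell 26 50 51) (rat 2))) <|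
  tab 10 0 3 (ifEq (cell 22 50 5) (cell 24 51 5)
    -- The difference of array 26 and twice array 27 is the binary digit, mapped from {0, 1} to {-1,
    -- 1}.
    (sub (mul (rat 2) (sub (cell 26 50 51) (mul (rat 2) (cell 27 50 51)))) (rat 1)))

open Expr in
/-- Computes the design matrix in the array `4`, the noiseless response vector in the array
`12`, the noise of scale one in the array `13`, and an upper bound for the residual of the
solution in the array `31`. -/
def designProg : Prog :=
  .seq (tab 11 0 3 (sum 0 (mul (cell 1 50 52) (cell 10 52 51)))) <|
  .seq (tab 28 6 6 (mul (mul (rat 16) (nat 2))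
    (add (rat 1) (sum 0 (sum 0 (mul (cell 1 52 53) (cell 1 52 53))))))) <|
  .seq (tab 4 2 3 (ite (nat 50) (nat 8) (sum 0 (mul (cell 8 50 52) (cell 11 52 51)))
    (ifEq (sub (nat 50) (nat 8)) (cell 24 51 5) (cell 28 5 5)))) <|
  .seq (tab 12 2 6 (ite (nat 50) (nat 8) (sum 0 (mul (cell 8 50 52) (cell 2 52 5)))
    (cell 28 5 5))) <|
  -- Arrays 29 and 30 approximate log m and its square root by counting, since the machine has no
  -- logarithm.
  .seq (tab 29 6 6 (sum 2 (ite (prod 2 (ite (nat 53) (nat 52) (rat 2) (rat 1))) (nat 2)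
    (rat 1) (rat 0)))) <|
  .seq (tab 30 6 6 (sum 2 (ite (mul (nat 52) (nat 52)) (cell 29 5 5) (rat 1) (rat 0)))) <|
  .seq (tab 13 2 6 (mul (mul (mul (mul (rat 100) (cell 0 5 5)) (nat 2)) (cell 30 5 5))
    -- Register 0 holds d, so this reads column d of the Gaussians, which the design does not use.
    (cell 8 50 0))) <|
  tab 31 6 6 (cell 28 5 5)

open Expr in
/-- Computes the smallest scale `2 ^ (-ℓ)` in the array `32`. -/
def scaleProg : Prog :=
  .seq (tab 32 6 6 (rat 1)) <| .loop 4 <|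
  .seq (tab 33 6 6 (div (cell 32 5 5) (rat 2))) (tab 32 6 6 (cell 33 5 5))

open Expr in
/-- Queries the oracle at the current scale, decodes the answer, keeps the decoded vector if
it is better than the ones before, and doubles the scale. -/
def roundProg : Prog :=
  .seq (tab 5 2 6 (add (cell 12 50 5) (mul (cell 32 5 5) (cell 13 50 5)))) <|
  .seq (tab 6 6 6 (div (cell 32 5 5) (rat 100))) <|
  .seq (.instr (.query 4 5 6 7)) <|
  .seq (tab 14 0 6 (ite (rat 0) (sum 3 (mul (cell 10 50 52) (cell 7 52 5)))
    (rat 1) (rat (-1)))) <|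
  .seq (tab 15 0 6 (sub (sum 0 (mul (cell 1 50 52) (cell 14 52 5))) (cell 2 50 5))) <|
  .seq (tab 34 6 6 (sum 0 (mul (cell 15 52 5) (cell 15 52 5)))) <|
  -- An expression may not read the array it fills, so the updates of 3, 31 and 32 pass through 16,
  -- 35 and 33.
  .seq (tab 16 0 6 (ite (cell 34 5 5) (cell 31 5 5) (cell 14 50 5) (cell 3 50 5))) <|
  .seq (tab 3 0 6 (cell 16 50 5)) <|
  .seq (tab 35 6 6 (ite (cell 34 5 5) (cell 31 5 5) (cell 34 5 5) (cell 31 5 5))) <|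
  .seq (tab 31 6 6 (cell 35 5 5)) <|
  .seq (tab 33 6 6 (mul (rat 2) (cell 32 5 5))) <|
  tab 32 6 6 (cell 33 5 5)

/-- The program after the initialization of the index registers. -/
def mainProg : Prog :=
  .seq gadgetProg (.seq designProg (.seq scaleProg (.loop 7 roundProg)))

/-- The reduction. -/
def bddProg : Prog := .seq initProg mainProg

/-! ### Running time of the reduction. -/

section

variable {d k m n ℓ : ℕ} (ω : ℕ → ℝ) (O : SLROracle m n)

theorem initProg_holds (α : ℝ) (B : Matrix (Fin d) (Fin d) ℝ) (t : Fin d → ℝ) :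
    ((initProg.run ω O (initState k m n ℓ α B t))).Holds (regs d k m n ℓ)
      (initState k m n ℓ α B t).mem 0 [] := by
  refine ⟨fun i _ => ?_, fun a _ => rfl, rfl, rfl⟩
  simp only [initProg, Prog.run, Instr.exec, RState.tick, RState.setIdx, Function.update_apply,
    initState, regs]
  by_cases h9 : i = 9
  · subst h9; simp
  by_cases h8 : i = 8
  · subst h8; simp
  by_cases h7 : i = 7
  · subst h7; simp; omega
  by_cases h6 : i = 6
  · subst h6; simp
  simp [h9, h8, h7, h6]

/-- The initialization is kept apart from `mainProg` because it writes registers that later bound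
loops. Afterwards all loop bounds are constant. -/
theorem mainProg_loopIdx : ∀ i ∈ mainProg.loopIdx, i ∉ mainProg.modIdx ∧
    i ∈ [0, 2, 3, 4, 5, 6, 7, 8, 9] := by decide +kernel

theorem mainProg_codepth : mainProg.codepth [4, 7] ≤ 10 := by decide +kernel

theorem mainProg_depth : mainProg.depth [4, 7] = 1 := by decide +kernel

theorem mainProg_weight : mainProg.weight ≤ 4000 := by decide +kernel

theorem bddProg_time (hd : 1 ≤ d) (hm : 6 * d ≤ m) (α : ℝ) (B : Matrix (Fin d) (Fin d) ℝ)
    (t : Fin d → ℝ) {C : ℕ} (hC : 10000 ≤ C) :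
    (bddProg.run ω O (initState k m n ℓ α B t)).time ≤ C * (n + m) ^ C * (ℓ + 1) := by
  have h := initProg_holds (k := k) (n := n) (ℓ := ℓ) ω O α B t
  have htime : (initProg.run ω O (initState k m n ℓ α B t)).time = 5 := by
    simp [initProg, Prog.run, Instr.exec, RState.tick, RState.setIdx, initState]
  rw [bddProg, Prog.run]
  generalize initProg.run ω O (initState k m n ℓ α B t) = s at h htime
  have hk := Prog.run_time_le ω O [4, 7] (n + m) (2 * ℓ + 1) (by omega) (by omega)
    (by omega) (by omega) mainProg s (fun i hi => by
      refine ⟨(mainProg_loopIdx i hi).1, ?_⟩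
      have := (mainProg_loopIdx i hi).2
      simp only [List.mem_cons, List.not_mem_nil, or_false] at this
      rw [h.idx i (by omega)]
      rcases this with rfl | rfl | rfl | rfl | rfl | rfl | rfl | rfl | rfl <;>
        simp [regs] <;> omega)
  rw [mainProg_depth, htime, pow_one] at hk
  have hp : (n + m) ^ mainProg.codepth [4, 7] ≤ (n + m) ^ C :=
    Nat.pow_le_pow_right (by omega) (mainProg_codepth.trans (by omega))
  have hp1 : 1 ≤ (n + m) ^ C := Nat.pow_pos (by omega)
  generalize (n + m) ^ C = A at hp hp1 ⊢
  -- Five steps of initialization; the factor 2 ℓ + 1 appears only once because loops bounded by the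
  -- registers 4 and 7 are not nested.
  calc _ ≤ 5 + 4000 * (A * (2 * ℓ + 1)) :=
        hk.trans (Nat.add_le_add_left (Nat.mul_le_mul mainProg_weight
          (Nat.mul_le_mul_right _ hp)) _)
    _ ≤ 10000 * A * (ℓ + 1) := by nlinarith
    _ ≤ _ := by gcongr

end

/-! ### Contents of the arrays computed by the program. -/

section

variable {d k m n ℓ : ℕ} (ω : ℕ → ℝ) (O : SLROracle m n)

/-- Every intermediate table is an exact cast of a natural number, so comparing block numbers as
reals agrees with comparing them in `Gsparse`. -/
theorem gadgetProg_holds (hd : 1 ≤ d) (hk : k ∣ d) (hn : n = k * 2 ^ (d / k))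
    {μ : ℕ → ℕ → ℕ → ℝ} {Q : List (SLRInstance m n)} {s : RState m n}
    (hs : s.Holds (regs d k m n ℓ) μ 0 Q) :
    ∃ (μ' : ℕ → ℕ → ℕ → ℝ) (D : ℕ),
      (gadgetProg.run ω O s).Holds (regs d k m n ℓ) μ' D Q ∧
      (∀ a < 3, μ' a = μ a) ∧
      (∀ i < m, ∀ j < d + 1, μ' 8 i j = ω (i * (d + 1) + j)) ∧
      (∀ (a : Fin d) (b : Fin n), μ' 10 a b = Gsparse d k n a b) ∧
      (∀ b < n, μ' 24 b 0 = (b / (n / k) : ℕ)) := by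
  have hk0 : 0 < k := Nat.pos_of_dvd_of_pos hk hd
  have hnk : n / k = 2 ^ (d / k) := by rw [hn, Nat.mul_div_cancel_left _ hk0]
  have hw : 0 < d / k := Nat.div_pos (Nat.le_of_dvd hd hk) hk0
  have hW : 0 < n / k := by rw [hnk]; positivity
  obtain ⟨μ₀, D, h₀, f₀, v₀⟩ := fill_gauss_holds ω O (C := 8) (I := 2) (J := 9) (by omega)
    (by omega) (by omega) rfl hs
  obtain ⟨μ₁, h₁, f₁, v₁⟩ := tab_holds ω O (C := 20) (I := 6) (J := 6)
    (Expr.floorDiv 0 (.nat 0) (.nat 1)) rfl (by omega) (by omega) (by omega) rfl rfl h₀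
  obtain ⟨μ₂, h₂, f₂, v₂⟩ := tab_holds ω O (C := 21) (I := 6) (J := 6)
    (Expr.floorDiv 3 (.nat 3) (.nat 1)) rfl (by omega) (by omega) (by omega) rfl rfl h₁
  obtain ⟨μ₃, h₃, f₃, v₃⟩ := tab_holds ω O (C := 22) (I := 0) (J := 6)
    (Expr.floorDiv 0 (.nat 50) (.cell 20 5 5)) rfl (by omega) (by omega) (by omega) rfl rfl h₂
  obtain ⟨μ₄, h₄, f₄, v₄⟩ := tab_holds ω O (C := 23) (I := 0) (J := 6)
    (.prod 0 (.ite (.nat 52) (.sub (.nat 50) (.mul (.cell 20 5 5) (.cell 22 50 5)))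
      (.rat 2) (.rat 1))) rfl (by omega) (by omega) (by omega) rfl rfl h₃
  obtain ⟨μ₅, h₅, f₅, v₅⟩ := tab_holds ω O (C := 24) (I := 3) (J := 6)
    (Expr.floorDiv 3 (.nat 50) (.cell 21 5 5)) rfl (by omega) (by omega) (by omega) rfl rfl h₄
  obtain ⟨μ₆, h₆, f₆, v₆⟩ := tab_holds ω O (C := 25) (I := 3) (J := 6)
    (.sub (.nat 50) (.mul (.cell 21 5 5) (.cell 24 50 5)))
    rfl (by omega) (by omega) (by omega) rfl rfl h₅
  obtain ⟨μ₇, h₇, f₇, v₇⟩ := tab_holds ω O (C := 26) (I := 0) (J := 3)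
    (Expr.floorDiv 3 (.cell 25 51 5) (.cell 23 50 5))
    rfl (by omega) (by omega) (by omega) rfl rfl h₆
  obtain ⟨μ₈, h₈, f₈, v₈⟩ := tab_holds ω O (C := 27) (I := 0) (J := 3)
    (Expr.floorDiv 3 (.cell 26 50 51) (.rat 2)) rfl (by omega) (by omega) (by omega) rfl rfl h₇
  obtain ⟨μ₉, h₉, f₉, v₉⟩ := tab_holds ω O (C := 10) (I := 0) (J := 3)
    (.ifEq (.cell 22 50 5) (.cell 24 51 5)
      (.sub (.mul (.rat 2) (.sub (.cell 26 50 51) (.mul (.rat 2) (.cell 27 50 51)))) (.rat 1)))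
    rfl (by omega) (by omega) (by omega) rfl rfl h₈
  simp only [Expr.eval, Expr.floorDiv, Expr.ifEq, entryIdx, Function.update_apply, regs,
    Nat.reduceAdd, Nat.reduceEqDiff, if_true, if_false, Nat.lt_one_iff, forall_eq, Rat.cast_zero,
    Rat.cast_one, Rat.cast_ofNat, Expr.ifEq_eq] at v₀ v₁ v₂ v₃ v₄ v₅ v₆ v₇ v₈ v₉
  have e₁ : μ₁ 20 0 0 = (d / k : ℕ) :=
    v₁.trans (Expr.sum_range_floorDiv hk0 (Nat.div_le_self _ _))
  have e₂ : μ₂ 21 0 0 = (n / k : ℕ) :=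
    v₂.trans (Expr.sum_range_floorDiv hk0 (Nat.div_le_self _ _))
  have e₃ : ∀ a < d, μ₃ 22 a 0 = (a / (d / k) : ℕ) := fun a ha => by
    rw [v₃ a ha, f₂ 20 (by omega), e₁]
    exact Expr.sum_range_floorDiv hw ((Nat.div_le_self _ _).trans ha.le)
  have e₄ : ∀ a < d, μ₄ 23 a 0 = (2 ^ (a % (d / k)) : ℕ) := fun a ha => by
    rw [v₄ a ha, f₃ 20 (by omega), f₂ 20 (by omega), e₁, e₃ a ha]
    have : (a : ℝ) - (d / k : ℕ) * (a / (d / k) : ℕ) = (a % (d / k) : ℕ) := by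
      rw [sub_eq_iff_eq_add]
      exact_mod_cast (Nat.mod_add_div a (d / k)).symm
    rw [this, Expr.prod_range_ite_two ((Nat.mod_le _ _).trans ha.le)]
    push_cast
    rfl
  have e₅ : ∀ b < n, μ₅ 24 b 0 = (b / (n / k) : ℕ) := fun b hb => by
    rw [v₅ b hb, f₄ 21 (by omega), f₃ 21 (by omega), e₂]
    exact Expr.sum_range_floorDiv hW ((Nat.div_le_self _ _).trans hb.le)
  have e₆ : ∀ b < n, μ₆ 25 b 0 = (b % (n / k) : ℕ) := fun b hb => by
    rw [v₆ b hb, f₅ 21 (by omega), f₄ 21 (by omega), f₃ 21 (by omega), e₂, e₅ b hb,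
      sub_eq_iff_eq_add]
    exact_mod_cast (Nat.mod_add_div b (n / k)).symm
  have hmod : ∀ b < n, b % (n / k) ≤ n := fun b hb => (Nat.mod_le _ _).trans hb.le
  have e₇ : ∀ a < d, ∀ b < n, μ₇ 26 a b = (b % (n / k) / 2 ^ (a % (d / k)) : ℕ) :=
    fun a ha b hb => by
    rw [v₇ a ha b hb, f₆ 23 (by omega), f₅ 23 (by omega), e₄ a ha, e₆ b hb]
    exact Expr.sum_range_floorDiv (by positivity) ((Nat.div_le_self _ _).trans (hmod b hb))
  have e₈ : ∀ a < d, ∀ b < n, μ₈ 27 a b = (b % (n / k) / 2 ^ (a % (d / k)) / 2 : ℕ) :=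
    fun a ha b hb => by
    rw [v₈ a ha b hb, e₇ a ha b hb]
    exact Expr.sum_range_floorDiv (w := 2) (by omega)
      ((Nat.div_le_self _ _).trans ((Nat.div_le_self _ _).trans (hmod b hb)))
  refine ⟨μ₉, D, h₉, fun a ha => ?_, fun i hi j hj => ?_, fun a b => ?_, fun b hb => ?_⟩
  · rw [f₉ a (by omega), f₈ a (by omega), f₇ a (by omega), f₆ a (by omega), f₅ a (by omega),
      f₄ a (by omega), f₃ a (by omega), f₂ a (by omega), f₁ a (by omega), f₀ a (by omega)]
  · rw [f₉ _ (by omega), f₈ _ (by omega), f₇ _ (by omega), f₆ _ (by omega), f₅ _ (by omega),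
      f₄ _ (by omega), f₃ _ (by omega), f₂ _ (by omega), f₁ _ (by omega), v₀ i hi j hj]
  · rw [v₉ a a.2 b b.2, f₈ 22 (by omega), f₇ 22 (by omega), f₆ 22 (by omega), f₅ 22 (by omega),
      f₄ 22 (by omega), e₃ a a.2, f₈ 24 (by omega), f₇ 24 (by omega), f₆ 24 (by omega), e₅ b b.2,
      f₈ 26 (by omega), e₇ a a.2 b b.2, e₈ a a.2 b b.2, Gsparse]
    simp only [Nat.cast_inj]
    refine if_congr Iff.rfl ?_ rfl
    rw [Nat.testBit_eq_decide_div_mod_eq]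
    generalize (b : ℕ) % (n / k) / 2 ^ ((a : ℕ) % (d / k)) = q
    have hq := Nat.mod_add_div q 2
    have hq' : (q : ℝ) - 2 * (q / 2 : ℕ) = (q % 2 : ℕ) := by
      rw [sub_eq_iff_eq_add]
      exact_mod_cast hq.symm
    rw [hq']
    rcases Nat.mod_two_eq_zero_or_one q with h | h <;> rw [h] <;> norm_num
  · rw [f₉ _ (by omega), f₈ _ (by omega), f₇ _ (by omega), f₆ _ (by omega), e₅ b hb]

/-- The number of `c < m` with `2 ^ c < m`. -/
def logCount (m : ℕ) : ℕ := ((Finset.range m).filter fun c => 2 ^ c < m).card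

/-- The number of `c < m` with `c ^ 2 < logCount m`. -/
def sqrtLogCount (m : ℕ) : ℕ := ((Finset.range m).filter fun c => c * c < logCount m).card

/-- The scale of the rows of the design matrix that force the block sums. -/
def gammaBin (m : ℕ) (B : Matrix (Fin d) (Fin d) ℝ) : ℝ :=
  16 * m * (1 + ∑ a, ∑ c, B a c * B a c)

/-- The Gaussian matrix on the random tape. -/
def tapeMatrix (d : ℕ) {r : ℕ} (ω : ℕ → ℝ) : Matrix (Fin r) (Fin d) ℝ :=
  fun i a => ω (i * (d + 1) + a)

/-- The design matrix of the program. -/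
def designMatrix (k m n : ℕ) (B : Matrix (Fin d) (Fin d) ℝ) (ω : ℕ → ℝ) :
    Matrix (Fin m) (Fin n) ℝ :=
  stackRows (fun i : Fin (m - k) => WithLp.toLp 2 fun b =>
    (tapeMatrix d ω * (B * Gsparse d k n) : Matrix (Fin (m - k)) (Fin n) ℝ) i b)
    (gammaBin m B • Gpartite k n)

/-- The response vector of the program without the noise. -/
def cleanResponse (k m : ℕ) (B : Matrix (Fin d) (Fin d) ℝ) (t : Fin d → ℝ) (ω : ℕ → ℝ) :
    Fin m → ℝ :=
  fun i => if (i : ℕ) < m - k then (tapeMatrix d ω : Matrix (Fin m) (Fin d) ℝ).mulVec t i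
    else gammaBin m B

theorem designProg_holds (hd : 1 ≤ d) (hk : k ∣ d) (α : ℝ)
    (B : Matrix (Fin d) (Fin d) ℝ) (t : Fin d → ℝ)
    {μ : ℕ → ℕ → ℕ → ℝ} {D : ℕ} {Q : List (SLRInstance m n)} {s : RState m n}
    (hs : s.Holds (regs d k m n ℓ) μ D Q) (hα : μ 0 0 0 = α)
    (hB : ∀ a c : Fin d, μ 1 a c = B a c) (ht : ∀ a : Fin d, μ 2 a 0 = t a)
    (hω : ∀ i < m, ∀ j < d + 1, μ 8 i j = ω (i * (d + 1) + j))
    (hG : ∀ (a : Fin d) (b : Fin n), μ 10 a b = Gsparse d k n a b)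
    (hb : ∀ b < n, μ 24 b 0 = (b / (n / k) : ℕ)) :
    ∃ (μ' : ℕ → ℕ → ℕ → ℝ),
      (designProg.run ω O s).Holds (regs d k m n ℓ) μ' D Q ∧
      (∀ a < 3, μ' a = μ a) ∧ μ' 10 = μ 10 ∧
      (∀ (i : Fin m) (b : Fin n), μ' 4 i b = designMatrix k m n B ω i b) ∧
      (∀ (i : Fin m), μ' 12 i 0 = cleanResponse k m B t ω i) ∧
      (∀ (i : Fin m), μ' 13 i 0 = 100 * α * m * sqrtLogCount m * ω (i * (d + 1) + d)) ∧
      μ' 31 0 0 = gammaBin m B := by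
  have hk0 : 0 < k := Nat.pos_of_dvd_of_pos hk hd
  obtain ⟨μ₁, h₁, f₁, v₁⟩ := tab_holds ω O (C := 11) (I := 0) (J := 3)
    (.sum 0 (.mul (.cell 1 50 52) (.cell 10 52 51)))
    rfl (by omega) (by omega) (by omega) rfl rfl hs
  obtain ⟨μ₂, h₂, f₂, v₂⟩ := tab_holds ω O (C := 28) (I := 6) (J := 6)
    (.mul (.mul (.rat 16) (.nat 2))
      (.add (.rat 1) (.sum 0 (.sum 0 (.mul (.cell 1 52 53) (.cell 1 52 53))))))
    rfl (by omega) (by omega) (by omega) rfl rfl h₁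
  obtain ⟨μ₃, h₃, f₃, v₃⟩ := tab_holds ω O (C := 4) (I := 2) (J := 3)
    (.ite (.nat 50) (.nat 8) (.sum 0 (.mul (.cell 8 50 52) (.cell 11 52 51)))
      (.ifEq (.sub (.nat 50) (.nat 8)) (.cell 24 51 5) (.cell 28 5 5)))
    rfl (by omega) (by omega) (by omega) rfl rfl h₂
  obtain ⟨μ₄, h₄, f₄, v₄⟩ := tab_holds ω O (C := 12) (I := 2) (J := 6)
    (.ite (.nat 50) (.nat 8) (.sum 0 (.mul (.cell 8 50 52) (.cell 2 52 5))) (.cell 28 5 5))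
    rfl (by omega) (by omega) (by omega) rfl rfl h₃
  obtain ⟨μ₅, h₅, f₅, v₅⟩ := tab_holds ω O (C := 29) (I := 6) (J := 6)
    (.sum 2 (.ite (.prod 2 (.ite (.nat 53) (.nat 52) (.rat 2) (.rat 1))) (.nat 2)
      (.rat 1) (.rat 0))) rfl (by omega) (by omega) (by omega) rfl rfl h₄
  obtain ⟨μ₆, h₆, f₆, v₆⟩ := tab_holds ω O (C := 30) (I := 6) (J := 6)
    (.sum 2 (.ite (.mul (.nat 52) (.nat 52)) (.cell 29 5 5) (.rat 1) (.rat 0)))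
    rfl (by omega) (by omega) (by omega) rfl rfl h₅
  obtain ⟨μ₇, h₇, f₇, v₇⟩ := tab_holds ω O (C := 13) (I := 2) (J := 6)
    (.mul (.mul (.mul (.mul (.rat 100) (.cell 0 5 5)) (.nat 2)) (.cell 30 5 5)) (.cell 8 50 0))
    rfl (by omega) (by omega) (by omega) rfl rfl h₆
  obtain ⟨μ₈, h₈, f₈, v₈⟩ := tab_holds ω O (C := 31) (I := 6) (J := 6)
    (.cell 28 5 5) rfl (by omega) (by omega) (by omega) rfl rfl h₇
  simp only [Expr.eval, Expr.ifEq, entryIdx, Function.update_apply, regs,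
    Nat.reduceAdd, Nat.reduceEqDiff, if_true, if_false, Nat.lt_one_iff, forall_eq, Rat.cast_zero,
    Rat.cast_one, Rat.cast_ofNat, Expr.ifEq_eq] at v₁ v₂ v₃ v₄ v₅ v₆ v₇ v₈
  have e₁ : ∀ (a : Fin d) (b : Fin n), μ₁ 11 a b = (B * Gsparse d k n) a b := fun a b => by
    rw [v₁ a a.2 b b.2, Finset.sum_range, Matrix.mul_apply]
    simp only [hB, hG]
  have e₂ : μ₂ 28 0 0 = gammaBin m B := by
    rw [v₂, f₁ 1 (by omega), gammaBin]
    simp only [Finset.sum_range, hB]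
  have hω' : ∀ (i : Fin m), ∀ j < d + 1, μ 8 i j = ω (i * (d + 1) + j) := fun i => hω i i.2
  have e₃ : ∀ (i : Fin m) (b : Fin n), μ₃ 4 i b = designMatrix k m n B ω i b := fun i b => by
    rw [v₃ i i.2 b b.2, f₂ 8 (by omega), f₁ 8 (by omega), f₂ 11 (by omega), f₂ 24 (by omega),
      f₁ 24 (by omega), hb b b.2, e₂]
    simp only [Finset.sum_range, e₁, Nat.cast_lt, designMatrix, stackRows]
    by_cases hi : (i : ℕ) < m - k
    · rw [if_pos hi, dif_pos hi, Matrix.mul_apply]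
      refine Finset.sum_congr rfl fun a _ => ?_
      rw [hω' i a (by omega)]
      rfl
    · rw [if_neg hi, dif_neg hi, ← Nat.cast_sub (not_lt.1 hi)]
      simp [Gpartite]
  have e₄ : ∀ (i : Fin m), μ₄ 12 i 0 = cleanResponse k m B t ω i := fun i => by
    rw [v₄ i i.2, f₃ 8 (by omega), f₂ 8 (by omega), f₁ 8 (by omega), f₃ 2 (by omega),
      f₂ 2 (by omega), f₁ 2 (by omega), f₃ 28 (by omega), e₂]
    simp only [Finset.sum_range, ht, Nat.cast_lt, cleanResponse]
    refine if_congr Iff.rfl ?_ rfl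
    refine Finset.sum_congr rfl fun a _ => ?_
    rw [hω' i a (by omega)]
    rfl
  have e₅ : μ₅ 29 0 0 = logCount m := by
    rw [v₅, logCount, ← Finset.sum_boole]
    refine Finset.sum_congr rfl fun c hc => ?_
    rw [Expr.prod_range_ite_two (Finset.mem_range.1 hc).le]
    refine if_congr ?_ rfl rfl
    exact_mod_cast Iff.rfl
  have e₆ : μ₆ 30 0 0 = sqrtLogCount m := by
    rw [v₆, e₅, sqrtLogCount, ← Finset.sum_boole]
    refine Finset.sum_congr rfl fun c hc => ?_
    refine if_congr ?_ rfl rfl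
    exact_mod_cast Iff.rfl
  have e₇ : ∀ (i : Fin m),
      μ₇ 13 i 0 = 100 * α * m * sqrtLogCount m * ω (i * (d + 1) + d) := fun i => by
    rw [v₇ i i.2, e₆, f₆ 0 (by omega), f₅ 0 (by omega), f₄ 0 (by omega), f₃ 0 (by omega),
      f₂ 0 (by omega), f₁ 0 (by omega), hα, f₆ 8 (by omega), f₅ 8 (by omega), f₄ 8 (by omega),
      f₃ 8 (by omega), f₂ 8 (by omega), f₁ 8 (by omega), hω' i d (by omega)]
  refine ⟨μ₈, h₈, fun a ha => ?_, ?_, fun i b => ?_, fun i => ?_, fun i => ?_, ?_⟩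
  · rw [f₈ a (by omega), f₇ a (by omega), f₆ a (by omega), f₅ a (by omega),
      f₄ a (by omega), f₃ a (by omega), f₂ a (by omega), f₁ a (by omega)]
  · rw [f₈ _ (by omega), f₇ _ (by omega), f₆ _ (by omega), f₅ _ (by omega),
      f₄ _ (by omega), f₃ _ (by omega), f₂ _ (by omega), f₁ _ (by omega)]
  · rw [f₈ _ (by omega), f₇ _ (by omega), f₆ _ (by omega), f₅ _ (by omega),
      f₄ _ (by omega), e₃]
  · rw [f₈ _ (by omega), f₇ _ (by omega), f₆ _ (by omega), f₅ _ (by omega), e₄]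
  · rw [f₈ _ (by omega), e₇]
  · rw [v₈, f₇ _ (by omega), f₆ _ (by omega), f₅ _ (by omega), f₄ _ (by omega), f₃ _ (by omega),
      e₂]

theorem scaleProg_holds {μ : ℕ → ℕ → ℕ → ℝ} {D : ℕ} {Q : List (SLRInstance m n)}
    {s : RState m n} (hs : s.Holds (regs d k m n ℓ) μ D Q) :
    ∃ (μ' : ℕ → ℕ → ℕ → ℝ),
      (scaleProg.run ω O s).Holds (regs d k m n ℓ) μ' D Q ∧
      (∀ a < 32, μ' a = μ a) ∧ μ' 32 0 0 = (2⁻¹ : ℝ) ^ ℓ := by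
  obtain ⟨μ₁, h₁, f₁, v₁⟩ := tab_holds ω O (C := 32) (I := 6) (J := 6)
    (.rat 1) rfl (by omega) (by omega) (by omega) rfl rfl hs
  set body : Prog := .seq (tab 33 6 6 (.div (.cell 32 5 5) (.rat 2)))
    (tab 32 6 6 (.cell 33 5 5)) with hbody
  set s₁ := (tab 32 6 6 (.rat 1)).run ω O s with hs₁
  have key : ∀ r : ℕ, ∃ (μ' : ℕ → ℕ → ℕ → ℝ),
      ((fun s' => (body.run ω O s').tick 1)^[r] (s₁.tick 1)).Holds (regs d k m n ℓ) μ' D Q ∧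
      (∀ a < 32, μ' a = μ a) ∧ μ' 32 0 0 = (2⁻¹ : ℝ) ^ r := by
    intro r
    induction r with
    | zero =>
      refine ⟨μ₁, ⟨h₁.idx, h₁.mem, h₁.draws, h₁.queries⟩, fun a ha => f₁ a (by omega), ?_⟩
      simpa [Expr.eval, regs] using v₁ 0 (by simp [regs]) 0 (by simp [regs])
    | succ r ih =>
      obtain ⟨μ', h', f', v'⟩ := ih
      rw [Function.iterate_succ_apply']
      obtain ⟨μ₂, h₂, f₂, v₂⟩ := tab_holds ω O (C := 33) (I := 6) (J := 6)
        (.div (.cell 32 5 5) (.rat 2)) rfl (by omega) (by omega) (by omega) rfl rfl h'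
      obtain ⟨μ₃, h₃, f₃, v₃⟩ := tab_holds ω O (C := 32) (I := 6) (J := 6)
        (.cell 33 5 5) rfl (by omega) (by omega) (by omega) rfl rfl h₂
      refine ⟨μ₃, ⟨h₃.idx, h₃.mem, h₃.draws, h₃.queries⟩, fun a ha => ?_, ?_⟩
      · rw [f₃ a (by omega), f₂ a (by omega), f' a ha]
      · have e₂ := v₂ 0 (by simp [regs]) 0 (by simp [regs])
        have e₃ := v₃ 0 (by simp [regs]) 0 (by simp [regs])
        simp only [Expr.eval, entryIdx, Function.update_apply, regs, Nat.reduceEqDiff, if_false,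
          Rat.cast_ofNat] at e₂ e₃
        rw [e₃, e₂, v', pow_succ, div_eq_mul_inv]
  have hl : s₁.idx 4 = ℓ := by rw [h₁.idx 4 (by omega)]; rfl
  rw [scaleProg, Prog.run, Prog.run, ← hs₁, hl]
  exact key ℓ

end

/-! ### The rounds of the program: queries, decoding and the best candidate. -/

open Classical in
/-- The vector of the signs of the entries. -/
def signVec {d : ℕ} (v : Fin d → ℝ) : Fin d → ℝ := fun a => if 0 < v a then 1 else -1

theorem isSignVector_signVec {d : ℕ} (v : Fin d → ℝ) : IsSignVector (signVec v) := fun a => by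
  unfold signVec
  split_ifs
  · exact Or.inl rfl
  · exact Or.inr rfl

/-- The squared distance of `B v` from `t`. -/
def sqResidual {d : ℕ} (B : Matrix (Fin d) (Fin d) ℝ) (t v : Fin d → ℝ) : ℝ :=
  ∑ a, (B.mulVec v a - t a) * (B.mulVec v a - t a)

/-- The response vector of the query at scale `s`. -/
def noisyResponse {d : ℕ} (k m : ℕ) (α : ℝ) (B : Matrix (Fin d) (Fin d) ℝ) (t : Fin d → ℝ)
    (s : ℝ) (ω : ℕ → ℝ) : Fin m → ℝ := fun i =>
  cleanResponse k m B t ω i + s * (100 * α * m * sqrtLogCount m * ω (i * (d + 1) + d))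

/-- The query at scale `s`. -/
def scaleQuery {d : ℕ} (k m n : ℕ) (α : ℝ) (B : Matrix (Fin d) (Fin d) ℝ) (t : Fin d → ℝ)
    (s : ℝ) (ω : ℕ → ℝ) : SLRInstance m n :=
  ⟨designMatrix k m n B ω, noisyResponse k m α B t s ω, s / 100⟩

/-- The scale in round `r`. -/
def scaleAt (ℓ r : ℕ) : ℝ := (2⁻¹ : ℝ) ^ ℓ * 2 ^ r

section

variable {d k m n ℓ : ℕ} (ω : ℕ → ℝ) (O : SLROracle m n)

/-- The contents of the arrays that are fixed during the rounds. -/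
structure RoundData (α : ℝ) (B : Matrix (Fin d) (Fin d) ℝ) (t : Fin d → ℝ) (k m n : ℕ)
    (ω : ℕ → ℝ) (μ : ℕ → ℕ → ℕ → ℝ) : Prop where
  mat : ∀ a c : Fin d, μ 1 a c = B a c
  target : ∀ a : Fin d, μ 2 a 0 = t a
  gadget : ∀ (a : Fin d) (b : Fin n), μ 10 a b = Gsparse d k n a b
  design : ∀ (i : Fin m) (b : Fin n), μ 4 i b = designMatrix k m n B ω i b
  clean : ∀ (i : Fin m), μ 12 i 0 = cleanResponse k m B t ω i
  noise : ∀ (i : Fin m), μ 13 i 0 = 100 * α * m * sqrtLogCount m * ω (i * (d + 1) + d)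

theorem roundProg_holds (α : ℝ) (B : Matrix (Fin d) (Fin d) ℝ) (t : Fin d → ℝ)
    {μ : ℕ → ℕ → ℕ → ℝ} {D : ℕ} {Q : List (SLRInstance m n)} {s : RState m n}
    (hs : s.Holds (regs d k m n ℓ) μ D Q) (hR : RoundData α B t k m n ω μ)
    {q : SLRInstance m n} (hq : q = scaleQuery k m n α B t (μ 32 0 0) ω)
    {z : Fin d → ℝ} (hz : z = signVec ((Gsparse d k n).mulVec (O q))) :
    ∃ (μ' : ℕ → ℕ → ℕ → ℝ),
      (roundProg.run ω O s).Holds (regs d k m n ℓ) μ' D (Q ++ [q]) ∧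
      RoundData α B t k m n ω μ' ∧ μ' 32 0 0 = 2 * μ 32 0 0 ∧
      (sqResidual B t z < μ 31 0 0 →
        (∀ a : Fin d, μ' 3 a 0 = z a) ∧ μ' 31 0 0 = sqResidual B t z) ∧
      (μ 31 0 0 ≤ sqResidual B t z →
        (∀ a : Fin d, μ' 3 a 0 = μ 3 a 0) ∧ μ' 31 0 0 = μ 31 0 0) := by
  obtain ⟨μ₁, h₁, f₁, v₁⟩ := tab_holds ω O (C := 5) (I := 2) (J := 6)
    (.add (.cell 12 50 5) (.mul (.cell 32 5 5) (.cell 13 50 5)))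
    rfl (by omega) (by omega) (by omega) rfl rfl hs
  obtain ⟨μ₂, h₂, f₂, v₂⟩ := tab_holds ω O (C := 6) (I := 6) (J := 6)
    (.div (.cell 32 5 5) (.rat 100)) rfl (by omega) (by omega) (by omega) rfl rfl h₁
  simp only [Expr.eval, entryIdx, Function.update_apply, regs, Nat.reduceEqDiff, if_true,
    if_false, Nat.lt_one_iff, forall_eq, Rat.cast_ofNat] at v₁ v₂
  have hq₂ : q = ⟨fun i j => μ₂ 4 i j, fun i => μ₂ 5 i 0, μ₂ 6 0 0⟩ := by
    rw [hq, scaleQuery]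
    congr 1
    · funext i j
      rw [f₂ _ (by omega), f₁ _ (by omega), hR.design]
    · funext i
      rw [f₂ _ (by omega), v₁ i i.2, hR.clean, hR.noise]
      rfl
    · rw [v₂, f₁ _ (by omega)]
  obtain ⟨μ₃, h₃, f₃, v₃⟩ := query_holds ω O (aθ := 7) (by omega) (by omega) (by omega) h₂ hq₂
  obtain ⟨μ₄, h₄, f₄, v₄⟩ := tab_holds ω O (C := 14) (I := 0) (J := 6)
    (.ite (.rat 0) (.sum 3 (.mul (.cell 10 50 52) (.cell 7 52 5))) (.rat 1) (.rat (-1)))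
    rfl (by omega) (by omega) (by omega) rfl rfl h₃
  obtain ⟨μ₅, h₅, f₅, v₅⟩ := tab_holds ω O (C := 15) (I := 0) (J := 6)
    (.sub (.sum 0 (.mul (.cell 1 50 52) (.cell 14 52 5))) (.cell 2 50 5))
    rfl (by omega) (by omega) (by omega) rfl rfl h₄
  obtain ⟨μ₆, h₆, f₆, v₆⟩ := tab_holds ω O (C := 34) (I := 6) (J := 6)
    (.sum 0 (.mul (.cell 15 52 5) (.cell 15 52 5)))
    rfl (by omega) (by omega) (by omega) rfl rfl h₅
  obtain ⟨μ₇, h₇, f₇, v₇⟩ := tab_holds ω O (C := 16) (I := 0) (J := 6)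
    (.ite (.cell 34 5 5) (.cell 31 5 5) (.cell 14 50 5) (.cell 3 50 5))
    rfl (by omega) (by omega) (by omega) rfl rfl h₆
  obtain ⟨μ₈, h₈, f₈, v₈⟩ := tab_holds ω O (C := 3) (I := 0) (J := 6)
    (.cell 16 50 5) rfl (by omega) (by omega) (by omega) rfl rfl h₇
  obtain ⟨μ₉, h₉, f₉, v₉⟩ := tab_holds ω O (C := 35) (I := 6) (J := 6)
    (.ite (.cell 34 5 5) (.cell 31 5 5) (.cell 34 5 5) (.cell 31 5 5))
    rfl (by omega) (by omega) (by omega) rfl rfl h₈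
  obtain ⟨ν₁, k₁, g₁, w₁⟩ := tab_holds ω O (C := 31) (I := 6) (J := 6)
    (.cell 35 5 5) rfl (by omega) (by omega) (by omega) rfl rfl h₉
  obtain ⟨ν₂, k₂, g₂, w₂⟩ := tab_holds ω O (C := 33) (I := 6) (J := 6)
    (.mul (.rat 2) (.cell 32 5 5)) rfl (by omega) (by omega) (by omega) rfl rfl k₁
  obtain ⟨ν₃, k₃, g₃, w₃⟩ := tab_holds ω O (C := 32) (I := 6) (J := 6)
    (.cell 33 5 5) rfl (by omega) (by omega) (by omega) rfl rfl k₂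
  simp only [Expr.eval, entryIdx, Function.update_apply, regs, Nat.reduceEqDiff, if_true,
    if_false, Nat.lt_one_iff, forall_eq, Rat.cast_ofNat, Rat.cast_zero, Rat.cast_one,
    Rat.cast_neg, Finset.sum_range] at v₄ v₅ v₆ v₇ v₈ v₉ w₁ w₂ w₃
  have e₄ : ∀ a : Fin d, μ₄ 14 a 0 = z a := fun a => by
    rw [v₄ a a.2, hz, signVec, f₃ 10 (by omega), f₂ 10 (by omega), f₁ 10 (by omega)]
    simp only [hR.gadget, v₃]
    rfl
  have e₅ : ∀ a : Fin d, μ₅ 15 a 0 = B.mulVec z a - t a := fun a => by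
    rw [v₅ a a.2, f₄ 1 (by omega), f₃ 1 (by omega), f₂ 1 (by omega), f₁ 1 (by omega),
      f₄ 2 (by omega), f₃ 2 (by omega), f₂ 2 (by omega), f₁ 2 (by omega), hR.target]
    simp only [hR.mat, e₄]
    rfl
  have e₆ : μ₆ 34 0 0 = sqResidual B t z := by
    rw [v₆]
    simp only [e₅]
    rfl
  have e₇ : ∀ a : Fin d, ν₃ 3 a 0 = if sqResidual B t z < μ 31 0 0 then z a else μ 3 a 0 :=
    fun a => by
    rw [g₃ 3 (by omega), g₂ 3 (by omega), g₁ 3 (by omega), f₉ 3 (by omega), v₈ a a.2, v₇ a a.2,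
      e₆, f₆ 31 (by omega), f₅ 31 (by omega), f₄ 31 (by omega), f₃ 31 (by omega),
      f₂ 31 (by omega), f₁ 31 (by omega), f₆ 14 (by omega), f₅ 14 (by omega), e₄,
      f₆ 3 (by omega), f₅ 3 (by omega), f₄ 3 (by omega), f₃ 3 (by omega),
      f₂ 3 (by omega), f₁ 3 (by omega)]
  have e₈ : ν₃ 31 0 0 = if sqResidual B t z < μ 31 0 0 then sqResidual B t z else μ 31 0 0 := by
    rw [g₃ 31 (by omega), g₂ 31 (by omega), w₁, v₉, f₈ 34 (by omega), f₇ 34 (by omega), e₆,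
      f₈ 31 (by omega), f₇ 31 (by omega), f₆ 31 (by omega), f₅ 31 (by omega), f₄ 31 (by omega),
      f₃ 31 (by omega), f₂ 31 (by omega), f₁ 31 (by omega)]
  have hfr : ∀ a, a = 1 ∨ a = 2 ∨ a = 10 ∨ a = 4 ∨ a = 12 ∨ a = 13 → ν₃ a = μ a := fun a ha => by
    rw [g₃ a (by omega), g₂ a (by omega), g₁ a (by omega), f₉ a (by omega), f₈ a (by omega),
      f₇ a (by omega), f₆ a (by omega), f₅ a (by omega), f₄ a (by omega), f₃ a (by omega),
      f₂ a (by omega), f₁ a (by omega)]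
  refine ⟨ν₃, k₃, ⟨?_, ?_, ?_, ?_, ?_, ?_⟩, ?_, fun h => ⟨fun a => ?_, ?_⟩,
    fun h => ⟨fun a => ?_, ?_⟩⟩
  · rw [hfr 1 (by omega)]; exact hR.mat
  · rw [hfr 2 (by omega)]; exact hR.target
  · rw [hfr 10 (by omega)]; exact hR.gadget
  · rw [hfr 4 (by omega)]; exact hR.design
  · rw [hfr 12 (by omega)]; exact hR.clean
  · rw [hfr 13 (by omega)]; exact hR.noise
  · rw [w₃, w₂, g₁ 32 (by omega), f₉ 32 (by omega), f₈ 32 (by omega),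
      f₇ 32 (by omega), f₆ 32 (by omega), f₅ 32 (by omega), f₄ 32 (by omega), f₃ 32 (by omega),
      f₂ 32 (by omega), f₁ 32 (by omega)]
  · rw [e₇, if_pos h]
  · rw [e₈, if_pos h]
  · rw [e₇, if_neg h.not_gt]
  · rw [e₈, if_neg h.not_gt]

/-- The program up to the rounds. -/
def preludeProg : Prog := .seq initProg (.seq gadgetProg (.seq designProg scaleProg))

theorem preludeProg_holds (hd : 1 ≤ d) (hk : k ∣ d) (hn : n = k * 2 ^ (d / k)) (α : ℝ)
    (B : Matrix (Fin d) (Fin d) ℝ) (t : Fin d → ℝ) :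
    ∃ (μ : ℕ → ℕ → ℕ → ℝ) (D : ℕ),
      (preludeProg.run ω O (initState k m n ℓ α B t)).Holds (regs d k m n ℓ) μ D [] ∧
      RoundData α B t k m n ω μ ∧ μ 32 0 0 = scaleAt ℓ 0 ∧ μ 31 0 0 = gammaBin m B := by
  have h0 := initProg_holds (k := k) (n := n) (ℓ := ℓ) ω O α B t
  obtain ⟨μ₁, D, h₁, f₁, r₁, g₁, b₁⟩ := gadgetProg_holds ω O hd hk hn h0
  obtain ⟨μ₂, h₂, f₂, g₂, x₂, c₂, u₂, l₂⟩ := designProg_holds ω O hd hk α B t h₁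
    (by rw [f₁ 0 (by omega)]; simp [initState])
    (fun a c => by rw [f₁ 1 (by omega)]; simp [initState])
    (fun a => by rw [f₁ 2 (by omega)]; simp [initState]) r₁ g₁ b₁
  obtain ⟨μ₃, h₃, f₃, s₃⟩ := scaleProg_holds ω O h₂
  refine ⟨μ₃, D, h₃, ⟨?_, ?_, ?_, ?_, ?_, ?_⟩, ?_, ?_⟩
  · rw [f₃ 1 (by omega), f₂ 1 (by omega), f₁ 1 (by omega)]; simp [initState]
  · rw [f₃ 2 (by omega), f₂ 2 (by omega), f₁ 2 (by omega)]; simp [initState]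
  · rw [f₃ 10 (by omega), g₂]; exact g₁
  · rw [f₃ 4 (by omega)]; exact x₂
  · rw [f₃ 12 (by omega)]; exact c₂
  · rw [f₃ 13 (by omega)]; exact u₂
  · rw [s₃, scaleAt, pow_zero, mul_one]
  · rw [f₃ 31 (by omega), l₂]

theorem RState.Holds.tick {x : ℕ → ℕ} {μ : ℕ → ℕ → ℕ → ℝ} {D : ℕ} {Q : List (SLRInstance m n)}
    {s : RState m n} (hs : s.Holds x μ D Q) (c : ℕ) : (s.tick c).Holds x μ D Q :=
  ⟨hs.idx, hs.mem, hs.draws, hs.queries⟩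

/-- The invariant is a dichotomy for the strict minimizer z: either no round has decoded it and the
record is still above its residual, or it is stored. Other candidates can neither reach its residual
nor replace it. -/
theorem rounds_holds (α : ℝ) (B : Matrix (Fin d) (Fin d) ℝ) (t : Fin d → ℝ)
    {μ₀ : ℕ → ℕ → ℕ → ℝ} {D : ℕ} {s : RState m n}
    (h₀ : s.Holds (regs d k m n ℓ) μ₀ D []) (R₀ : RoundData α B t k m n ω μ₀)
    (s₀ : μ₀ 32 0 0 = scaleAt ℓ 0) (l₀ : μ₀ 31 0 0 = gammaBin m B) (N : ℕ) :
    ∃ (μ : ℕ → ℕ → ℕ → ℝ),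
      ((fun s' => (roundProg.run ω O s').tick 1)^[N] (s.tick 1)).Holds (regs d k m n ℓ) μ D
        ((List.range N).map (fun r => scaleQuery k m n α B t (scaleAt ℓ r) ω)) ∧
      RoundData α B t k m n ω μ ∧ μ 32 0 0 = scaleAt ℓ N ∧
      ∀ z : Fin d → ℝ, sqResidual B t z < gammaBin m B →
        (∀ z', IsSignVector z' → z' ≠ z → sqResidual B t z < sqResidual B t z') →
        ((sqResidual B t z < μ 31 0 0 ∧ ∀ r < N, signVec ((Gsparse d k n).mulVec
          (O (scaleQuery k m n α B t (scaleAt ℓ r) ω))) ≠ z) ∨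
        ((∀ a : Fin d, μ 3 a 0 = z a) ∧ μ 31 0 0 = sqResidual B t z)) := by
  induction N with
  | zero =>
    refine ⟨μ₀, h₀.tick 1, R₀, s₀, fun z hz _ => Or.inl ⟨?_, ?_⟩⟩
    · rw [l₀]; exact hz
    · intro r hr; omega
  | succ N ih =>
    obtain ⟨μ, h, R, hsc, hI⟩ := ih
    rw [Function.iterate_succ_apply', List.range_succ, List.map_append, List.map_singleton]
    obtain ⟨μ', h', R', hsc', hlt, hge⟩ := roundProg_holds ω O α B t h R
      (q := scaleQuery k m n α B t (scaleAt ℓ N) ω) (by rw [hsc]) rfl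
    refine ⟨μ', h'.tick 1, R', ?_, fun z hz hmin => ?_⟩
    · rw [hsc', hsc, scaleAt, scaleAt, pow_succ]; ring
    · set c := signVec ((Gsparse d k n).mulVec
        (O (scaleQuery k m n α B t (scaleAt ℓ N) ω))) with hc
      have hcs : IsSignVector c := isSignVector_signVec _
      rcases hI z hz hmin with ⟨h1, h2⟩ | ⟨h1, h2⟩
      · by_cases hcz : c = z
        · right
          rw [← hcz] at h1 ⊢
          exact hlt h1
        · left
          have hres := hmin c hcs hcz
          constructor
          · rcases lt_or_ge (sqResidual B t c) (μ 31 0 0) with h3 | h3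
            · rw [(hlt h3).2]; exact hres
            · rw [(hge h3).2]; exact h1
          · intro r hr
            rcases Nat.lt_succ_iff_lt_or_eq.1 hr with hr' | rfl
            · exact h2 r hr'
            · exact hcz
      · right
        have hle : sqResidual B t z ≤ sqResidual B t c := by
          by_cases hcz : c = z
          · rw [hcz]
          · exact (hmin c hcs hcz).le
        obtain ⟨h3, h4⟩ := hge (by rw [h2]; exact hle)
        exact ⟨fun a => (h3 a).trans (h1 a), h4.trans h2⟩

theorem bddProg_run_eq (s : RState m n) : bddProg.run ω O s =
    (Prog.loop 7 roundProg).run ω O (preludeProg.run ω O s) := by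
  simp only [bddProg, mainProg, preludeProg, Prog.run]

/-- One successful decoding in any round is enough, whatever happens in the other rounds. -/
theorem bddProg_run_spec (hd : 1 ≤ d) (hk : k ∣ d) (hn : n = k * 2 ^ (d / k)) (α : ℝ)
    (B : Matrix (Fin d) (Fin d) ℝ) (t : Fin d → ℝ) :
    (bddProg.run ω O (initState k m n ℓ α B t)).queries =
      (List.range (2 * ℓ + 1)).map (fun r => scaleQuery k m n α B t (scaleAt ℓ r) ω) ∧
    ∀ z : Fin d → ℝ, sqResidual B t z < gammaBin m B →
      (∀ z', IsSignVector z' → z' ≠ z → sqResidual B t z < sqResidual B t z') →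
      ∀ r < 2 * ℓ + 1, signVec ((Gsparse d k n).mulVec
        (O (scaleQuery k m n α B t (scaleAt ℓ r) ω))) = z →
      (bddProg.run ω O (initState k m n ℓ α B t)).output d = z := by
  obtain ⟨μ₀, D, h₀, R₀, s₀, l₀⟩ := preludeProg_holds (m := m) (ℓ := ℓ) ω O hd hk hn α B t
  rw [bddProg_run_eq]
  generalize preludeProg.run ω O (initState k m n ℓ α B t) = s at h₀ ⊢
  have h7 : s.idx 7 = 2 * ℓ + 1 := by rw [h₀.idx 7 (by omega)]; rfl
  rw [Prog.run, h7]
  obtain ⟨μ, h, -, -, hI⟩ := rounds_holds ω O α B t h₀ R₀ s₀ l₀ (2 * ℓ + 1)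
  refine ⟨h.queries, fun z hz hmin r hr hdec => ?_⟩
  rcases hI z hz hmin with ⟨-, h2⟩ | ⟨h1, -⟩
  · exact absurd hdec (h2 r hr)
  · funext a
    rw [RState.output, h.mem 3 (by omega), h1 a]

end

/-! ### Norm estimates and the binary minimum distance. -/

theorem l2norm_sq {ι : Type} [Fintype ι] (v : ι → ℝ) : l2norm v ^ 2 = ∑ i, v i ^ 2 := by
  simp [l2norm, EuclideanSpace.norm_sq_eq]

theorem l2norm_nonneg {ι : Type} [Fintype ι] (v : ι → ℝ) : 0 ≤ l2norm v := norm_nonneg _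

theorem l2norm_add_le {ι : Type} [Fintype ι] (v w : ι → ℝ) :
    l2norm (v + w) ≤ l2norm v + l2norm w := norm_add_le (WithLp.toLp 2 v) (WithLp.toLp 2 w)

theorem l2norm_sub_le {ι : Type} [Fintype ι] (v w : ι → ℝ) :
    l2norm (v - w) ≤ l2norm v + l2norm w := norm_sub_le (WithLp.toLp 2 v) (WithLp.toLp 2 w)

theorem l2norm_sub_comm {ι : Type} [Fintype ι] (v w : ι → ℝ) :
    l2norm (v - w) = l2norm (w - v) := norm_sub_rev (WithLp.toLp 2 v) (WithLp.toLp 2 w)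

theorem abs_le_l2norm {ι : Type} [Fintype ι] (v : ι → ℝ) (i : ι) : |v i| ≤ l2norm v := by
  refine abs_le_of_sq_le_sq ?_ (l2norm_nonneg v)
  rw [l2norm_sq]
  exact Finset.single_le_sum (f := fun i => v i ^ 2) (fun i _ => sq_nonneg _) (Finset.mem_univ i)

theorem l2norm_mulVec_le {ι κ : Type} [Fintype ι] [Fintype κ] (A : Matrix ι κ ℝ) (v : κ → ℝ) :
    l2norm (A.mulVec v) ^ 2 ≤ (∑ i, ∑ j, A i j ^ 2) * l2norm v ^ 2 := by
  rw [l2norm_sq, l2norm_sq, Finset.sum_mul]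
  refine Finset.sum_le_sum fun i _ => ?_
  exact Finset.sum_mul_sq_le_sq_mul_sq _ _ _

section

variable {d k m n : ℕ}

theorem lambdaBin_le (B : Matrix (Fin d) (Fin d) ℝ) {z z' : Fin d → ℝ} (hz : IsSignVector z)
    (hz' : IsSignVector z') (h : z ≠ z') :
    lambdaBin B ≤ l2norm (B.mulVec z - B.mulVec z') := by
  refine csInf_le ⟨0, ?_⟩ ⟨z, z', hz, hz', h, rfl⟩
  rintro _ ⟨_, _, _, _, _, rfl⟩
  exact l2norm_nonneg _

theorem lambdaBin_nonneg (B : Matrix (Fin d) (Fin d) ℝ) : 0 ≤ lambdaBin B := by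
  refine Real.sInf_nonneg ?_
  rintro _ ⟨_, _, _, _, _, rfl⟩
  exact l2norm_nonneg _

/-- Flip one coordinate of the all-ones vector: the difference is twice a unit vector, and the
Frobenius norm bounds its image. This bounds the unknown λ by a computable quantity, on which γ is
built. -/
theorem lambdaBin_sq_le (hd : 1 ≤ d) (B : Matrix (Fin d) (Fin d) ℝ) :
    lambdaBin B ^ 2 ≤ 4 * ∑ a, ∑ c, B a c * B a c := by
  let a₀ : Fin d := ⟨0, hd⟩
  let z : Fin d → ℝ := fun _ => 1
  let z' : Fin d → ℝ := Function.update z a₀ (-1)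
  have hz : IsSignVector z := fun _ => Or.inl rfl
  have hz' : IsSignVector z' := fun i => by
    by_cases h : i = a₀
    · right; simp [z', h]
    · left; simp [z', h, z]
  have hne : z ≠ z' := fun h => by
    have := congrFun h a₀
    simp [z', z] at this
    linarith
  have h := lambdaBin_le B hz hz' hne
  have hsub : z - z' = Pi.single a₀ 2 := by
    funext i
    by_cases h : i = a₀
    · subst h; simp [z', z]; norm_num
    · simp [z', z, h]
  rw [← Matrix.mulVec_sub, hsub] at h
  have h2 := l2norm_mulVec_le B (Pi.single a₀ 2)
  have h3 : l2norm (Pi.single a₀ 2 : Fin d → ℝ) ^ 2 = 4 := by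
    rw [l2norm_sq, Finset.sum_eq_single a₀]
    · simp; norm_num
    · intro b _ hb; simp [hb]
    · simp
  rw [h3] at h2
  have h4 := pow_le_pow_left₀ (lambdaBin_nonneg B) h 2
  simp only [← sq]
  linarith

/-! ### The gadget matrices and sparse vectors -/

theorem div_lt_of_lt_mul_block {k w a : ℕ} (ha : a < k * w) : a / w < k := by
  rw [mul_comm] at ha
  exact Nat.div_lt_of_lt_mul ha

/-- In each block take the indicator of the column whose binary digits, `code κ`, encode the signs
of z in that block. -/
theorem exists_sparse_preimage (hd : 1 ≤ d) (hk : k ∣ d) (hn : n = k * 2 ^ (d / k))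
    {z : Fin d → ℝ} (hz : IsSignVector z) :
    ∃ θ : Fin n → ℝ, IsSparse k θ ∧ (Gsparse d k n).mulVec θ = z ∧
      (Gpartite k n).mulVec θ = fun _ => 1 := by
  classical
  have hk0 : 0 < k := Nat.pos_of_dvd_of_pos hk hd
  have hnk : n / k = 2 ^ (d / k) := by rw [hn, Nat.mul_div_cancel_left _ hk0]
  obtain ⟨w, rfl⟩ := hk
  have hdk : k * w / k = w := Nat.mul_div_cancel_left _ hk0
  rw [hdk] at hnk hn
  have hw : 0 < w := Nat.pos_of_mul_pos_left (by omega : 0 < k * w)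
  let code : ℕ → ℕ := fun κ => Nat.ofBits fun r : Fin w =>
    if h : κ * w + r < k * w then decide (z ⟨κ * w + r, h⟩ = 1) else false
  have hcode : ∀ κ, code κ < 2 ^ w := fun κ => Nat.ofBits_lt_two_pow _
  let θ : Fin n → ℝ := fun j => if (j : ℕ) % 2 ^ w = code ((j : ℕ) / 2 ^ w) then 1 else 0
  have hpos : 0 < 2 ^ w := by positivity
  have hj : ∀ κ < k, κ * 2 ^ w + code κ < n := fun κ hκ => by
    have := hcode κ
    rw [hn]
    calc κ * 2 ^ w + code κ < κ * 2 ^ w + 2 ^ w := by omega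
      _ = (κ + 1) * 2 ^ w := by ring
      _ ≤ k * 2 ^ w := Nat.mul_le_mul_right _ hκ
  have hθ : ∀ (κ : ℕ) (hκ : κ < k) (j : Fin n), (j : ℕ) / 2 ^ w = κ →
      θ j = if j = ⟨κ * 2 ^ w + code κ, hj κ hκ⟩ then 1 else 0 := by
    intro κ hκ j h
    simp only [θ, h]
    refine if_congr ?_ rfl rfl
    rw [Fin.ext_iff]
    have := Nat.div_add_mod (j : ℕ) (2 ^ w)
    rw [h, mul_comm] at this
    simp only
    omega
  have hblock : ∀ κ < k, (κ * 2 ^ w + code κ) / 2 ^ w = κ := fun κ _ => by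
    rw [mul_comm, Nat.mul_add_div hpos, Nat.div_eq_of_lt (hcode κ), add_zero]
  have hmod : ∀ κ < k, (κ * 2 ^ w + code κ) % 2 ^ w = code κ := fun κ _ => by
    rw [mul_comm, Nat.mul_add_mod, Nat.mod_eq_of_lt (hcode κ)]
  refine ⟨θ, ?_, ?_, ?_⟩
  · unfold IsSparse
    have : (Finset.univ.filter fun j => θ j ≠ 0).card ≤ (Finset.univ : Finset (Fin k)).card := by
      refine Finset.card_le_card_of_injOn
        (fun j => ⟨(j : ℕ) / 2 ^ w, div_lt_of_lt_mul_block (hn ▸ j.2)⟩)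
        (fun _ _ => Finset.mem_coe.2 (Finset.mem_univ _)) ?_
      intro i hi j hj' hij
      simp only [Fin.mk.injEq] at hij
      simp only [Finset.coe_filter, Finset.mem_univ, true_and, Set.mem_ofPred_eq] at hi hj'
      have hκ : (i : ℕ) / 2 ^ w < k := div_lt_of_lt_mul_block (hn ▸ i.2)
      have h1 := hθ _ hκ i rfl
      have h2 := hθ _ hκ j hij.symm
      have h1' : i = ⟨_, hj _ hκ⟩ := by
        by_contra hne
        exact hi (by rw [h1, if_neg hne])
      have h2' : j = ⟨_, hj _ hκ⟩ := by
        by_contra hne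
        exact hj' (by rw [h2, if_neg hne])
      exact h1'.trans h2'.symm
    simpa using this
  · funext a
    have hκ : (a : ℕ) / w < k := div_lt_of_lt_mul_block a.2
    have hr : (a : ℕ) % w < w := Nat.mod_lt _ hw
    rw [Matrix.mulVec, dotProduct, Finset.sum_eq_single ⟨_, hj _ hκ⟩]
    · rw [hθ _ hκ _ (hblock _ hκ), if_pos rfl, mul_one, Gsparse, hdk, hnk]
      simp only [hblock _ hκ, hmod _ hκ, if_true]
      have hdm : (a : ℕ) / w * w + (a : ℕ) % w = a := Nat.div_add_mod' _ _
      rw [Nat.testBit_ofBits_lt _ _ hr, dif_pos (by simp only [hdm]; exact a.2)]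
      have : (⟨(a : ℕ) / w * w + (a : ℕ) % w, by rw [hdm]; exact a.2⟩ : Fin (k * w)) = a :=
        Fin.ext hdm
      simp only [this, decide_eq_true_eq]
      rcases hz a with h | h <;> rw [h] <;> norm_num
    · intro j _ hne
      simp only [Gsparse, hdk, hnk]
      split_ifs with h1
      · rw [hθ _ hκ j h1.symm, if_neg hne, mul_zero]
      · rw [hθ _ hκ j h1.symm, if_neg hne, mul_zero]
      · simp
    · simp
  · funext κ
    rw [Matrix.mulVec, dotProduct, Finset.sum_eq_single ⟨_, hj _ κ.2⟩]
    · rw [hθ _ κ.2 _ (hblock _ κ.2), if_pos rfl, mul_one, Gpartite, hnk]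
      simp [hblock _ κ.2]
    · intro j _ hne
      simp only [Gpartite, hnk]
      split_ifs with h1
      · rw [hθ _ κ.2 j h1.symm, if_neg hne, mul_zero]
      · simp
    · simp

/-- A `k`-sparse vector whose block sums are positive is mapped by `Gsparse` to a sign vector
whose entries are scaled by the block sums. -/
theorem gsparse_mulVec_of_sparse (hd : 1 ≤ d) (hk : k ∣ d) (hn : n = k * 2 ^ (d / k))
    {θ : Fin n → ℝ} (hθ : IsSparse k θ) (hpos : ∀ κ, 0 < (Gpartite k n).mulVec θ κ) (a : Fin d) :
    ∃ κ, (Gsparse d k n).mulVec θ a =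
      signVec ((Gsparse d k n).mulVec θ) a * (Gpartite k n).mulVec θ κ := by
  classical
  have hk0 : 0 < k := Nat.pos_of_dvd_of_pos hk hd
  have hnk : n / k = 2 ^ (d / k) := by rw [hn, Nat.mul_div_cancel_left _ hk0]
  have hpos2 : 0 < 2 ^ (d / k) := by positivity
  let blk : Fin n → Fin k := fun j =>
    ⟨(j : ℕ) / 2 ^ (d / k), div_lt_of_lt_mul_block (hn ▸ j.2)⟩
  have hsum : ∀ κ, (Gpartite k n).mulVec θ κ = ∑ j, if blk j = κ then θ j else 0 := by
    intro κ
    rw [Matrix.mulVec, dotProduct]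
    refine Finset.sum_congr rfl fun j _ => ?_
    have : (κ : ℕ) = (j : ℕ) / (n / k) ↔ blk j = κ := by
      rw [hnk, Fin.ext_iff, eq_comm]
    simp only [Gpartite, this, ite_mul, one_mul, zero_mul]
  set S := Finset.univ.filter fun j => θ j ≠ 0 with hS
  -- A block with positive sum contains a non-zero entry. With k blocks and at most k non-zero
  -- entries, the map to the blocks is injective on the support.
  have hsurj : ∀ κ : Fin k, ∃ j ∈ S, blk j = κ := by
    intro κ
    by_contra hcon
    push Not at hcon
    refine (hpos κ).ne' ?_
    rw [hsum]
    refine Finset.sum_eq_zero fun j _ => ?_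
    split_ifs with h
    · by_contra h0
      exact hcon j (by simp [hS, h0]) h
    · rfl
  have hinj : Set.InjOn blk S := by
    refine Finset.injOn_of_surjOn_of_card_le (t := Finset.univ) blk
      (fun _ _ => by simp) (fun κ _ => ?_) ?_
    · obtain ⟨j, hj, h⟩ := hsurj κ
      exact ⟨j, hj, h⟩
    · have : S.card ≤ k := by
        unfold IsSparse at hθ
        rw [hS]
        convert hθ
      simpa using this
  let κ : Fin k := ⟨(a : ℕ) / (d / k), div_lt_of_lt_mul_block (by
    rw [Nat.mul_div_cancel' hk]; exact a.2)⟩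
  obtain ⟨j₀, hj₀, hb⟩ := hsurj κ
  have huniq : ∀ j, j ≠ j₀ → blk j = κ → θ j = 0 := by
    intro j hne hj
    by_contra h0
    exact hne (hinj (by simp [hS, h0]) hj₀ (hj.trans hb.symm))
  have h1 : (Gpartite k n).mulVec θ κ = θ j₀ := by
    rw [hsum, Finset.sum_eq_single j₀]
    · rw [if_pos hb]
    · intro j _ hne
      split_ifs with h
      · exact huniq j hne h
      · rfl
    · simp
  have hiff : ∀ j : Fin n, (a : ℕ) / (d / k) = (j : ℕ) / (n / k) ↔ blk j = κ := by
    intro j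
    rw [hnk, Fin.ext_iff, eq_comm]
  have h2 : (Gsparse d k n).mulVec θ a = Gsparse d k n a j₀ * θ j₀ := by
    rw [Matrix.mulVec, dotProduct, Finset.sum_eq_single j₀]
    · intro j _ hne
      by_cases h : blk j = κ
      · rw [huniq j hne h, mul_zero]
      · rw [Gsparse, if_neg (mt (hiff j).1 h), zero_mul]
    · simp
  have h3 : Gsparse d k n a j₀ = 1 ∨ Gsparse d k n a j₀ = -1 := by
    rw [Gsparse, if_pos ((hiff j₀).2 hb)]
    split_ifs
    · exact Or.inl rfl
    · exact Or.inr rfl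
  refine ⟨κ, ?_⟩
  have hp := hpos κ
  rw [h1] at hp ⊢
  rw [signVec, h2]
  rcases h3 with h3 | h3 <;> rw [h3]
  · rw [if_pos (by linarith)]
  · rw [if_neg (by linarith)]

end

/-! ### The approximation of the square root of the logarithm -/

theorem card_filter_range_of_downward {N e : ℕ} {p : ℕ → Prop} [DecidablePred p]
    (hp : ∀ c, p c ↔ c < e) (he : e ≤ N) : ((Finset.range N).filter p).card = e := by
  have : (Finset.range N).filter p = Finset.range e := by
    ext c
    simp only [Finset.mem_filter, Finset.mem_range, hp]
    omega
  rw [this, Finset.card_range]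

theorem logCount_eq (m : ℕ) : logCount m = Nat.clog 2 m := by
  refine card_filter_range_of_downward (fun c => ?_) ?_
  · rw [Nat.lt_clog_iff_pow_lt (by omega)]
  · exact Nat.clog_le_of_le_pow (Nat.lt_two_pow_self).le

/-- The count of c with c² < `logCount m` is the least q with `logCount m` ≤ q², that is, the square
root rounded up. -/
theorem sqrtLogCount_spec (m : ℕ) (hm : 2 ≤ m) :
    logCount m ≤ sqrtLogCount m * sqrtLogCount m ∧
      (sqrtLogCount m - 1) * (sqrtLogCount m - 1) < logCount m ∧ 1 ≤ sqrtLogCount m := by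
  have he : logCount m ≤ m := by
    rw [logCount_eq]
    exact Nat.clog_le_of_le_pow (Nat.lt_two_pow_self).le
  have he1 : 1 ≤ logCount m := by
    rw [logCount_eq]
    exact Nat.clog_pos (by omega) hm
  have hex : ∃ q, logCount m ≤ q * q := ⟨logCount m, Nat.le_mul_self _⟩
  have hq : sqrtLogCount m = Nat.find hex := by
    refine card_filter_range_of_downward (fun c => ?_) ?_
    · rw [Nat.lt_find_iff]
      refine ⟨fun h c' hc' => ?_, fun h => ?_⟩
      · have := Nat.mul_le_mul hc' hc'
        omega
      · have := h c le_rfl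
        omega
    · exact (Nat.find_min' hex (Nat.le_mul_self _)).trans he
  rw [hq]
  have hspec := Nat.find_spec hex
  have hpos : 1 ≤ Nat.find hex := by
    by_contra h
    have : Nat.find hex = 0 := by omega
    rw [this] at hspec
    omega
  refine ⟨hspec, ?_, hpos⟩
  have := Nat.find_min hex (m := Nat.find hex - 1) (by omega)
  omega

theorem sqrtLogCount_bounds (m : ℕ) (hm : 2 ≤ m) :
    √(Real.log m) ≤ sqrtLogCount m ∧ (sqrtLogCount m : ℝ) ≤ 4 * √(Real.log m) := by
  obtain ⟨h1, h2, h3⟩ := sqrtLogCount_spec m hm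
  have hm' : (2 : ℝ) ≤ m := by exact_mod_cast hm
  have hl2 := Real.log_two_gt_d9
  have hl2' := Real.log_two_lt_d9
  have hlog : Real.log 2 ≤ Real.log m := Real.log_le_log (by norm_num) hm'
  have hle : Real.log m ≤ logCount m := by
    have h : m ≤ 2 ^ logCount m := by rw [logCount_eq]; exact Nat.le_pow_clog (by omega) m
    have h' : (m : ℝ) ≤ 2 ^ logCount m := by exact_mod_cast h
    have := Real.log_le_log (by linarith) h'
    rw [Real.log_pow] at this
    have h0 : (0 : ℝ) ≤ logCount m := Nat.cast_nonneg _
    nlinarith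
  -- Rounding up costs at most 1, which is at most log m / log 2 because 2 ≤ m; and 2 / log 2 < 3.
  have hge : (logCount m : ℝ) ≤ 3 * Real.log m := by
    have h : 2 ^ (logCount m - 1) < m := by
      rw [logCount_eq]
      exact Nat.pow_pred_clog_lt_self (by omega) (by omega)
    have h' : (2 : ℝ) ^ (logCount m - 1) ≤ m := by exact_mod_cast h.le
    have := Real.log_le_log (by positivity) h'
    have hc1 : 1 ≤ logCount m := by rw [logCount_eq]; exact Nat.clog_pos (by omega) hm
    rw [Real.log_pow, Nat.cast_sub hc1, Nat.cast_one] at this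
    nlinarith
  have hL : (0 : ℝ) ≤ Real.log m := by linarith
  constructor
  · rw [Real.sqrt_le_left (Nat.cast_nonneg _)]
    have : (logCount m : ℝ) ≤ sqrtLogCount m * sqrtLogCount m := by exact_mod_cast h1
    nlinarith
  · have h4 : ((sqrtLogCount m : ℝ) - 1) * (sqrtLogCount m - 1) ≤ logCount m := by
      have : (((sqrtLogCount m - 1) * (sqrtLogCount m - 1) : ℕ) : ℝ) ≤ logCount m := by
        exact_mod_cast h2.le
      rwa [Nat.cast_mul, Nat.cast_sub h3, Nat.cast_one] at this
    have hs := Real.sq_sqrt hL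
    have hs0 := Real.sqrt_nonneg (Real.log m)
    by_contra hcon
    push Not at hcon
    have hs1 : (4 / 5 : ℝ) ≤ √(Real.log m) := by
      refine Real.le_sqrt_of_sq_le ?_
      norm_num at hl2 ⊢
      linarith
    nlinarith

/-! ### Deterministic decoding on a well-behaved tape. -/

section

variable {d k m n : ℕ}

theorem sum_fin_ite_lt {N m : ℕ} (h : N ≤ m) (f : ℕ → ℝ) :
    (∑ i : Fin m, if (i : ℕ) < N then f i else 0) = ∑ i : Fin N, f i := by
  rw [Fin.sum_univ_eq_sum_range (fun i => if i < N then f i else 0) m,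
    Fin.sum_univ_eq_sum_range f N, ← Finset.sum_filter]
  congr 1
  ext i
  simp only [Finset.mem_filter, Finset.mem_range]
  omega

theorem sum_fin_castLE_le {N m : ℕ} (h : N ≤ m) (f : Fin m → ℝ) (hf : ∀ i, 0 ≤ f i) :
    ∑ i : Fin N, f (Fin.castLE h i) ≤ ∑ i, f i := by
  have := Finset.sum_map Finset.univ (Fin.castLEEmb h) f
  simp only [Fin.castLEEmb_apply] at this
  rw [← this]
  exact Finset.sum_le_sum_of_subset_of_nonneg (Finset.subset_univ _) fun i _ _ => hf i

theorem designMatrix_mulVec (B : Matrix (Fin d) (Fin d) ℝ) (ω : ℕ → ℝ) (θ : Fin n → ℝ)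
    (i : Fin m) :
    (designMatrix k m n B ω).mulVec θ i =
      if h : (i : ℕ) < m - k then
        (tapeMatrix d ω : Matrix (Fin (m - k)) (Fin d) ℝ).mulVec
          (B.mulVec ((Gsparse d k n).mulVec θ)) ⟨i, h⟩
      else gammaBin m B * (Gpartite k n).mulVec θ ⟨(i : ℕ) - (m - k), by omega⟩ := by
  split_ifs with h
  · rw [Matrix.mulVec_mulVec, Matrix.mulVec_mulVec, Matrix.mul_assoc, Matrix.mulVec,
      Matrix.mulVec]
    simp only [designMatrix, stackRows, h, dif_pos]
  · rw [Matrix.mulVec, Matrix.mulVec, ← smul_eq_mul, ← smul_dotProduct]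
    simp only [designMatrix, stackRows, h, dif_neg, not_false_eq_true]
    rfl

/-- The noise of the query with standard deviation `σ`, for the error vector `e`. -/
def noiseVec (k m : ℕ) (e : Fin d → ℝ) (σ : ℝ) (ω : ℕ → ℝ) : Fin m → ℝ := fun i =>
  (if (i : ℕ) < m - k then (tapeMatrix d ω : Matrix (Fin m) (Fin d) ℝ).mulVec e i else 0) +
    σ * ω (i * (d + 1) + d)

/-- On top R t = R B z + R e and the design maps θ to R B z; below, block sums 1 reproduce γ. So
only R e and the added Gaussians remain as noise. -/
theorem design_add_noise {α s : ℝ} (B : Matrix (Fin d) (Fin d) ℝ) {t z e : Fin d → ℝ}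
    (ht : t = B.mulVec z + e) {θ : Fin n → ℝ} (hG : (Gsparse d k n).mulVec θ = z)
    (hP : (Gpartite k n).mulVec θ = fun _ => 1) (ω : ℕ → ℝ) :
    (designMatrix k m n B ω).mulVec θ +
      noiseVec k m e (s * (100 * α * m * sqrtLogCount m)) ω = noisyResponse k m α B t s ω := by
  funext i
  rw [Pi.add_apply, designMatrix_mulVec, hG, hP, noiseVec, noisyResponse, cleanResponse, ht]
  split_ifs with h
  · rw [Matrix.mulVec_add, Pi.add_apply]
    have : (tapeMatrix d ω : Matrix (Fin (m - k)) (Fin d) ℝ).mulVec (B.mulVec z) ⟨i, h⟩ =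
      (tapeMatrix d ω : Matrix (Fin m) (Fin d) ℝ).mulVec (B.mulVec z) i := rfl
    rw [this]
    ring
  · ring

/-- The event that the Gaussians on the tape behave as expected. -/
structure GoodTape (k m : ℕ) (B : Matrix (Fin d) (Fin d) ℝ) (z e : Fin d → ℝ) (ω : ℕ → ℝ) :
    Prop where
  lower : ∀ z', IsSignVector z' → z' ≠ z →
    (m - k : ℕ) / 32 * l2norm (B.mulVec (z' - z)) ^ 2 ≤
      l2norm ((tapeMatrix d ω : Matrix (Fin (m - k)) (Fin d) ℝ).mulVec (B.mulVec (z' - z))) ^ 2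
  error : l2norm ((tapeMatrix d ω : Matrix (Fin (m - k)) (Fin d) ℝ).mulVec e) ^ 2 ≤
    100 * (m * l2norm e ^ 2)
  noise : ∑ i : Fin m, ω (i * (d + 1) + d) ^ 2 ≤ 100 * m
  upper : ∑ i, ∑ j, ((tapeMatrix d ω : Matrix (Fin (m - k)) (Fin d) ℝ) * B) i j ^ 2 ≤
    100 * (m * ∑ a, ∑ c, B a c * B a c)

theorem l2norm_noiseVec_le (B : Matrix (Fin d) (Fin d) ℝ) {z e : Fin d → ℝ} {ω : ℕ → ℝ}
    (hω : GoodTape k m B z e ω) (σ : ℝ) :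
    l2norm (noiseVec k m e σ ω) ^ 2 ≤ 200 * m * (l2norm e ^ 2 + σ ^ 2) := by
  have h1 := hω.error
  have h2 := hω.noise
  rw [l2norm_sq] at h1
  have h3 : ∑ i : Fin m, (if (i : ℕ) < m - k then
      (tapeMatrix d ω : Matrix (Fin m) (Fin d) ℝ).mulVec e i ^ 2 else 0) =
      ∑ i : Fin (m - k), (tapeMatrix d ω : Matrix (Fin (m - k)) (Fin d) ℝ).mulVec e i ^ 2 :=
    sum_fin_ite_lt (Nat.sub_le m k) (fun i => (∑ a : Fin d, ω (i * (d + 1) + a) * e a) ^ 2)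
  rw [← h3] at h1
  rw [l2norm_sq]
  have h4 : ∑ i, noiseVec k m e σ ω i ^ 2 ≤ ∑ i : Fin m, (2 * (if (i : ℕ) < m - k then
      (tapeMatrix d ω : Matrix (Fin m) (Fin d) ℝ).mulVec e i ^ 2 else 0) +
      2 * σ ^ 2 * ω (i * (d + 1) + d) ^ 2) := by
    refine Finset.sum_le_sum fun i _ => ?_
    rw [noiseVec]
    split_ifs
    · nlinarith [sq_nonneg ((tapeMatrix d ω : Matrix (Fin m) (Fin d) ℝ).mulVec e i -
        σ * ω (i * (d + 1) + d))]
    · nlinarith [sq_nonneg (σ * ω (i * (d + 1) + d))]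
  rw [Finset.sum_add_distrib, ← Finset.mul_sum, ← Finset.mul_sum] at h4
  have h5 := mul_le_mul_of_nonneg_left h2 (by positivity : 0 ≤ 2 * σ ^ 2)
  nlinarith

/-- This explains the size of γ = 16 m (1 + F), F = ‖B‖_F²: block sums off by at most 2b/γ change R
B G_sparse θ' by at most b, using ‖R B‖_F² ≤ 100 m F. -/
theorem frobenius_bound {m d F : ℝ} (hm : 0 ≤ m) (hd : 0 ≤ d) (hF : 0 ≤ F) (h : 6 * d ≤ m) :
    100 * (m * F) * (d * 4) ≤ (16 * m * (1 + F)) ^ 2 := by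
  have h1 : F * (6 * d) ≤ (1 + F) ^ 2 * m :=
    mul_le_mul (by nlinarith) h (by positivity) (by positivity)
  have h2 := mul_le_mul_of_nonneg_left h1 hm
  have h3 : 0 ≤ (m * (1 + F)) ^ 2 := sq_nonneg _
  nlinarith

/-- Any solution of a query whose noise is within the error parameter decodes to the
solution of the binary BDD instance. -/
theorem decode_of_isSolution (hd : 1 ≤ d) (hk : k ∣ d) (hn : n = k * 2 ^ (d / k))
    (hm : 6 * d ≤ m) (B : Matrix (Fin d) (Fin d) ℝ) {t z e : Fin d → ℝ}
    (hz : IsSignVector z) (ht : t = B.mulVec z + e) {α s : ℝ} (hs : 0 < s)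
    (hsl : s ≤ lambdaBin B) {ω : ℕ → ℝ} (hω : GoodTape k m B z e ω)
    (hw : l2norm (noiseVec k m e (s * (100 * α * m * sqrtLogCount m)) ω) ^ 2 ≤
      m * (s / 100) ^ 2)
    {θ' : Fin n → ℝ} (hθ' : (scaleQuery k m n α B t s ω).IsSolution k θ') :
    signVec ((Gsparse d k n).mulVec θ') = z := by
  obtain ⟨θ, -, hG, hP⟩ := exists_sparse_preimage hd hk hn hz
  obtain ⟨hsparse, herr⟩ := hθ'
  have hkd : k ≤ d := Nat.le_of_dvd hd hk
  have hm1 : (6 : ℝ) ≤ m := by exact_mod_cast (by omega : 6 ≤ m)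
  have hm0 : (0 : ℝ) < m := by linarith
  have hdm : 6 * (d : ℝ) ≤ m := by exact_mod_cast hm
  have hd0 : (0 : ℝ) ≤ d := Nat.cast_nonneg d
  set w := noiseVec k m e (s * (100 * α * m * sqrtLogCount m)) ω with hwdef
  set b := √m * (s / 100) with hb
  have hb2 : b ^ 2 = m * (s / 100) ^ 2 := by rw [hb, mul_pow, Real.sq_sqrt hm0.le]
  have hb0 : 0 ≤ b := by positivity
  have hwb : l2norm w ≤ b := abs_le_of_sq_le_sq (by rw [hb2]; exact hw) hb0 |> (le_abs_self _).trans
  have hvb : l2norm ((designMatrix k m n B ω).mulVec θ' - noisyResponse k m α B t s ω) ≤ b := by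
    refine (le_abs_self _).trans (abs_le_of_sq_le_sq ?_ hb0)
    rw [hb2]
    have h := (div_le_iff₀ hm0).1 herr
    simp only [scaleQuery] at h
    linarith
  -- Both θ' and θ have residual at most b = √m s/100, so their images differ by at most 2b.
  set u := (designMatrix k m n B ω).mulVec θ' - (designMatrix k m n B ω).mulVec θ with hu
  have hub : l2norm u ≤ 2 * b := by
    have : u = ((designMatrix k m n B ω).mulVec θ' - noisyResponse k m α B t s ω) + w := by
      rw [hu, hwdef, ← design_add_noise B ht hG hP ω]
      abel
    rw [this]
    exact (l2norm_add_le _ _).trans (by linarith)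
  set F := ∑ a, ∑ c, B a c * B a c with hF
  have hF0 : 0 ≤ F := Finset.sum_nonneg fun a _ => Finset.sum_nonneg fun c _ => mul_self_nonneg _
  have hlF := lambdaBin_sq_le hd B
  rw [← hF] at hlF
  have hγ : gammaBin m B = 16 * m * (1 + F) := rfl
  set γ := gammaBin m B with hγdef
  have hγ0 : 0 < γ := by rw [hγ]; positivity
  -- From s² ≤ λ² ≤ 4F ≤ (1 + F)².
  have hsF : s ≤ 1 + F := by
    refine (le_abs_self _).trans (abs_le_of_sq_le_sq ?_ (by linarith))
    nlinarith [lambdaBin_nonneg B, sq_nonneg (1 - F)]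
  have hsm : √m ≤ m := by
    rw [Real.sqrt_le_left hm0.le]
    nlinarith
  have h2bγ : 2 * b < γ := by
    rw [hb, hγ]
    nlinarith [mul_le_mul hsm hsF hs.le hm0.le, mul_pos hm0 (by linarith : 0 < 1 + F)]
  -- The coordinate of u in the row m - k + κ is γ times the deviation of the block sum from 1.
  have hblock : ∀ κ, |(Gpartite k n).mulVec θ' κ - 1| * γ ≤ 2 * b := by
    intro κ
    have hi : (κ : ℕ) + (m - k) < m := by have := κ.2; omega
    have h := (abs_le_l2norm u ⟨(κ : ℕ) + (m - k), hi⟩).trans hub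
    have hnot : ¬ (κ : ℕ) + (m - k) < m - k := by omega
    rw [hu, Pi.sub_apply, designMatrix_mulVec, designMatrix_mulVec, hP] at h
    simp only [hnot, dif_neg, not_false_eq_true, Nat.add_sub_cancel] at h
    rw [← mul_sub, abs_mul, abs_of_pos hγ0, mul_comm] at h
    exact h
  have hpos : ∀ κ, 0 < (Gpartite k n).mulVec θ' κ := by
    intro κ
    by_contra hcon
    push Not at hcon
    have h := hblock κ
    have h1 : 1 ≤ |(Gpartite k n).mulVec θ' κ - 1| := by
      rw [abs_sub_comm]
      exact le_trans (by linarith) (le_abs_self _)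
    nlinarith
  set z' := signVec ((Gsparse d k n).mulVec θ') with hz'
  have hz's : IsSignVector z' := isSignVector_signVec _
  by_contra hne
  -- The rounding error: each entry is a sign times a block sum minus 1.
  set D := (Gsparse d k n).mulVec θ' - z' with hD
  have hDa : ∀ a, D a ^ 2 * γ ^ 2 ≤ 4 * b ^ 2 := by
    intro a
    obtain ⟨κ, hκ⟩ := gsparse_mulVec_of_sparse hd hk hn hsparse hpos a
    have h1 : D a = z' a * ((Gpartite k n).mulVec θ' κ - 1) := by
      rw [hD, Pi.sub_apply, hκ, hz']
      ring
    have h2 : z' a ^ 2 = 1 := by rcases hz's a with h | h <;> rw [h] <;> norm_num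
    have h3 := pow_le_pow_left₀ (by positivity) (hblock κ) 2
    rw [mul_pow, sq_abs] at h3
    rw [h1, mul_pow, h2]
    linarith
  have hD2 : l2norm D ^ 2 * γ ^ 2 ≤ d * (4 * b ^ 2) := by
    rw [l2norm_sq, Finset.sum_mul]
    refine (Finset.sum_le_sum fun a _ => hDa a).trans ?_
    simp
  set R : Matrix (Fin (m - k)) (Fin d) ℝ := tapeMatrix d ω with hR
  have hRBD : l2norm (R.mulVec (B.mulVec D)) ≤ b := by
    refine (le_abs_self _).trans (abs_le_of_sq_le_sq ?_ hb0)
    have h1 := l2norm_mulVec_le (R * B) D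
    rw [← Matrix.mulVec_mulVec] at h1
    have h2 := hω.upper
    have h3 := h1.trans (mul_le_mul_of_nonneg_right h2 (sq_nonneg (l2norm D)))
    have hγ2 : 0 < γ ^ 2 := by positivity
    refine le_of_mul_le_mul_right ?_ hγ2
    refine (mul_le_mul_of_nonneg_right h3 hγ2.le).trans ?_
    rw [mul_assoc (100 * _)]
    refine (mul_le_mul_of_nonneg_left hD2 (by positivity)).trans ?_
    rw [hγ, ← hF]
    have h4 : 100 * ((m : ℝ) * F) * (d * 4) ≤ (16 * m * (1 + F)) ^ 2 := by
      exact frobenius_bound hm0.le hd0 hF0 hdm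
    have h6 := mul_le_mul_of_nonneg_right h4 (sq_nonneg b)
    linarith
  have hRBu : l2norm (R.mulVec (B.mulVec ((Gsparse d k n).mulVec θ' - z))) ≤ 2 * b := by
    refine le_trans ?_ hub
    refine (le_abs_self _).trans (abs_le_of_sq_le_sq ?_ (l2norm_nonneg _))
    rw [l2norm_sq, l2norm_sq]
    refine le_trans (le_of_eq ?_)
      (sum_fin_castLE_le (Nat.sub_le m k) (fun i => u i ^ 2) fun i => sq_nonneg _)
    refine Finset.sum_congr rfl fun i _ => ?_
    have hi : ((Fin.castLE (Nat.sub_le m k) i : Fin m) : ℕ) < m - k := i.2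
    rw [hu, Pi.sub_apply, designMatrix_mulVec, designMatrix_mulVec, dif_pos hi, dif_pos hi, hG,
      Matrix.mulVec_sub, Matrix.mulVec_sub, Pi.sub_apply]
    rfl
  have hRBz : l2norm (R.mulVec (B.mulVec (z' - z))) ≤ 3 * b := by
    have : z' - z = ((Gsparse d k n).mulVec θ' - z) - D := by rw [hD]; abel
    rw [this, Matrix.mulVec_sub, Matrix.mulVec_sub]
    exact (l2norm_sub_le _ _).trans (by linarith)
  have h1 := hω.lower z' hz's hne
  have h2 := pow_le_pow_left₀ (l2norm_nonneg _) hRBz 2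
  have h3 := pow_le_pow_left₀ (lambdaBin_nonneg B) (lambdaBin_le B hz's hz hne) 2
  rw [← Matrix.mulVec_sub] at h3
  have hN : 5 / 6 * (m : ℝ) ≤ (m - k : ℕ) := by
    rw [Nat.cast_sub (by omega)]
    have : (k : ℝ) ≤ d := by exact_mod_cast hkd
    linarith
  have h4 : s ^ 2 ≤ lambdaBin B ^ 2 := pow_le_pow_left₀ hs.le hsl 2
  have h5 : 5 / 6 * (m : ℝ) / 32 * s ^ 2 ≤ (m - k : ℕ) / 32 * l2norm (B.mulVec (z' - z)) ^ 2 :=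
    mul_le_mul (by linarith) (h4.trans h3) (sq_nonneg _) (by positivity)
  have h6 : 5 / 6 * (m : ℝ) / 32 * s ^ 2 ≤ (3 * b) ^ 2 := h5.trans (h1.trans h2)
  -- The contradiction is numerical: (5/6)/32 is about 0.026, while 9/10⁴ is 0.0009.
  rw [mul_pow, hb2] at h6
  nlinarith [mul_pos hm0 (pow_pos hs 2)]

theorem sqResidual_eq (B : Matrix (Fin d) (Fin d) ℝ) (t v : Fin d → ℝ) :
    sqResidual B t v = l2norm (B.mulVec v - t) ^ 2 := by
  rw [l2norm_sq, sqResidual]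
  exact Finset.sum_congr rfl fun a _ => (sq _).symm

/-- Triangle inequality: another sign vector is mapped to distance at least λ - α λ > α λ from t. -/
theorem sqResidual_lt_of_isBinaryBDD (B : Matrix (Fin d) (Fin d) ℝ) {t z : Fin d → ℝ} {α : ℝ}
    (hα : α < 1 / 2) (hl : 0 < lambdaBin B) (h : IsBinaryBDD α B t z) :
    sqResidual B t z ≤ (α * lambdaBin B) ^ 2 ∧
    ∀ z', IsSignVector z' → z' ≠ z → sqResidual B t z < sqResidual B t z' := by
  obtain ⟨hz, e, ht, he⟩ := h
  have h1 : l2norm (B.mulVec z - t) ≤ α * lambdaBin B := by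
    rw [ht, l2norm_sub_comm, add_sub_cancel_left]
    exact he
  refine ⟨?_, fun z' hz' hne => ?_⟩
  · rw [sqResidual_eq]
    exact pow_le_pow_left₀ (l2norm_nonneg _) h1 2
  · rw [sqResidual_eq, sqResidual_eq]
    refine pow_lt_pow_left₀ ?_ (l2norm_nonneg _) two_ne_zero
    have h2 := lambdaBin_le B hz' hz hne
    have h3 : B.mulVec z' - B.mulVec z = (B.mulVec z' - t) - (B.mulVec z - t) := by abel
    rw [h3] at h2
    have h4 := h2.trans (l2norm_sub_le _ _)
    nlinarith

end

/-! ### Gaussian vectors -/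

/-- The law of a vector of independent standard Gaussians. -/
def stdGaussianPi (ι : Type) [Fintype ι] : Measure (ι → ℝ) :=
  Measure.pi fun _ => gaussianReal 0 1

instance (ι : Type) [Fintype ι] : IsProbabilityMeasure (stdGaussianPi ι) := by
  unfold stdGaussianPi; infer_instance

/-- Completing the square in the Gaussian density. -/
theorem setIntegral_exp_gaussianReal (h : ℝ) {s : Set ℝ} (hs : MeasurableSet s) :
    ENNReal.ofReal (∫ x in s, Real.exp (h * x - h ^ 2 / 2) ∂gaussianReal 0 1) =
      gaussianReal h 1 s := by
  rw [gaussianReal_apply_eq_integral h one_ne_zero, ← integral_indicator hs,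
    integral_gaussianReal_eq_integral_smul one_ne_zero, ← integral_indicator hs]
  congr 2
  funext x
  by_cases hx : x ∈ s
  · simp only [Set.indicator_of_mem hx, gaussianPDFReal, smul_eq_mul, NNReal.coe_one]
    rw [mul_assoc, ← Real.exp_add]
    congr 2
    ring
  · simp [Set.indicator_of_notMem hx]

theorem integrable_exp_gaussianReal (h : ℝ) :
    Integrable (fun x => Real.exp (h * x - h ^ 2 / 2)) (gaussianReal 0 1) := by
  have := (integrable_exp_mul_gaussianReal (μ := 0) (v := 1) h).mul_const (Real.exp (-(h ^ 2 / 2)))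
  refine this.congr (Filter.Eventually.of_forall fun x => ?_)
  simp only [← Real.exp_add]
  congr 1

theorem integral_exp_gaussianReal (h : ℝ) :
    ∫ x, Real.exp (h * x) ∂gaussianReal 0 1 = Real.exp (h ^ 2 / 2) := by
  have := congrFun (mgf_fun_id_gaussianReal (μ := 0) (v := 1)) h
  simp only [mgf] at this
  rw [this]
  simp

section shift

variable {ι : Type} [Fintype ι]

/-- The density of the standard Gaussian shifted by `h`. -/
def shiftDensity (h : ι → ℝ) (x : ι → ℝ) : ℝ := ∏ i, Real.exp (h i * x i - h i ^ 2 / 2)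

theorem shiftDensity_nonneg (h x : ι → ℝ) : 0 ≤ shiftDensity h x :=
  Finset.prod_nonneg fun _ _ => (Real.exp_pos _).le

theorem integrable_shiftDensity (h : ι → ℝ) : Integrable (shiftDensity h) (stdGaussianPi ι) :=
  Integrable.fintype_prod (f := fun i x => Real.exp (h i * x - h i ^ 2 / 2))
    fun i => integrable_exp_gaussianReal (h i)

theorem map_add_stdGaussianPi (h : ι → ℝ) :
    (stdGaussianPi ι).map (fun g => g + h) =
      (stdGaussianPi ι).withDensity fun x => ENNReal.ofReal (shiftDensity h x) := by
  have h1 : (stdGaussianPi ι).map (fun g => g + h) =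
      Measure.pi fun i => gaussianReal (h i) 1 := by
    have := Measure.pi_map_pi (μ := fun _ : ι => gaussianReal 0 1) (f := fun i x => x + h i)
      (hμ := fun i => by rw [gaussianReal_map_add_const]; infer_instance)
      (fun i => by fun_prop)
    simp only [gaussianReal_map_add_const, zero_add] at this
    exact this
  rw [h1]
  refine Measure.pi_eq fun s hs => ?_
  have hbox : MeasurableSet (Set.univ.pi s) := MeasurableSet.univ_pi hs
  rw [withDensity_apply _ hbox, ← ofReal_integral_eq_lintegral_ofReal
    (integrable_shiftDensity h).integrableOn
    (Filter.Eventually.of_forall fun x => shiftDensity_nonneg h x), ← integral_indicator hbox]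
  have h2 : (Set.univ.pi s).indicator (shiftDensity h) = fun x =>
      ∏ i, (s i).indicator (fun y => Real.exp (h i * y - h i ^ 2 / 2)) (x i) := by
    funext x
    by_cases hx : x ∈ Set.univ.pi s
    · rw [Set.indicator_of_mem hx, shiftDensity]
      refine Finset.prod_congr rfl fun i _ => ?_
      rw [Set.indicator_of_mem (hx i (Set.mem_univ i))]
    · rw [Set.indicator_of_notMem hx]
      simp only [Set.mem_pi, Set.mem_univ, true_implies, not_forall] at hx
      obtain ⟨i, hi⟩ := hx
      exact (Finset.prod_eq_zero (Finset.mem_univ i) (Set.indicator_of_notMem hi _)).symm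
  rw [h2, stdGaussianPi, integral_fintype_prod_eq_prod, ENNReal.ofReal_prod_of_nonneg
    fun i _ => integral_nonneg fun y => Set.indicator_nonneg (fun _ _ => (Real.exp_pos _).le) _]
  refine Finset.prod_congr rfl fun i _ => ?_
  rw [integral_indicator (hs i), setIntegral_exp_gaussianReal (h i) (hs i)]

theorem integral_shiftDensity (h : ι → ℝ) : ∫ x, shiftDensity h x ∂stdGaussianPi ι = 1 := by
  unfold shiftDensity stdGaussianPi
  rw [integral_fintype_prod_eq_prod (fun i x => Real.exp (h i * x - h i ^ 2 / 2))]
  refine Finset.prod_eq_one fun i _ => ?_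
  have : ∀ x, Real.exp (h i * x - h i ^ 2 / 2) = Real.exp (h i * x) * Real.exp (-(h i ^ 2 / 2)) :=
    fun x => by rw [← Real.exp_add]; congr 1
  simp only [this]
  rw [integral_mul_const, integral_exp_gaussianReal, ← Real.exp_add]
  simp

/-- With `integral_shiftDensity` this gives the second moment exp(‖h‖²) of the density, hence the
chi-squared distance exp(‖h‖²) - 1. -/
theorem shiftDensity_sq (h x : ι → ℝ) : shiftDensity h x ^ 2 =
    Real.exp (∑ i, h i ^ 2) * shiftDensity (fun i => 2 * h i) x := by
  unfold shiftDensity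
  rw [← Finset.prod_pow, Real.exp_sum, ← Finset.prod_mul_distrib]
  refine Finset.prod_congr rfl fun i _ => ?_
  rw [← Real.exp_add, ← Real.exp_nat_mul]
  congr 1
  push_cast
  ring

/-- Shifting a standard Gaussian by a short vector changes probabilities only little. -/
theorem abs_shift_sub_le {h : ι → ℝ} (hh : ∑ i, h i ^ 2 ≤ 1 / 25) {A : Set (ι → ℝ)}
    (hA : MeasurableSet A) :
    |(stdGaussianPi ι).real ((fun g => g + h) ⁻¹' A) - (stdGaussianPi ι).real A| ≤ 1 / 4 := by
  have hI := integrable_shiftDensity h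
  have h1 : (stdGaussianPi ι).real ((fun g => g + h) ⁻¹' A) =
      ∫ x in A, shiftDensity h x ∂stdGaussianPi ι := by
    rw [Measure.real, ← Measure.map_apply (by fun_prop) hA, map_add_stdGaussianPi,
      withDensity_apply _ hA, ← ofReal_integral_eq_lintegral_ofReal hI.integrableOn
      (Filter.Eventually.of_forall fun x => shiftDensity_nonneg h x), ENNReal.toReal_ofReal
      (integral_nonneg fun x => shiftDensity_nonneg h x)]
  have h2 : (stdGaussianPi ι).real A = ∫ _ in A, (1 : ℝ) ∂stdGaussianPi ι := by simp
  have hI2 : Integrable (fun x => shiftDensity h x ^ 2) (stdGaussianPi ι) := by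
    simp only [shiftDensity_sq]
    exact (integrable_shiftDensity _).const_mul _
  have hIs : Integrable (fun x => shiftDensity h x ^ 2 - 2 * shiftDensity h x)
      (stdGaussianPi ι) := hI2.sub (hI.const_mul 2)
  have hId : Integrable (fun x => shiftDensity h x - 1) (stdGaussianPi ι) :=
    hI.sub (integrable_const _)
  have hIq : Integrable (fun x => (shiftDensity h x ^ 2 - 2 * shiftDensity h x + 1))
      (stdGaussianPi ι) := hIs.add (integrable_const _)
  have hq : ∫ x, (shiftDensity h x ^ 2 - 2 * shiftDensity h x + 1) ∂stdGaussianPi ι =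
      Real.exp (∑ i, h i ^ 2) - 1 := by
    rw [integral_add hIs (integrable_const _),
      integral_sub hI2 (hI.const_mul 2), integral_const_mul, integral_shiftDensity]
    simp only [shiftDensity_sq]
    rw [integral_const_mul, integral_shiftDensity]
    simp
    ring
  rw [h1, h2, ← integral_sub hI.integrableOn (integrable_const _)]
  calc |∫ x in A, (shiftDensity h x - 1) ∂stdGaussianPi ι|
      ≤ ∫ x in A, |shiftDensity h x - 1| ∂stdGaussianPi ι := abs_integral_le_integral_abs
    _ ≤ ∫ x, |shiftDensity h x - 1| ∂stdGaussianPi ι :=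
        setIntegral_le_integral hId.abs (Filter.Eventually.of_forall fun x => abs_nonneg _)
    -- Pointwise |x| ≤ 2x² + 1/8, which replaces the Cauchy–Schwarz inequality. The final bound is
    -- 2(25/24 - 1) + 1/8 < 1/4.
    _ ≤ ∫ x, (2 * (shiftDensity h x ^ 2 - 2 * shiftDensity h x + 1) + 1 / 8)
          ∂stdGaussianPi ι := by
        refine integral_mono hId.abs ((hIq.const_mul 2).add (integrable_const _)) fun x => ?_
        simp only
        nlinarith [sq_abs (shiftDensity h x - 1), sq_nonneg (|shiftDensity h x - 1| - 1 / 4)]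
    _ = 2 * (Real.exp (∑ i, h i ^ 2) - 1) + 1 / 8 := by
        rw [integral_add (hIq.const_mul 2) (integrable_const _), integral_const_mul, hq]
        simp
    _ ≤ 1 / 4 := by
        have h3 : Real.exp (∑ i, h i ^ 2) ≤ Real.exp (1 / 25) := Real.exp_le_exp.2 hh
        have h4 : Real.exp (1 / 25) ≤ 1 / (1 - 1 / 25) :=
          Real.exp_bound_div_one_sub_of_interval (by norm_num) (by norm_num)
        norm_num at h4
        linarith

end shift

/-- If a Gaussian vector is shifted by a function of an independent variable that is usually
short, then the joint law does not change much. -/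
theorem abs_prod_shift_sub_le {ι : Type} [Fintype ι] {Ω : Type} [MeasurableSpace Ω]
    (μ : Measure Ω) [IsProbabilityMeasure μ] {h : Ω → ι → ℝ} (hh : Measurable h)
    (hμ : μ.real {x | 1 / 25 < ∑ i, h x i ^ 2} ≤ 1 / 4)
    {A : Set (Ω × (ι → ℝ))} (hA : MeasurableSet A) :
    |(μ.prod (stdGaussianPi ι)).real {p | (p.1, p.2 + h p.1) ∈ A} -
      (μ.prod (stdGaussianPi ι)).real A| ≤ 1 / 2 := by
  have hprod : ∀ S : Set (Ω × (ι → ℝ)), MeasurableSet S →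
      Integrable (fun x => (stdGaussianPi ι).real (Prod.mk x ⁻¹' S)) μ ∧
      (μ.prod (stdGaussianPi ι)).real S =
        ∫ x, (stdGaussianPi ι).real (Prod.mk x ⁻¹' S) ∂μ := by
    intro S hS
    have hm := measurable_measure_prodMk_left (ν := stdGaussianPi ι) hS
    constructor
    · refine Integrable.of_bound hm.ennreal_toReal.aestronglyMeasurable 1
        (Filter.Eventually.of_forall fun x => ?_)
      rw [Real.norm_eq_abs, abs_of_nonneg measureReal_nonneg]
      exact measureReal_le_one
    · rw [Measure.real, Measure.prod_apply hS, ← integral_toReal hm.aemeasurable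
        (Filter.Eventually.of_forall fun x => measure_lt_top _ _)]
      rfl
  have hA' : MeasurableSet {p : Ω × (ι → ℝ) | (p.1, p.2 + h p.1) ∈ A} := by
    have : Measurable fun p : Ω × (ι → ℝ) => (p.1, p.2 + h p.1) :=
      measurable_fst.prodMk (measurable_snd.add (hh.comp measurable_fst))
    exact this hA
  obtain ⟨i1, e1⟩ := hprod _ hA'
  obtain ⟨i2, e2⟩ := hprod _ hA
  set bad : Set Ω := {x | 1 / 25 < ∑ i, h x i ^ 2} with hbad
  have hbadm : MeasurableSet bad :=
    measurableSet_lt measurable_const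
      (Finset.measurable_sum _ fun i _ => ((measurable_pi_iff.1 hh i).pow_const 2))
  rw [e1, e2, ← integral_sub i1 i2]
  refine abs_integral_le_integral_abs.trans ?_
  -- Fibre by fibre: at most 1/4 where the shift is short, and trivially at most 1 on the bad set,
  -- whose measure is at most 1/4.
  have hle : ∀ x, |(stdGaussianPi ι).real (Prod.mk x ⁻¹' {p : Ω × (ι → ℝ) |
      (p.1, p.2 + h p.1) ∈ A}) - (stdGaussianPi ι).real (Prod.mk x ⁻¹' A)| ≤
      1 / 4 + bad.indicator 1 x := by
    intro x
    by_cases hx : x ∈ bad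
    · rw [Set.indicator_of_mem hx, Pi.one_apply, abs_le]
      have b1 : (stdGaussianPi ι).real (Prod.mk x ⁻¹' {p : Ω × (ι → ℝ) |
        (p.1, p.2 + h p.1) ∈ A}) ≤ 1 := measureReal_le_one
      have b2 : (stdGaussianPi ι).real (Prod.mk x ⁻¹' A) ≤ 1 := measureReal_le_one
      have b3 : 0 ≤ (stdGaussianPi ι).real (Prod.mk x ⁻¹' {p : Ω × (ι → ℝ) |
        (p.1, p.2 + h p.1) ∈ A}) := measureReal_nonneg
      have b4 : 0 ≤ (stdGaussianPi ι).real (Prod.mk x ⁻¹' A) := measureReal_nonneg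
      constructor <;> linarith
    · rw [Set.indicator_of_notMem hx, add_zero]
      exact abs_shift_sub_le (not_lt.1 hx) (measurable_prodMk_left hA)
  have hib : Integrable (fun x => bad.indicator (1 : Ω → ℝ) x) μ :=
    (integrable_const (1 : ℝ)).indicator hbadm
  refine (integral_mono (i1.sub i2).abs ((integrable_const (1 / 4 : ℝ)).add hib) hle).trans ?_
  simp only [Pi.add_apply]
  rw [integral_add (integrable_const _) hib, integral_indicator_one hbadm]
  simp
  linarith

/-! ### Images of Gaussian vectors -/

theorem map_dotProduct_stdGaussianPi {ι : Type} [Fintype ι] (v : ι → ℝ) :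
    (stdGaussianPi ι).map (fun r => r ⬝ᵥ v) = gaussianReal 0 (l2norm v ^ 2).toNNReal := by
  have h := IsGaussian.map_eq_gaussianReal (μ := stdGaussian (EuclideanSpace ℝ ι))
    (innerSL ℝ (WithLp.toLp 2 v))
  rw [integral_strongDual_stdGaussian, variance_dual_stdGaussian, innerSL_apply_norm,
    ← map_pi_eq_stdGaussian, Measure.map_map (by fun_prop) (by fun_prop)] at h
  rw [l2norm, ← h, stdGaussianPi]
  rfl

/-- Characteristic functions agree since ⟨Mᵀ r, x⟩ = ⟨r, M x⟩ and ‖M x‖² = xᵀ Mᵀ M x. With M = B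
G_sparse this is the law of one design row. -/
theorem map_mulVec_stdGaussianPi {ι κ : Type} [Fintype ι] [Fintype κ] [DecidableEq κ]
    (M : Matrix ι κ ℝ) :
    (stdGaussianPi ι).map (fun r => (WithLp.toLp 2 (M.transpose.mulVec r) : EuclideanSpace ℝ κ)) =
      multivariateGaussian 0 (M.transpose * M) := by
  have hmeas : Measurable fun r : ι → ℝ =>
      (WithLp.toLp 2 (M.transpose.mulVec r) : EuclideanSpace ℝ κ) := by
    have : Continuous fun r : ι → ℝ => M.transpose.mulVec r := by fun_prop
    exact ((PiLp.continuous_toLp 2 _).comp this).measurable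
  have : IsProbabilityMeasure ((stdGaussianPi ι).map (fun r =>
      (WithLp.toLp 2 (M.transpose.mulVec r) : EuclideanSpace ℝ κ))) :=
    Measure.isProbabilityMeasure_map hmeas.aemeasurable
  have hS : (M.transpose * M).PosSemidef := by
    simpa using Matrix.posSemidef_conjTranspose_mul_self M
  refine Measure.ext_of_charFun (funext fun x => ?_)
  rw [charFun_multivariateGaussian hS, charFun_apply, integral_map hmeas.aemeasurable
    (by fun_prop)]
  have h1 := charFun_stdGaussian (E := EuclideanSpace ℝ ι) (WithLp.toLp 2 (M.mulVec x.ofLp))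
  rw [charFun_apply, ← map_pi_eq_stdGaussian, integral_map (by fun_prop) (by fun_prop)] at h1
  have h2 : ∀ r : ι → ℝ, inner ℝ (WithLp.toLp 2 (M.transpose.mulVec r) : EuclideanSpace ℝ κ) x =
      inner ℝ (WithLp.toLp 2 r : EuclideanSpace ℝ ι) (WithLp.toLp 2 (M.mulVec x.ofLp)) := by
    intro r
    simp only [EuclideanSpace.inner_eq_star_dotProduct, star_trivial]
    rw [Matrix.mulVec_transpose, dotProduct_comm, ← Matrix.dotProduct_mulVec, dotProduct_comm]
  simp only [h2]
  rw [stdGaussianPi, h1]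
  congr 1
  have h3 : ‖(WithLp.toLp 2 (M.mulVec x.ofLp) : EuclideanSpace ℝ ι)‖ ^ 2 =
      x.ofLp ⬝ᵥ (M.transpose * M).mulVec x.ofLp := by
    rw [← Matrix.mulVec_mulVec, Matrix.mulVec_transpose, dotProduct_comm,
      ← Matrix.dotProduct_mulVec, EuclideanSpace.norm_sq_eq, dotProduct]
    simp [sq]
  rw [← h3]
  simp [neg_div]

/-! ### The law of the random tape -/

instance : IsProbabilityMeasure tapeLaw := by unfold tapeLaw; infer_instance

/-- The law of a matrix of independent standard Gaussians. -/
def gaussianMatrix (N d : ℕ) : Measure (Fin N → Fin d → ℝ) :=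
  Measure.pi fun _ => stdGaussianPi (Fin d)

instance (N d : ℕ) : IsProbabilityMeasure (gaussianMatrix N d) := by
  unfold gaussianMatrix; infer_instance

/-- The position on the tape of the entries of the Gaussian matrix and of the noise. -/
def tapeIndex (N d m : ℕ) : (Fin N × Fin d) ⊕ Fin m → ℕ
  | .inl (i, a) => i * (d + 1) + a
  | .inr i => i * (d + 1) + d

/-- Division with remainder by the row length d + 1. No tape position is used twice, so R and g are
independent. -/
theorem tapeIndex_injective (N d m : ℕ) : Function.Injective (tapeIndex N d m) := by
  have hdiv : ∀ i a : ℕ, a < d + 1 → (i * (d + 1) + a) / (d + 1) = i := fun i a h => by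
    rw [mul_comm, Nat.mul_add_div (by omega), Nat.div_eq_of_lt h, add_zero]
  have hmod : ∀ i a : ℕ, a < d + 1 → (i * (d + 1) + a) % (d + 1) = a := fun i a h => by
    rw [mul_comm, Nat.mul_add_mod, Nat.mod_eq_of_lt h]
  have key : ∀ i a j b : ℕ, a < d + 1 → b < d + 1 →
      i * (d + 1) + a = j * (d + 1) + b → i = j ∧ a = b := fun i a j b ha hb h =>
    ⟨by rw [← hdiv i a ha, h, hdiv j b hb], by rw [← hmod i a ha, h, hmod j b hb]⟩
  rintro (⟨i, a⟩ | i) (⟨j, b⟩ | j) h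
  · obtain ⟨h1, h2⟩ := key i a j b (by omega) (by omega) h
    rw [Fin.ext h1, Fin.ext h2]
  · obtain ⟨-, h2⟩ := key i a j d (by omega) (by omega) h
    omega
  · obtain ⟨-, h2⟩ := key i d j b (by omega) (by omega) h
    omega
  · obtain ⟨h1, -⟩ := key i d j d (by omega) (by omega) h
    rw [Fin.ext h1]

/-- The part of the tape that the program reads. -/
def readTape (N d m : ℕ) (ω : ℕ → ℝ) : (Fin N → Fin d → ℝ) × (Fin m → ℝ) :=
  (fun i a => ω (i * (d + 1) + a), fun i => ω (i * (d + 1) + d))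

theorem measurable_readTape (N d m : ℕ) : Measurable (readTape N d m) := by
  unfold readTape
  fun_prop

theorem map_readTape (N d m : ℕ) :
    tapeLaw.map (readTape N d m) = (gaussianMatrix N d).prod (stdGaussianPi (Fin m)) := by
  have h1 : tapeLaw.map (fun ω j => ω (tapeIndex N d m j)) =
      Measure.pi fun _ => gaussianReal 0 1 := by
    rw [tapeLaw, Measure.map_infinitePi_infinitePi_of_inj (tapeIndex_injective N d m),
      Measure.infinitePi_eq_pi]
  have h2 := (measurePreserving_sumPiEquivProdPi
    (fun _ : (Fin N × Fin d) ⊕ Fin m => gaussianReal 0 1)).map_eq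
  have h3 : (Measure.pi fun _ : Fin N × Fin d => gaussianReal 0 1).map
      (MeasurableEquiv.curry (Fin N) (Fin d) ℝ) = gaussianMatrix N d := by
    have := Measure.infinitePi_map_curry (fun (_ : Fin N) (_ : Fin d) => gaussianReal 0 1)
    simp only [Measure.infinitePi_eq_pi] at this
    exact this
  rw [← h3, ← Measure.map_id (μ := stdGaussianPi (Fin m)), Measure.map_prod_map _ _
    (MeasurableEquiv.measurable _) measurable_id, stdGaussianPi, ← h2, ← h1,
    Measure.map_map (MeasurableEquiv.measurable _) (by fun_prop),
    Measure.map_map ((MeasurableEquiv.measurable _).prodMap measurable_id)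
      ((MeasurableEquiv.measurable _).comp (by fun_prop))]
  rfl

theorem map_readTape_fst (N d : ℕ) :
    tapeLaw.map (fun ω => (readTape N d 0 ω).1) = gaussianMatrix N d := by
  have : (fun ω => (readTape N d 0 ω).1) = Prod.fst ∘ readTape N d 0 := rfl
  rw [this, ← Measure.map_map measurable_fst (measurable_readTape N d 0), map_readTape]
  exact Measure.map_fst_prod.trans (by simp)

/-! ### Concentration of Gaussian sums of squares. -/

section concentration

variable {N d m : ℕ}

theorem map_mulVec_gaussianMatrix (v : Fin d → ℝ) :
    (gaussianMatrix N d).map (fun R i => R i ⬝ᵥ v) =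
      Measure.pi fun _ : Fin N => gaussianReal 0 (l2norm v ^ 2).toNNReal := by
  have := Measure.pi_map_pi (μ := fun _ : Fin N => stdGaussianPi (Fin d))
    (f := fun _ r => r ⬝ᵥ v) (hμ := fun i => by
      rw [map_dotProduct_stdGaussianPi]; infer_instance)
    (fun i => Measurable.aemeasurable (by unfold dotProduct; fun_prop))
  simp only [map_dotProduct_stdGaussianPi] at this
  exact this

theorem measurable_tapeMatrix_mulVec (v : Fin d → ℝ) :
    Measurable fun ω : ℕ → ℝ => (tapeMatrix d ω : Matrix (Fin N) (Fin d) ℝ).mulVec v := by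
  unfold tapeMatrix Matrix.mulVec dotProduct
  fun_prop

theorem map_tapeMatrix_mulVec (v : Fin d → ℝ) :
    tapeLaw.map (fun ω => (tapeMatrix d ω : Matrix (Fin N) (Fin d) ℝ).mulVec v) =
      Measure.pi fun _ : Fin N => gaussianReal 0 (l2norm v ^ 2).toNNReal := by
  have hm : Measurable fun (R : Fin N → Fin d → ℝ) i => R i ⬝ᵥ v := by
    unfold dotProduct; fun_prop
  rw [← map_mulVec_gaussianMatrix, ← map_readTape_fst, Measure.map_map hm
    (show Measurable fun ω => (readTape N d 0 ω).1 from
      measurable_fst.comp (measurable_readTape N d 0))]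
  rfl

theorem map_tapeMatrix_mulVec_apply (v : Fin d → ℝ) (i : Fin N) :
    tapeLaw.map (fun ω => (tapeMatrix d ω : Matrix (Fin N) (Fin d) ℝ).mulVec v i) =
      gaussianReal 0 (l2norm v ^ 2).toNNReal := by
  have h := map_tapeMatrix_mulVec (N := N) v
  have h2 := congrArg (Measure.map (Function.eval i)) h
  rw [Measure.map_map (measurable_pi_apply i) (measurable_tapeMatrix_mulVec v),
    (measurePreserving_eval _ i).map_eq] at h2
  exact h2

theorem map_tape_apply (i : ℕ) : tapeLaw.map (fun ω => ω i) = gaussianReal 0 1 := by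
  rw [tapeLaw]
  exact Measure.infinitePi_map_eval _ i

/-- Markov's inequality for a sum of squares of centered Gaussians. -/
theorem measure_sum_sq_gt_le {Ω ι : Type} [MeasurableSpace Ω] [Fintype ι] {μ : Measure Ω}
    [IsProbabilityMeasure μ] {Y : ι → Ω → ℝ} {V : ι → ℝ} (hY : ∀ i, Measurable (Y i))
    (hV : ∀ i, 0 ≤ V i) (hlaw : ∀ i, μ.map (Y i) = gaussianReal 0 (V i).toNNReal) {M : ℝ}
    (hM : ∑ i, V i ≤ M) : μ.real {ω | 100 * M < ∑ i, Y i ω ^ 2} ≤ 1 / 100 := by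
  have hint : ∀ i, Integrable (fun ω => Y i ω ^ 2) μ ∧ ∫ ω, Y i ω ^ 2 ∂μ = V i := by
    intro i
    have h1 : Integrable (fun x : ℝ => x ^ 2) (gaussianReal 0 (V i).toNNReal) :=
      (memLp_id_gaussianReal (μ := 0) (v := (V i).toNNReal) 2).integrable_sq
    have h2 : ∫ x : ℝ, x ^ 2 ∂gaussianReal 0 (V i).toNNReal = V i := by
      have := variance_of_integral_eq_zero (μ := gaussianReal 0 (V i).toNNReal)
        (X := fun x => x) (by fun_prop) integral_id_gaussianReal
      rw [← this, variance_fun_id_gaussianReal, Real.coe_toNNReal _ (hV i)]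
    rw [← hlaw i] at h1 h2
    refine ⟨(integrable_map_measure h1.aestronglyMeasurable (hY i).aemeasurable).1 h1, ?_⟩
    rw [integral_map (hY i).aemeasurable h1.aestronglyMeasurable] at h2
    exact h2
  have hsum : ∫ ω, ∑ i, Y i ω ^ 2 ∂μ = ∑ i, V i := by
    rw [integral_finsetSum _ fun i _ => (hint i).1]
    exact Finset.sum_congr rfl fun i _ => (hint i).2
  have hi : Integrable (fun ω => ∑ i, Y i ω ^ 2) μ := integrable_finsetSum _ fun i _ => (hint i).1
  have hnn : 0 ≤ᵐ[μ] fun ω => ∑ i, Y i ω ^ 2 :=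
    Filter.Eventually.of_forall fun ω => Finset.sum_nonneg fun i _ => sq_nonneg _
  have hS0 : 0 ≤ ∑ i, V i := Finset.sum_nonneg fun i _ => hV i
  -- M = 0 does occur (e = 0 or B = 0); then Markov's inequality is empty, but the sum vanishes
  -- almost surely.
  rcases (hS0.trans hM).eq_or_lt with h0 | h0
  · have hz : ∫ ω, ∑ i, Y i ω ^ 2 ∂μ = 0 := by rw [hsum]; linarith
    rw [integral_eq_zero_iff_of_nonneg_ae hnn hi] at hz
    have : μ {ω | 100 * M < ∑ i, Y i ω ^ 2} = 0 := by
      refine measure_mono_null (fun ω hω => ?_) (ae_iff.1 hz)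
      simp only [Set.mem_ofPred_eq] at hω ⊢
      rw [← h0, mul_zero] at hω
      exact hω.ne'
    rw [Measure.real, this]
    norm_num
  · have h1 := mul_meas_ge_le_integral_of_nonneg hnn hi (100 * M)
    rw [hsum] at h1
    have h2 : μ.real {ω | 100 * M < ∑ i, Y i ω ^ 2} ≤ μ.real {ω | 100 * M ≤ ∑ i, Y i ω ^ 2} :=
      measureReal_mono fun ω hω => by
        simp only [Set.mem_ofPred_eq] at hω ⊢
        exact hω.le
    have h3 : 100 * M * μ.real {ω | 100 * M < ∑ i, Y i ω ^ 2} ≤ M :=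
      (mul_le_mul_of_nonneg_left h2 (by linarith)).trans (h1.trans hM)
    nlinarith

/-- The Laplace transform of x² at 32/V, equal to 1/√65; each coordinate contributes this factor to
the Chernoff bound. -/
theorem integral_exp_neg_sq_gaussianReal {V : ℝ} (hV : 0 < V) :
    ∫ x, Real.exp (-(32 / V) * x ^ 2) ∂gaussianReal 0 V.toNNReal ≤ 1 / 8 := by
  have hv : V.toNNReal ≠ 0 := by simpa using hV
  have hc : (V.toNNReal : ℝ) = V := Real.coe_toNNReal _ hV.le
  rw [integral_gaussianReal_eq_integral_smul hv]
  have h1 : ∀ x : ℝ, gaussianPDFReal 0 V.toNNReal x • Real.exp (-(32 / V) * x ^ 2) =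
      (√(2 * Real.pi * V))⁻¹ * Real.exp (-(65 / (2 * V)) * x ^ 2) := by
    intro x
    rw [gaussianPDFReal, hc, smul_eq_mul, mul_assoc, ← Real.exp_add]
    congr 2
    field_simp
    ring
  simp only [h1]
  rw [integral_const_mul, integral_gaussian, ← Real.sqrt_inv, ← Real.sqrt_mul (by positivity)]
  have h2 : (2 * Real.pi * V)⁻¹ * (Real.pi / (65 / (2 * V))) = 1 / 65 := by
    have := Real.pi_pos
    field_simp
  rw [h2, Real.sqrt_le_left (by norm_num)]
  norm_num

/-- A vector of `N` independent Gaussians of variance `V` is unlikely to be short. -/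
theorem measure_sum_sq_le_le {V : ℝ} (hV : 0 < V) :
    (Measure.pi fun _ : Fin N => gaussianReal 0 V.toNNReal).real
      {x | ∑ i, x i ^ 2 < N / 32 * V} ≤ (3 / 8) ^ N := by
  set ν := Measure.pi fun _ : Fin N => gaussianReal 0 V.toNNReal
  have hi1 : Integrable (fun x : ℝ => Real.exp (-(32 / V) * x ^ 2)) (gaussianReal 0 V.toNNReal) := by
    refine Integrable.of_bound (by fun_prop) 1 (Filter.Eventually.of_forall fun x => ?_)
    rw [Real.norm_eq_abs, abs_of_pos (Real.exp_pos _), Real.exp_le_one_iff]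
    have : 0 ≤ 32 / V * x ^ 2 := by positivity
    linarith
  have hi : Integrable (fun x : Fin N → ℝ => ∏ i, Real.exp (-(32 / V) * x i ^ 2)) ν :=
    Integrable.fintype_prod fun _ => hi1
  have hI : ∫ x : Fin N → ℝ, ∏ i, Real.exp (-(32 / V) * x i ^ 2) ∂ν ≤ (1 / 8) ^ N := by
    rw [integral_fintype_prod_eq_prod (fun _ x => Real.exp (-(32 / V) * x ^ 2)),
      Finset.prod_const, Finset.card_univ, Fintype.card_fin]
    exact pow_le_pow_left₀ (integral_nonneg fun x => (Real.exp_pos _).le)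
      (integral_exp_neg_sq_gaussianReal hV) N
  -- Markov's inequality for exp(-(32/V) ∑ x²), which is at least exp(-N) on the event; the result
  -- is (e/8)^N ≤ (3/8)^N.
  have hM := mul_meas_ge_le_integral_of_nonneg
    (Filter.Eventually.of_forall fun x => Finset.prod_nonneg fun i _ => (Real.exp_pos _).le) hi
    (Real.exp (-N))
  have hsub : ν.real {x | ∑ i, x i ^ 2 < N / 32 * V} ≤
      ν.real {x | Real.exp (-N) ≤ ∏ i, Real.exp (-(32 / V) * x i ^ 2)} := by
    refine measureReal_mono fun x hx => ?_
    simp only [Set.mem_ofPred_eq] at hx ⊢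
    rw [← Real.exp_sum, Real.exp_le_exp, ← Finset.mul_sum]
    have : 32 / V * ∑ i, x i ^ 2 ≤ 32 / V * (N / 32 * V) :=
      mul_le_mul_of_nonneg_left hx.le (by positivity)
    have h2 : 32 / V * (N / 32 * V) = N := by field_simp
    linarith
  have h3 : Real.exp (-N) * ν.real {x | ∑ i, x i ^ 2 < N / 32 * V} ≤ (1 / 8) ^ N :=
    (mul_le_mul_of_nonneg_left hsub (Real.exp_pos _).le).trans (hM.trans hI)
  have h4 : ν.real {x | ∑ i, x i ^ 2 < N / 32 * V} ≤ Real.exp N * (1 / 8) ^ N := by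
    have := mul_le_mul_of_nonneg_left h3 (Real.exp_pos (N : ℝ)).le
    rwa [← mul_assoc, ← Real.exp_add, add_neg_cancel, Real.exp_zero, one_mul] at this
  refine h4.trans ?_
  have h5 : Real.exp (N : ℝ) = Real.exp 1 ^ N := by rw [← Real.exp_nat_mul, mul_one]
  rw [h5, ← mul_pow]
  refine pow_le_pow_left₀ (by positivity) ?_ N
  have := Real.exp_one_lt_d9
  norm_num at this ⊢
  linarith

theorem measure_tapeMatrix_mulVec_lt_le (v : Fin d → ℝ) :
    tapeLaw.real {ω | l2norm ((tapeMatrix d ω : Matrix (Fin N) (Fin d) ℝ).mulVec v) ^ 2 <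
      N / 32 * l2norm v ^ 2} ≤ (3 / 8) ^ N := by
  rcases (sq_nonneg (l2norm v)).eq_or_lt with h0 | h0
  · have : {ω | l2norm ((tapeMatrix d ω : Matrix (Fin N) (Fin d) ℝ).mulVec v) ^ 2 <
        N / 32 * l2norm v ^ 2} = ∅ := by
      ext ω
      simp only [Set.mem_ofPred_eq, Set.mem_empty_iff_false, iff_false, not_lt]
      rw [← h0, mul_zero]
      exact sq_nonneg _
    rw [this, measureReal_empty]
    positivity
  · have h := measure_sum_sq_le_le (N := N) h0
    rw [← map_tapeMatrix_mulVec, map_measureReal_apply (measurable_tapeMatrix_mulVec v)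
      (measurableSet_lt (by fun_prop) measurable_const)] at h
    simp only [Set.preimage_ofPred_eq] at h
    simpa only [l2norm_sq] using h

end concentration

/-! ### The good event. -/

section

variable {d k m n : ℕ}

theorem IsSignVector.exists_bool {z : Fin d → ℝ} (hz : IsSignVector z) :
    ∃ b : Fin d → Bool, z = fun i => if b i then (1 : ℝ) else -1 := by
  refine ⟨fun i => decide (z i = 1), funext fun i => ?_⟩
  rcases hz i with h | h
  · simp [h]
  · norm_num [h]

/-- Union bound over 2^d sign patterns; 5 d rows suffice because 2 (3/8)⁵ < 1/50. When applied to m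
- k rows this is why m ≥ 6 d is required. -/
theorem measure_iUnion_tapeMatrix_lt_le (hd : 1 ≤ d) (hm : 5 * d ≤ m)
    (v : (Fin d → Bool) → Fin d → ℝ) :
    tapeLaw.real (⋃ b, {ω | l2norm ((tapeMatrix d ω : Matrix (Fin m) (Fin d) ℝ).mulVec (v b)) ^ 2 <
      m / 32 * l2norm (v b) ^ 2}) ≤ 1 / 50 := by
  refine (measureReal_iUnion_fintype_le _).trans ?_
  refine (Finset.sum_le_sum fun b _ => measure_tapeMatrix_mulVec_lt_le (v b)).trans ?_
  rw [Finset.sum_const, Finset.card_univ, Fintype.card_fun, Fintype.card_bool, Fintype.card_fin,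
    nsmul_eq_mul]
  push_cast
  have h1 : ((3 : ℝ) / 8) ^ m ≤ (3 / 8) ^ (5 * d) :=
    pow_le_pow_of_le_one (by norm_num) (by norm_num) hm
  have h2 : ((2 : ℝ) * (3 / 8) ^ 5) ^ d ≤ (2 * (3 / 8) ^ 5) ^ 1 :=
    pow_le_pow_of_le_one (by norm_num) (by norm_num) hd
  calc (2 : ℝ) ^ d * (3 / 8) ^ m ≤ 2 ^ d * (3 / 8) ^ (5 * d) := by gcongr
    _ = (2 * (3 / 8) ^ 5) ^ d := by rw [mul_pow, pow_mul]
    _ ≤ _ := h2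
    _ ≤ 1 / 50 := by norm_num

theorem measure_tapeMatrix_mulVec_gt_le {N : ℕ} (hN : N ≤ m) (e : Fin d → ℝ) :
    tapeLaw.real {ω | 100 * (m * l2norm e ^ 2) <
      ∑ i, (tapeMatrix d ω : Matrix (Fin N) (Fin d) ℝ).mulVec e i ^ 2} ≤ 1 / 100 :=
  measure_sum_sq_gt_le (Y := fun (i : Fin N) ω =>
      (tapeMatrix d ω : Matrix (Fin N) (Fin d) ℝ).mulVec e i)
    (V := fun _ => l2norm e ^ 2)
    (fun i => measurable_pi_iff.1 (measurable_tapeMatrix_mulVec e) i) (fun _ => sq_nonneg _)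
    (map_tapeMatrix_mulVec_apply e) (M := m * l2norm e ^ 2) <| by
      rw [Finset.sum_const, Finset.card_univ, Fintype.card_fin, nsmul_eq_mul]
      exact mul_le_mul_of_nonneg_right (by exact_mod_cast hN) (sq_nonneg _)

theorem measure_sum_sq_tape_gt_le (j : Fin m → ℕ) :
    tapeLaw.real {ω | 100 * (m : ℝ) < ∑ i, ω (j i) ^ 2} ≤ 1 / 100 := by
  have hM : ∑ _i : Fin m, (1 : ℝ) ≤ m := by simp
  have hlaw : ∀ i, tapeLaw.map (fun ω => ω (j i)) = gaussianReal 0 (1 : ℝ).toNNReal := fun i => by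
    rw [map_tape_apply, Real.toNNReal_one]
  exact measure_sum_sq_gt_le (fun i => measurable_pi_apply (j i)) (fun _ => zero_le_one) hlaw hM

theorem measure_tapeMatrix_mul_gt_le {N : ℕ} (hN : N ≤ m) (B : Matrix (Fin d) (Fin d) ℝ) :
    tapeLaw.real {ω | 100 * (m * ∑ a, ∑ c, B a c * B a c) <
      ∑ p : Fin N × Fin d, (tapeMatrix d ω : Matrix (Fin N) (Fin d) ℝ).mulVec
        (fun a => B a p.2) p.1 ^ 2} ≤ 1 / 100 :=
  measure_sum_sq_gt_le (Y := fun (p : Fin N × Fin d) ω =>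
      (tapeMatrix d ω : Matrix (Fin N) (Fin d) ℝ).mulVec (fun a => B a p.2) p.1)
    (V := fun p => l2norm (fun a => B a p.2) ^ 2)
    (fun p => measurable_pi_iff.1 (measurable_tapeMatrix_mulVec _) p.1) (fun _ => sq_nonneg _)
    (fun p => map_tapeMatrix_mulVec_apply _ p.1) (M := m * ∑ a, ∑ c, B a c * B a c) <| by
      rw [Fintype.sum_prod_type]
      simp only [l2norm_sq, Finset.sum_const, Finset.card_univ, Fintype.card_fin, nsmul_eq_mul]
      rw [Finset.sum_comm]
      simp only [← sq]
      exact mul_le_mul_of_nonneg_right (by exact_mod_cast hN)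
        (Finset.sum_nonneg fun a _ => Finset.sum_nonneg fun c _ => sq_nonneg _)

/-- The complement of a measurable hull of the bad events avoids proving them measurable; their
total measure is at most 1/20. -/
theorem exists_measurableSet_compl {Ω : Type} [MeasurableSpace Ω] {μ : Measure Ω}
    [IsProbabilityMeasure μ] {E₀ E₁ E₂ E₃ : Set Ω}
    (h0 : μ.real E₀ ≤ 1 / 50) (h1 : μ.real E₁ ≤ 1 / 100) (h2 : μ.real E₂ ≤ 1 / 100)
    (h3 : μ.real E₃ ≤ 1 / 100) :
    ∃ E, MeasurableSet E ∧ 9 / 10 ≤ μ.real E ∧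
      ∀ ω ∈ E, ω ∉ E₀ ∧ ω ∉ E₁ ∧ ω ∉ E₂ ∧ ω ∉ E₃ := by
  refine ⟨(toMeasurable μ (E₀ ∪ E₁ ∪ E₂ ∪ E₃))ᶜ, (measurableSet_toMeasurable _ _).compl, ?_,
    fun ω hω => ?_⟩
  · rw [probReal_compl_eq_one_sub (measurableSet_toMeasurable _ _), measureReal_def,
      measure_toMeasurable, ← measureReal_def]
    have u1 := measureReal_union_le (μ := μ) E₀ E₁
    have u2 := measureReal_union_le (μ := μ) (E₀ ∪ E₁) E₂
    have u3 := measureReal_union_le (μ := μ) (E₀ ∪ E₁ ∪ E₂) E₃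
    linarith
  · have := fun h => hω (subset_toMeasurable μ _ h)
    simp only [Set.mem_union] at this
    tauto

theorem exists_goodTape (hd : 1 ≤ d) (hk : k ∣ d) (hm : 6 * d ≤ m) (B : Matrix (Fin d) (Fin d) ℝ)
    (z e : Fin d → ℝ) :
    ∃ E : Set (ℕ → ℝ), MeasurableSet E ∧ 9 / 10 ≤ tapeLaw.real E ∧
      ∀ ω ∈ E, GoodTape k m B z e ω := by
  have hkd : k ≤ d := Nat.le_of_dvd hd hk
  obtain ⟨E, hE, hE9, h⟩ := exists_measurableSet_compl
    (measure_iUnion_tapeMatrix_lt_le (m := m - k) hd (by omega) fun b =>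
      B.mulVec ((fun i => if b i then (1 : ℝ) else -1) - z))
    (measure_tapeMatrix_mulVec_gt_le (Nat.sub_le m k) e) (measure_sum_sq_tape_gt_le fun i : Fin m => i * (d + 1) + d)
    (measure_tapeMatrix_mul_gt_le (Nat.sub_le m k) B)
  refine ⟨E, hE, hE9, fun ω hω => ?_⟩
  obtain ⟨h0, h1, h2, h3⟩ := h ω hω
  refine ⟨fun z' hz' _ => ?_, ?_, not_lt.1 h2, ?_⟩
  · obtain ⟨b, rfl⟩ := hz'.exists_bool
    rw [Set.mem_iUnion, not_exists] at h0
    exact not_lt.1 (h0 b)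
  · rw [l2norm_sq]
    exact not_lt.1 h1
  · rw [Set.mem_ofPred_eq, not_lt, Fintype.sum_prod_type] at h3
    exact h3

/-! ### The noise is close to Gaussian and nearly independent of the design. -/

theorem gaussianNoise_eq_map (m : ℕ) (σ : ℝ) :
    gaussianNoise m σ = (stdGaussianPi (Fin m)).map (fun g => σ • g) := by
  have := Measure.pi_map_pi (μ := fun _ : Fin m => gaussianReal 0 1)
    (f := fun _ x => σ * x) (hμ := fun i => by rw [gaussianReal_map_const_mul]; infer_instance)
    (fun i => by fun_prop)
  simp only [gaussianReal_map_const_mul, mul_zero, mul_one] at this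
  rw [gaussianNoise]
  refine Eq.trans ?_ this.symm
  congr 1
  funext i
  congr 1
  exact Real.toNNReal_of_nonneg (sq_nonneg σ)

/-- The design and the noise are nearly independent. -/
theorem abs_joint_sub_le (hm : 0 < m) {e : Fin d → ℝ} {σ : ℝ}
    (hσ : 2500 * (m * l2norm e ^ 2) ≤ σ ^ 2) {Ω : Type} [MeasurableSpace Ω]
    {F : (Fin (m - k) → Fin d → ℝ) → Ω} (hF : Measurable F) {A : Set (Ω × (Fin m → ℝ))}
    (hA : MeasurableSet A) :
    |(tapeLaw.map fun ω => (F (readTape (m - k) d 0 ω).1, noiseVec k m e σ ω)).real A -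
      ((tapeLaw.map fun ω => F (readTape (m - k) d 0 ω).1).prod (gaussianNoise m σ)).real A| ≤
      1 / 2 := by
  -- The shift R e in units of σ, zero on the last k rows.
  let h : (Fin (m - k) → Fin d → ℝ) → Fin m → ℝ := fun R i =>
    if hi : (i : ℕ) < m - k then σ⁻¹ * (R ⟨i, hi⟩ ⬝ᵥ e) else 0
  have hh : Measurable h := by
    refine measurable_pi_lambda _ fun i => ?_
    by_cases hi : (i : ℕ) < m - k
    · simp only [h, hi, dif_pos]
      unfold dotProduct
      fun_prop
    · simp only [h, hi, dif_neg, not_false_eq_true]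
      fun_prop
  -- σ may vanish, namely when α = 0. Then `hσ` forces e = 0, and the convention σ⁻¹ = 0 is
  -- harmless.
  have hσe : ∀ x : ℝ, (x = 0 ∨ e ≠ 0) → σ * (σ⁻¹ * x) = x := by
    intro x hx
    rcases hx with rfl | hx
    · simp
    · rw [← mul_assoc, mul_inv_cancel₀, one_mul]
      rintro rfl
      refine hx ?_
      have h0 : l2norm e ^ 2 ≤ 0 := by
        have : (0 : ℝ) < m := by exact_mod_cast hm
        by_contra hcon
        push Not at hcon
        nlinarith [mul_pos this hcon]
      rw [l2norm_sq] at h0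
      funext a
      have := (Finset.sum_eq_zero_iff_of_nonneg (fun a _ => sq_nonneg (e a))).1
        (le_antisymm h0 (Finset.sum_nonneg fun a _ => sq_nonneg (e a))) a (Finset.mem_univ a)
      simpa using this
  have hnoise : ∀ ω, noiseVec k m e σ ω =
      σ • ((readTape (m - k) d m ω).2 + h (readTape (m - k) d m ω).1) := by
    intro ω
    funext i
    simp only [noiseVec, Pi.smul_apply, Pi.add_apply, smul_eq_mul, h]
    rw [mul_add σ, add_comm]
    refine congrArg₂ (· + ·) rfl ?_
    split_ifs with hi
    · rw [hσe]
      · rfl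
      · by_cases he : e = 0
        · left; rw [he, dotProduct_zero]
        · exact Or.inr he
    · rw [mul_zero]
  set ρ := (gaussianMatrix (m - k) d).prod (stdGaussianPi (Fin m)) with hρ
  have hsum : ∀ R : Fin (m - k) → Fin d → ℝ, ∑ i, h R i ^ 2 = (σ⁻¹) ^ 2 * ∑ i, (R i ⬝ᵥ e) ^ 2 := by
    intro R
    have := sum_fin_ite_lt (Nat.sub_le m k)
      (fun i => if hi : i < m - k then (σ⁻¹ * (R ⟨i, hi⟩ ⬝ᵥ e)) ^ 2 else 0)
    rw [Finset.mul_sum]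
    refine Eq.trans ?_ (this.trans ?_)
    · refine Finset.sum_congr rfl fun i _ => ?_
      by_cases hi : (i : ℕ) < m - k <;> simp [h, hi]
    · refine Finset.sum_congr rfl fun i _ => ?_
      rw [dif_pos i.2, mul_pow]
  -- Outside an event of probability 1/100, ‖R e‖² ≤ 100 m ‖e‖² ≤ σ²/25; this is where 2500 comes
  -- from.
  have hbad : (gaussianMatrix (m - k) d).real {R | 1 / 25 < ∑ i, h R i ^ 2} ≤ 1 / 4 := by
    have hset : MeasurableSet {R | 1 / 25 < ∑ i, h R i ^ 2} := measurableSet_lt measurable_const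
      (Finset.measurable_sum _ fun i _ => ((measurable_pi_iff.1 hh i).pow_const 2))
    rw [← map_readTape_fst, map_measureReal_apply
      (show Measurable fun ω => (readTape (m - k) d 0 ω).1 from
        measurable_fst.comp (measurable_readTape (m - k) d 0)) hset]
    have hp := measure_sum_sq_gt_le (μ := tapeLaw) (V := fun _ : Fin (m - k) => l2norm e ^ 2)
      (fun i => measurable_pi_iff.1 (measurable_tapeMatrix_mulVec e) i)
      (fun _ => sq_nonneg _) (fun i => map_tapeMatrix_mulVec_apply e i) (M := m * l2norm e ^ 2) (by
        rw [Finset.sum_const, Finset.card_univ, Fintype.card_fin, nsmul_eq_mul]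
        exact mul_le_mul_of_nonneg_right (by exact_mod_cast Nat.sub_le m k) (sq_nonneg _))
    refine le_trans (measureReal_mono fun ω hω => ?_) (hp.trans (by norm_num))
    simp only [Set.mem_preimage, Set.mem_ofPred_eq, hsum] at hω ⊢
    change 1 / 25 < σ⁻¹ ^ 2 * ∑ i : Fin (m - k),
      (tapeMatrix d ω : Matrix (Fin (m - k)) (Fin d) ℝ).mulVec e i ^ 2 at hω
    by_contra hcon
    push Not at hcon
    rcases eq_or_ne σ 0 with h0 | h0
    · rw [h0] at hω
      norm_num at hω
    · have hσ2 : 0 < σ ^ 2 := by positivity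
      rw [inv_pow, inv_mul_eq_div, lt_div_iff₀ hσ2] at hω
      linarith
  let Ψ : (Fin (m - k) → Fin d → ℝ) × (Fin m → ℝ) → Ω × (Fin m → ℝ) :=
    Prod.map F (fun g => σ • g)
  have hsm : Measurable fun g : Fin m → ℝ => σ • g := by fun_prop
  have hΨ : Measurable Ψ := hF.prodMap hsm
  have hshift : Measurable fun p : (Fin (m - k) → Fin d → ℝ) × (Fin m → ℝ) =>
      (p.1, p.2 + h p.1) :=
    measurable_fst.prodMk (measurable_snd.add (hh.comp measurable_fst))
  have e1 : (tapeLaw.map fun ω => (F (readTape (m - k) d 0 ω).1, noiseVec k m e σ ω)) =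
      (ρ.map fun p => (p.1, p.2 + h p.1)).map Ψ := by
    rw [hρ, ← map_readTape, Measure.map_map hshift (measurable_readTape _ _ _),
      Measure.map_map hΨ (hshift.comp (measurable_readTape _ _ _))]
    congr 1
    funext ω
    rw [hnoise]
    rfl
  have e2 : (tapeLaw.map fun ω => F (readTape (m - k) d 0 ω).1).prod (gaussianNoise m σ) =
      ρ.map Ψ := by
    have : (tapeLaw.map fun ω => F (readTape (m - k) d 0 ω).1) =
        (gaussianMatrix (m - k) d).map F := by
      rw [← map_readTape_fst, Measure.map_map hF
        (show Measurable fun ω => (readTape (m - k) d 0 ω).1 from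
          measurable_fst.comp (measurable_readTape (m - k) d 0))]
      rfl
    rw [this, gaussianNoise_eq_map, Measure.map_prod_map _ _ hF hsm]
  rw [e1, e2, map_measureReal_apply hΨ hA, map_measureReal_apply hΨ hA,
    map_measureReal_apply hshift (hΨ hA)]
  exact abs_prod_shift_sub_le (gaussianMatrix (m - k) d) hh hbad (hΨ hA)

theorem measurable_noiseVec (e : Fin d → ℝ) (σ : ℝ) : Measurable (noiseVec k m e σ) := by
  refine measurable_pi_lambda _ fun i => ?_
  unfold noiseVec
  refine Measurable.add ?_ (by fun_prop)
  split_ifs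
  · exact measurable_pi_iff.1 (measurable_tapeMatrix_mulVec e) i
  · fun_prop

/-! ### The law of the design rows. -/

/-- The random rows of the design matrix. -/
def designRows (k m n : ℕ) (B : Matrix (Fin d) (Fin d) ℝ) (ω : ℕ → ℝ) :
    Fin (m - k) → EuclideanSpace ℝ (Fin n) := fun i => WithLp.toLp 2 fun b =>
  (tapeMatrix d ω * (B * Gsparse d k n) : Matrix (Fin (m - k)) (Fin n) ℝ) i b

theorem measurable_row (M : Matrix (Fin d) (Fin n) ℝ) : Measurable fun r : Fin d → ℝ =>
    (WithLp.toLp 2 (M.transpose.mulVec r) : EuclideanSpace ℝ (Fin n)) := by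
  have : Continuous fun r : Fin d → ℝ => M.transpose.mulVec r := by fun_prop
  exact ((PiLp.continuous_toLp 2 _).comp this).measurable

theorem designRows_eq (B : Matrix (Fin d) (Fin d) ℝ) :
    designRows k m n B = fun ω => (fun (R : Fin (m - k) → Fin d → ℝ) i =>
      (WithLp.toLp 2 ((B * Gsparse d k n).transpose.mulVec (R i)) : EuclideanSpace ℝ (Fin n)))
        (readTape (m - k) d 0 ω).1 := by
  funext ω i
  unfold designRows
  congr 1
  funext b
  rw [Matrix.mulVec_transpose]
  rfl

theorem measurable_rows (M : Matrix (Fin d) (Fin n) ℝ) {N : ℕ} :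
    Measurable fun (R : Fin N → Fin d → ℝ) i =>
      (WithLp.toLp 2 (M.transpose.mulVec (R i)) : EuclideanSpace ℝ (Fin n)) :=
  measurable_pi_lambda _ fun i => (measurable_row M).comp (measurable_pi_apply i)

theorem measurable_designRows (B : Matrix (Fin d) (Fin d) ℝ) :
    Measurable (designRows k m n B) := by
  rw [designRows_eq]
  exact (measurable_rows _).comp (measurable_fst.comp (measurable_readTape _ _ _))

theorem map_designRows (B : Matrix (Fin d) (Fin d) ℝ) :
    tapeLaw.map (designRows k m n B) = Measure.pi (fun _ : Fin (m - k) =>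
      multivariateGaussian 0 ((Gsparse d k n).transpose * B.transpose * B * Gsparse d k n)) := by
  have hlaw := map_mulVec_stdGaussianPi (B * Gsparse d k n)
  have h := Measure.pi_map_pi (μ := fun _ : Fin (m - k) => stdGaussianPi (Fin d))
    (f := fun _ r => (WithLp.toLp 2 ((B * Gsparse d k n).transpose.mulVec r) :
      EuclideanSpace ℝ (Fin n))) (hμ := fun i => by rw [hlaw]; infer_instance)
    (fun i => (measurable_row _).aemeasurable)
  rw [hlaw] at h
  have hcomp := Measure.map_map (μ := tapeLaw) (measurable_rows (N := m - k) (B * Gsparse d k n))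
    (show Measurable fun ω => (readTape (m - k) d 0 ω).1 from
      measurable_fst.comp (measurable_readTape (m - k) d 0))
  rw [map_readTape_fst] at hcomp
  rw [designRows_eq]
  refine hcomp.symm.trans (h.trans ?_)
  rw [Matrix.transpose_mul]
  simp only [Matrix.mul_assoc]

/-! ### The right scale and the parameters. -/

theorem exists_scale {ℓ : ℕ} {lam : ℝ} (h1 : (2 : ℝ)⁻¹ ^ ℓ ≤ lam) (h2 : lam ≤ 2 ^ ℓ) :
    ∃ r < 2 * ℓ + 1, scaleAt ℓ r ≤ lam ∧ lam ≤ 2 * scaleAt ℓ r := by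
  -- The first scale above `lam` is not the initial one, and its predecessor is at most `lam` and at
  -- least half of it. Without such a scale, r = 2 ℓ works, where the scale is 2^ℓ.
  by_cases hlt : ∃ r, lam < scaleAt ℓ r
  · classical
    have hf := Nat.find_spec hlt
    set r := Nat.find hlt with hr
    have hr0 : r ≠ 0 := by
      intro h0
      rw [h0, scaleAt, pow_zero, mul_one] at hf
      linarith
    obtain ⟨j, hj⟩ := Nat.exists_eq_succ_of_ne_zero hr0
    have hjle : scaleAt ℓ j ≤ lam := not_lt.1 (Nat.find_min hlt (by omega))
    have hj2 : lam < 2 * scaleAt ℓ j := by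
      have : scaleAt ℓ (j + 1) = 2 * scaleAt ℓ j := by rw [scaleAt, scaleAt, pow_succ]; ring
      rw [← this, ← Nat.succ_eq_add_one, ← hj]
      exact hf
    refine ⟨j, ?_, hjle, hj2.le⟩
    by_contra hcon
    have h3 : (2 : ℝ) ^ (2 * ℓ + 1) ≤ 2 ^ j := pow_le_pow_right₀ (by norm_num) (by omega)
    have h4 : (2⁻¹ : ℝ) ^ ℓ * 2 ^ (2 * ℓ + 1) = 2 * 2 ^ ℓ := by
      rw [two_mul ℓ, pow_succ, pow_add, inv_pow]
      field_simp
    have h5 : (2⁻¹ : ℝ) ^ ℓ * 2 ^ (2 * ℓ + 1) ≤ scaleAt ℓ j :=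
      mul_le_mul_of_nonneg_left h3 (by positivity)
    have h6 : (0 : ℝ) < 2 ^ ℓ := by positivity
    linarith
  · push Not at hlt
    have h4 : scaleAt ℓ (2 * ℓ) = 2 ^ ℓ := by
      rw [scaleAt, two_mul ℓ, pow_add, inv_pow]
      field_simp
    have h6 : (0 : ℝ) < 2 ^ ℓ := by positivity
    exact ⟨2 * ℓ, by omega, hlt _, by rw [h4]; linarith⟩

theorem scaleAt_pos (ℓ r : ℕ) : 0 < scaleAt ℓ r := by unfold scaleAt; positivity

end

section

variable {d k m n : ℕ}

theorem one_le_sqrt_log (hm : 6 ≤ m) : (1 : ℝ) ≤ √(Real.log m) := by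
  have hm' : (6 : ℝ) ≤ m := by exact_mod_cast hm
  have h1 : (1 : ℝ) ≤ Real.log m := by
    rw [Real.le_log_iff_exp_le (by linarith)]
    have := Real.exp_one_lt_d9
    linarith
  rw [← Real.sqrt_one]
  exact Real.sqrt_le_sqrt h1

/-- The arithmetic of the parameters: the noise level is comparable with its target, it
dominates the error of the BDD instance, and the noise is small at the scale of the query. -/
theorem noise_parameters (hm : 6 ≤ m) {α lam s ε : ℝ} (hα : 0 ≤ α)
    (hαc : α ≤ (1 / 2000000) / (m * √(Real.log m))) (hlam : 0 < lam) (hs1 : s ≤ lam)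
    (hs2 : lam ≤ 2 * s) (hε : 0 ≤ ε) (hεα : ε ≤ α * lam) :
    50 * (α * lam * m * √(Real.log m)) ≤ s * (100 * α * m * sqrtLogCount m) ∧
    s * (100 * α * m * sqrtLogCount m) ≤ 400 * (α * lam * m * √(Real.log m)) ∧
    2500 * (m * ε ^ 2) ≤ (s * (100 * α * m * sqrtLogCount m)) ^ 2 ∧
    200 * m * (ε ^ 2 + (s * (100 * α * m * sqrtLogCount m)) ^ 2) ≤ m * (s / 100) ^ 2 ∧
    α ≤ 1 / 2000000 := by
  have hm' : (6 : ℝ) ≤ m := by exact_mod_cast hm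
  have hlogm := one_le_sqrt_log hm
  obtain ⟨hq1, hq2⟩ := sqrtLogCount_bounds m (by omega)
  set L := √(Real.log m) with hL
  have hL0 : 0 ≤ L := Real.sqrt_nonneg _
  have hq : 1 ≤ m * L := by nlinarith
  have hαm : α * (m * L) ≤ 1 / 2000000 := by
    rwa [le_div_iff₀ (by linarith)] at hαc
  have hs0 : 0 < s := by linarith
  have hαc' : α ≤ 1 / 2000000 := by nlinarith
  -- The constants 50 and 400 are 100 times 1/2 (from lam ≤ 2 s) and 100 times 4 (from the
  -- approximation of the square root).
  have hlow : 50 * (α * lam * m * L) ≤ s * (100 * α * m * sqrtLogCount m) := by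
    have h1 : lam * L ≤ 2 * s * sqrtLogCount m := mul_le_mul hs2 hq1 hL0 (by linarith)
    have h2 : 0 ≤ 50 * α * m := by positivity
    nlinarith [mul_le_mul_of_nonneg_left h1 h2]
  have hup : s * (100 * α * m * sqrtLogCount m) ≤ 400 * (α * lam * m * L) := by
    have h1 : s * sqrtLogCount m ≤ lam * (4 * L) :=
      mul_le_mul hs1 hq2 (Nat.cast_nonneg _) hlam.le
    have h2 : 0 ≤ 100 * α * m := by positivity
    nlinarith [mul_le_mul_of_nonneg_left h1 h2]
  have hσ0 : 0 ≤ s * (100 * α * m * sqrtLogCount m) := by positivity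
  refine ⟨hlow, hup, ?_, ?_, hαc'⟩
  · have h1 : 50 * (α * lam * m) ≤ s * (100 * α * m * sqrtLogCount m) := by
      refine le_trans ?_ hlow
      have : 0 ≤ α * lam * m := by positivity
      nlinarith
    have h2 : (50 * (α * lam * m)) ^ 2 ≤ (s * (100 * α * m * sqrtLogCount m)) ^ 2 :=
      pow_le_pow_left₀ (by positivity) h1 2
    have h3 : ε ^ 2 ≤ (α * lam) ^ 2 := pow_le_pow_left₀ hε hεα 2
    have h4 : (m : ℝ) * ε ^ 2 ≤ m ^ 2 * (α * lam) ^ 2 :=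
      mul_le_mul (by nlinarith) h3 (sq_nonneg _) (by positivity)
    nlinarith
  · have h1 : s * (100 * α * m * sqrtLogCount m) ≤ lam / 5000 := by
      refine hup.trans ?_
      have := mul_le_mul_of_nonneg_right hαm hlam.le
      nlinarith
    have h2 : (s * (100 * α * m * sqrtLogCount m)) ^ 2 ≤ (lam / 5000) ^ 2 :=
      pow_le_pow_left₀ hσ0 h1 2
    have h3 : ε ≤ lam / 2000000 := hεα.trans (by nlinarith)
    have h4 : ε ^ 2 ≤ (lam / 2000000) ^ 2 := pow_le_pow_left₀ hε h3 2
    have h5 : lam ^ 2 ≤ (2 * s) ^ 2 := pow_le_pow_left₀ hlam.le hs2 2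
    -- With lam ≤ 2 s the left side is about 200 · 4 s²/5000² = 3.2 · 10⁻⁵ s², below 10⁻⁴ s².
    have h6 : 200 * (ε ^ 2 + (s * (100 * α * m * sqrtLogCount m)) ^ 2) ≤ (s / 100) ^ 2 := by
      nlinarith
    nlinarith [mul_le_mul_of_nonneg_left h6 (by linarith : (0 : ℝ) ≤ m)]

instance (m : ℕ) (σ : ℝ) : IsProbabilityMeasure (gaussianNoise m σ) := by
  unfold gaussianNoise
  infer_instance

theorem tvDist_joint_le (hm : 0 < m) (B : Matrix (Fin d) (Fin d) ℝ) {e : Fin d → ℝ} {σ : ℝ}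
    (hσ : 2500 * (m * l2norm e ^ 2) ≤ σ ^ 2) :
    tvDist (tapeLaw.map fun ω => (designRows k m n B ω, noiseVec k m e σ ω))
      ((tapeLaw.map (designRows k m n B)).prod (gaussianNoise m σ)) ≤ 1 / 2 := by
  refine Real.sSup_le ?_ (by norm_num)
  rintro r ⟨A, hA, rfl⟩
  rw [designRows_eq]
  exact abs_joint_sub_le hm hσ (measurable_rows (B * Gsparse d k n)) hA

/-- The joint statement with a constant in place of the design gives the marginal law. -/
theorem tvDist_noise_le (hm : 0 < m) {e : Fin d → ℝ} {σ : ℝ}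
    (hσ : 2500 * (m * l2norm e ^ 2) ≤ σ ^ 2) :
    tvDist (tapeLaw.map (noiseVec k m e σ)) (gaussianNoise m σ) ≤ 1 / 2 := by
  refine Real.sSup_le ?_ (by norm_num)
  rintro r ⟨A, hA, rfl⟩
  have hF : Measurable fun _ : Fin (m - k) → Fin d → ℝ => () := measurable_const
  have h := abs_joint_sub_le hm hσ hF (MeasurableSet.univ.prod hA)
  rw [map_measureReal_apply (measurable_const.prodMk (measurable_noiseVec e σ))
    (MeasurableSet.univ.prod hA), measureReal_prod_prod, Measure.map_const] at h
  rw [map_measureReal_apply (measurable_noiseVec e σ) hA]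
  simpa [Set.mk_preimage_prod] using h

end

end

/-! ### The reduction theorem. -/

theorem mainTheorem6 :
    -- one program, and universal constants
    ∃ (P : Prog) (C₀ C : ℕ) (c δ₁ δ₂ σ₁ σ₂ : ℝ),
      0 < c ∧ 0 < δ₁ ∧ 0 < δ₂ ∧ 0 < σ₁ ∧ 0 < σ₂ ∧
      ∀ d k m n ℓ : ℕ, 1 ≤ d → k ∣ d → C₀ * d ≤ m → n = k * 2 ^ (d / k) →
        -- running time, on every input, for every random tape and every oracle
        (∀ (α : ℝ) (B : Matrix (Fin d) (Fin d) ℝ) (t : Fin d → ℝ) (ω : ℕ → ℝ)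
          (O : SLROracle m n),
          (P.run ω O (initState k m n ℓ α B t)).time ≤ C * (n + m) ^ C * (ℓ + 1)) ∧
        ∀ (α : ℝ) (B : Matrix (Fin d) (Fin d) ℝ) (t z : Fin d → ℝ),
          0 ≤ α → α ≤ c / (m * √(Real.log m)) →
          (2 : ℝ)⁻¹ ^ ℓ ≤ lambdaBin B → lambdaBin B ≤ 2 ^ ℓ →
          IsBinaryBDD α B t z →
          -- the resulting instance `q ω`, which is the query number `i` of the program
          ∃ (i : ℕ) (δ γ σ : ℝ) (θ : Fin n → ℝ)
            (X₁ : (ℕ → ℝ) → Fin (m - k) → EuclideanSpace ℝ (Fin n))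
            (y w : (ℕ → ℝ) → Fin m → ℝ) (q : (ℕ → ℝ) → SLRInstance m n),
            (∀ ω, q ω = ⟨stackRows (X₁ ω) (γ • Gpartite k n), y ω, δ⟩) ∧
            (∀ (ω : ℕ → ℝ) (O : SLROracle m n),
              (P.run ω O (initState k m n ℓ α B t)).queries[i]? = some (q ω)) ∧
            -- its parameter and its design matrix
            δ₁ * lambdaBin B ≤ δ ∧ δ ≤ δ₂ * lambdaBin B ∧
            Measurable X₁ ∧
            tapeLaw.map X₁ = Measure.pi (fun _ : Fin (m - k) => multivariateGaussian 0
              ((Gsparse d k n).transpose * B.transpose * B * Gsparse d k n)) ∧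
            -- its noise
            IsSparse k θ ∧
            Measurable w ∧ (∀ ω, (q ω).X.mulVec θ + w ω = y ω) ∧
            σ₁ * (α * lambdaBin B * m * √(Real.log m)) ≤ σ ∧
            σ ≤ σ₂ * (α * lambdaBin B * m * √(Real.log m)) ∧
            tvDist (tapeLaw.map w) (gaussianNoise m σ) ≤ 1 / 2 ∧
            tvDist (tapeLaw.map fun ω => (X₁ ω, w ω))
              ((tapeLaw.map X₁).prod (gaussianNoise m σ)) ≤ 1 / 2 ∧
            -- success with probability at least 9/10
            ∃ E : Set (ℕ → ℝ), MeasurableSet E ∧ 9 / 10 ≤ tapeLaw.real E ∧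
              ∀ ω ∈ E, (∃ θ' : Fin n → ℝ, (q ω).IsSolution k θ') ∧
                ∀ O : SLROracle m n, (q ω).IsSolution k (O (q ω)) →
                  (P.run ω O (initState k m n ℓ α B t)).output d = z := by
  obtain ⟨C, hC⟩ : ∃ C : ℕ, 10000 ≤ C := ⟨_, le_rfl⟩
  -- The bounds 1/200 and 1/100 on δ/λ come from δ = s/100 with λ/2 ≤ s ≤ λ.
  refine ⟨bddProg, 6, C, 1 / 2000000, 1 / 200, 1 / 100, 50, 400, by norm_num, by norm_num,
    by norm_num, by norm_num, by norm_num, fun d k m n ℓ hd hk hm hn =>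
      ⟨fun α B t ω O => bddProg_time ω O hd hm α B t hC, ?_⟩⟩
  intro α B t z hα hαc hl1 hl2 hbdd
  obtain ⟨hz, e, ht, he⟩ := id hbdd
  have hm6 : 6 ≤ m := by omega
  have hm0 : (6 : ℝ) ≤ m := by exact_mod_cast hm6
  have hlam : 0 < lambdaBin B := lt_of_lt_of_le (by positivity) hl1
  obtain ⟨r, hr, hs1, hs2⟩ := exists_scale hl1 hl2
  have hs0 := scaleAt_pos ℓ r
  obtain ⟨hσ1, hσ2, hσe, hσw, hα1⟩ :=
    noise_parameters hm6 hα hαc hlam hs1 hs2 (l2norm_nonneg e) he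
  obtain ⟨θ, hθ, hG, hP⟩ := exists_sparse_preimage hd hk hn hz
  obtain ⟨E, hE, hE9, hgood⟩ := exists_goodTape hd hk hm B z e
  have hnoise := fun ω => design_add_noise (k := k) (m := m) (α := α) (s := scaleAt ℓ r)
    B ht hG hP ω
  have hsmall : ∀ ω ∈ E, l2norm (noiseVec k m e
      (scaleAt ℓ r * (100 * α * m * sqrtLogCount m)) ω) ^ 2 ≤ m * (scaleAt ℓ r / 100) ^ 2 :=
    fun ω hω => (l2norm_noiseVec_le B (hgood ω hω) _).trans hσw
  refine ⟨r, scaleAt ℓ r / 100, gammaBin m B, scaleAt ℓ r * (100 * α * m * sqrtLogCount m), θ,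
    designRows k m n B, noisyResponse k m α B t (scaleAt ℓ r),
    noiseVec k m e (scaleAt ℓ r * (100 * α * m * sqrtLogCount m)),
    scaleQuery k m n α B t (scaleAt ℓ r), fun ω => rfl, fun ω O => ?_, by linarith, by linarith,
    measurable_designRows B, map_designRows B, hθ, measurable_noiseVec e _, hnoise, hσ1, hσ2,
    tvDist_noise_le (by omega) hσe, tvDist_joint_le (by omega) B hσe, E, hE, hE9,
    fun ω hω => ⟨⟨θ, hθ, ?_⟩, fun O hO => ?_⟩⟩
  · rw [(bddProg_run_spec ω O hd hk hn α B t).1, List.getElem?_map, List.getElem?_range hr]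
    rfl
  · have : (designMatrix k m n B ω).mulVec θ - noisyResponse k m α B t (scaleAt ℓ r) ω =
        -noiseVec k m e (scaleAt ℓ r * (100 * α * m * sqrtLogCount m)) ω := by
      rw [← hnoise ω]
      abel
    rw [div_le_iff₀ (by linarith)]
    simp only [scaleQuery, this]
    have hneg : ∀ v : Fin m → ℝ, l2norm (-v) ^ 2 = l2norm v ^ 2 := fun v => by
      simp [l2norm_sq]
    rw [hneg]
    exact (hsmall ω hω).trans_eq (mul_comm _ _)
  · obtain ⟨hres, hmin⟩ := sqResidual_lt_of_isBinaryBDD B (by linarith) hlam hbdd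
    refine (bddProg_run_spec ω O hd hk hn α B t).2 z (hres.trans_lt ?_) hmin r hr
      (decode_of_isSolution hd hk hn hm B hz ht hs0 hs1 (hgood ω hω) (hsmall ω hω) hO)
    -- The initial record γ exceeds the residual of z: (α λ)² ≤ λ² ≤ 4 ‖B‖_F² < γ.
    have h4 := lambdaBin_sq_le hd B
    have h5 : (α * lambdaBin B) ^ 2 ≤ lambdaBin B ^ 2 :=
      pow_le_pow_left₀ (by positivity) (by nlinarith) 2
    have h6 : (0 : ℝ) ≤ ∑ a, ∑ c, B a c * B a c :=
      Finset.sum_nonneg fun a _ => Finset.sum_nonneg fun c _ => mul_self_nonneg _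
    unfold gammaBin
    nlinarith
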